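/- **Setting.** Let $C$ be a site, $\mathsf T$ the topos of sheaves of sets on $C$, and $A$, $B$ abelian sheaves on $C$, with tensor product $A\otimes B$ (the sheafification of $V\mapsto A(V)\otimes_{\mathbb Z}B(V)$). The Heisenberg extension is the central extension of sheaves of groups $$0\to A\otimes B\to H_{A,B}\to A\times B\to 0,\qquad (a,b,t)(a',b',t')=(a+a',\,b+b',\,t+t'+a\otimes b').$$ **Notation.** Put $G=A\times B$ and $M=A\otimes B$. Let $\mathrm B_G$ be the topos of left $G$-objects of $\mathsf T$, and regard $M$ as an abelian group object of $\mathrm B_G$ with trivial action. The class of the extension is the class in $H^2(\mathrm B_G,M)$ of the gerbe of liftings of the universal $G$-torsor of $\mathrm B_G$ to an $H_{A,B}$-torsor. It is computed on hypercovers $U$ of $\mathrm B_G$ by the cocycles $e_{01}e_{12}e_{02}^{-1}$, where $e$ is a section of $H_{A,B}$ over $U_1$ which lifts the transition function of the universal torsor relative to a trivialization over $U_0$. For a simplicial sheaf of sets $X$ let $\mathbb H^i(X,M)=\mathrm{Ext}^i(\mathbb Z[X]^\sim,M)$, where $\mathbb Z[X]^\sim$ is the complex of free abelian sheaves $\mathbb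 Z[X_n]$ with the alternating sums of the faces as differentials. Let $K(M,n)$ be the simplicial abelian sheaf which corresponds to $M[n]$ under the Dold–Kan correspondence, and $\iota^n_M\in\mathbb H^n(K(M,n),M)$ its fundamental class. The homotopy class of a map $f:X\to K(M,n)$ corresponds to $f^*\iota^n_M\in\mathbb H^n(X,M)$. Let $$\delta_{1,1}:K(A,1)\times K(B,1)\to K(A\otimes B,2)$$ be the map $(x,y)\mapsto x\otimes y$ to the diagonal simplicial tensor product $K(A,1)\otimes K(B,1)$, followed by the map of simplicial abelian sheaves which corresponds under Dold–Kan to the Alexander–Whitney map. **Theorem.** 1. The coordinate $1$-cocycles $(a,b)\mapsto a$ and $(a,b)\mapsto b$ of $BG$ define an isomorphism of simplicial sheaves $\kappa:BG=K(A\times B,1)\to K(A,1)\times K(B,1)$, where $BG$ is the classifying simplicial sheaf of $G$, with $B_nG=G^n$. 2. The composite $\delta_{1,1}\circ\kappa: K(A\times B,1)\to K(A\otimes B,2)$ is given in degree $2$ by the cocycle $$(A\times B)\times(A\times B)\to A\otimes B,\qquad (a,b,a',b')\mapsto a\otimes b'.$$ 3. Let $EG$ be the simplicial object of $\mathrm B_G$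 with $E_nG=P^{n+1}$, where $P$ is the universal torsor. The augmentation of $EG$ and the projection $EG\to BG$ induce bijections $$H^2(\mathrm B_G,M)\to\mathbb H^2(EG,M)\leftarrow\mathbb H^2(BG,M)$$ (the middle term is computed in $\mathrm B_G$), hence an identification $H^2(\mathrm B_G,M)\cong\mathbb H^2(K(A\times B,1),A\otimes B)$. 4. The class of the Heisenberg extension in $H^2(\mathrm B_G,M)$ exists and is unique, and under this identification it is equal to the class $$\kappa^*\delta_{1,1}^*\,\iota^2_{A\otimes B}\in\mathbb H^2(K(A\times B,1),A\otimes B)$$ of the cup-product map $\delta_{1,1}$, that is, to $\delta_{1,1}(\iota_A^1\times\iota_B^1)=\iota_A^1\otimes\iota_B^1$. -/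

import Mathlib

open CategoryTheory Opposite Simplicial
universe w w' w'' v u
namespace HeisenbergCup
noncomputable section

section Complexes
variable {A : Type*} [Category* A] [Abelian A]

/-- A homomorphism `K_n ⟶ M` vanishing on boundaries, as a map of complexes `K ⟶ M[n]`; the chain
complex `K` is seen as a cochain complex with `K_n` in degree `-n`. -/
def extendToSingle (K : ChainComplex A ℕ) {M : A} {n : ℕ} (φ : K.X n ⟶ M)
    (hφ : K.d (n + 1) n ≫ φ = 0) : K.extend ComplexShape.embeddingDownNat ⟶
      (HomologicalComplex.single A (ComplexShape.up ℤ) (-(n : ℤ))).obj M :=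
  HomologicalComplex.mkHomToSingle
    ((K.extendXIso ComplexShape.embeddingDownNat (i := n) rfl).hom ≫ φ) (by
      intro i hi
      have hi' : ComplexShape.embeddingDownNat.f (n + 1) = i := by
        rw [ComplexShape.up_Rel] at hi
        change -((n + 1 : ℕ) : ℤ) = i
        omega
      have h := K.extend_d_eq ComplexShape.embeddingDownNat hi'
        (j := n) (j' := -(n : ℤ)) rfl
      rw [h, Category.assoc, Category.assoc]
      erw [Iso.inv_hom_id_assoc, hφ, Limits.comp_zero])

end Complexes

section Basic
variable {C : Type u} [Category.{v} C] (J : GrothendieckTopology C)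

/-- Sheaves of sets on the site `(C, J)`: the topos of the site. -/
abbrev SetSheaf := Sheaf J (Type (max u v))

/-- Abelian sheaves on the site `(C, J)`. -/
abbrev AbSheaf := Sheaf J AddCommGrpCat.{max u v}

/-- The underlying sheaf of sets of an abelian sheaf. -/
abbrev forgetAb : AbSheaf J ⥤ SetSheaf J := sheafCompose J (forget AddCommGrpCat.{max u v})

/-- The free abelian sheaf `ℤ[X]` on a sheaf of sets `X`. -/
abbrev freeAb : SetSheaf J ⥤ AbSheaf J :=
  Sheaf.composeAndSheafify J AddCommGrpCat.free.{max u v}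

/-- The adjunction between `ℤ[-]` and the forgetful functor. -/
abbrev freeAdj : freeAb J ⊣ forgetAb J := Sheaf.adjunction J AddCommGrpCat.adj.{max u v}


variable {J}

lemma free_hom_ext {X : SetSheaf J} {M : AbSheaf J} {f g : (freeAb J).obj X ⟶ M}
    (h : ∀ (V : Cᵒᵖ) (x : X.obj.obj V),
      f.hom.app V (((freeAdj J).unit.app X).hom.app V x) =
        g.hom.app V (((freeAdj J).unit.app X).hom.app V x)) : f = g := by
  apply ((freeAdj J).homEquiv _ _).injective
  rw [Adjunction.homEquiv_unit, Adjunction.homEquiv_unit]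
  ext V x
  exact h V x

lemma free_lift_unit {X : SetSheaf J} {M : AbSheaf J} (z : X ⟶ (forgetAb J).obj M)
    (V : Cᵒᵖ) (x : X.obj.obj V) :
    (((freeAdj J).homEquiv _ _).symm z).hom.app V (((freeAdj J).unit.app X).hom.app V x) =
      z.hom.app V x := by
  have := ((freeAdj J).homEquiv X M).apply_symm_apply z
  rw [Adjunction.homEquiv_unit] at this
  conv_rhs => rw [← this]
  rfl

lemma free_map_unit {X Y : SetSheaf J} (f : X ⟶ Y) (V : Cᵒᵖ) (x : X.obj.obj V) :
    ((freeAb J).map f).hom.app V (((freeAdj J).unit.app X).hom.app V x) =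
      ((freeAdj J).unit.app Y).hom.app V (f.hom.app V x) := by
  have := (freeAdj J).unit.naturality f
  have h2 := congrArg (fun k => k.hom.app V x) this
  exact h2.symm


/-- The chain complex `ℤ[X]~` of a simplicial sheaf of sets `X`: it is `ℤ[X_n]` in degree `n`,
with the alternating sum of the faces as differential. -/
abbrev freeChain : SimplicialObject (SetSheaf J) ⥤ ChainComplex (AbSheaf J) ℕ :=
  (SimplicialObject.whiskering _ _).obj (freeAb J) ⋙
    AlgebraicTopology.alternatingFaceMapComplex (AbSheaf J)

/-- The same complex as a cochain complex indexed by `ℤ`: `ℤ[X_n]` sits in degree `-n`. -/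
abbrev freeComplex (X : SimplicialObject (SetSheaf J)) : CochainComplex (AbSheaf J) ℤ :=
  (freeChain.obj X).extend ComplexShape.embeddingDownNat

/-- Functoriality of `ℤ[X]~` in `X`. -/
abbrev freeComplexMap {X Y : SimplicialObject (SetSheaf J)} (f : X ⟶ Y) :
    freeComplex X ⟶ freeComplex Y :=
  HomologicalComplex.extendMap (freeChain.map f) ComplexShape.embeddingDownNat

/-- The value, as an element of the group `M(V)`, of a map of sheaves of sets `X ⟶ M` at a section
of `X` over `V`. -/
def valAb {X : SetSheaf J} {M : AbSheaf J} (z : X ⟶ (forgetAb J).obj M) (V : Cᵒᵖ)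
    (x : X.obj.obj V) : M.obj.obj V :=
  z.hom.app V x

/-- An `n`-cocycle of a simplicial sheaf of sets `X` with values in `M`: a map of sheaves of sets
`X_n ⟶ M` the alternating sum of whose composites with the faces `X_{n+1} ⟶ X_n` vanishes. -/
structure Cocycle (X : SimplicialObject (SetSheaf J)) (M : AbSheaf J) (n : ℕ) where
  toHom : X _⦋n⦌ ⟶ (forgetAb J).obj M
  closed : ∀ (V : Cᵒᵖ) (x : (X _⦋n + 1⦌).obj.obj V),
    ∑ k : Fin (n + 2), (-1 : ℤ) ^ (k : ℕ) •
      valAb toHom V ((X.δ k).hom.app V x) = 0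

/-- The homomorphism of abelian sheaves `ℤ[X_n] ⟶ M` extending a cocycle. -/
def Cocycle.lin {X : SimplicialObject (SetSheaf J)} {M : AbSheaf J} {n : ℕ}
    (z : Cocycle X M n) : (freeChain.obj X).X n ⟶ M :=
  ((freeAdj J).homEquiv _ _).symm z.toHom

lemma sum_hom_app {F G : AbSheaf J} {ι : Type*} (s : Finset ι) (f : ι → (F ⟶ G)) (V : Cᵒᵖ)
    (x : F.obj.obj V) : (∑ i ∈ s, f i).hom.app V x = ∑ i ∈ s, (f i).hom.app V x := by
  classical
  induction s using Finset.induction_on with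
  | empty => rfl
  | insert a s ha ih => rw [Finset.sum_insert ha, Finset.sum_insert ha, ← ih]; rfl

lemma zsmul_hom_app {F G : AbSheaf J} (n : ℤ) (f : F ⟶ G) (V : Cᵒᵖ)
    (x : F.obj.obj V) : (n • f).hom.app V x = n • f.hom.app V x := by
  let ev : (F ⟶ G) →+ G.obj.obj V :=
    { toFun := fun g => g.hom.app V x
      map_zero' := rfl
      map_add' := fun _ _ => rfl }
  exact map_zsmul ev n f

lemma freeChain_d_comp (X : SimplicialObject (SetSheaf J)) (n : ℕ) {M : AbSheaf J}
    (φ : (freeAb J).obj (X _⦋n⦌) ⟶ M) :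
    (freeChain.obj X).d (n + 1) n ≫ φ =
      ∑ k : Fin (n + 2), (-1 : ℤ) ^ (k : ℕ) • ((freeAb J).map (X.δ k) ≫ φ) := by
  have h : (freeChain.obj X).d (n + 1) n =
      ∑ k : Fin (n + 2), (-1 : ℤ) ^ (k : ℕ) • (freeAb J).map (X.δ k) :=
    AlgebraicTopology.alternatingFaceMapComplex_obj_d _ _
  refine (congrArg (fun f : (freeAb J).obj (X _⦋n + 1⦌) ⟶ (freeAb J).obj (X _⦋n⦌) => f ≫ φ)
    h).trans ?_
  simp only [Preadditive.sum_comp, Preadditive.zsmul_comp]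

lemma Cocycle.d_lin {X : SimplicialObject (SetSheaf J)} {M : AbSheaf J} {n : ℕ}
    (z : Cocycle X M n) : (freeChain.obj X).d (n + 1) n ≫ z.lin = 0 := by
  refine (freeChain_d_comp X n z.lin).trans ?_
  apply free_hom_ext
  intro V x
  refine (sum_hom_app _ _ V _).trans (Eq.trans (Finset.sum_congr rfl fun k _ => ?_) (z.closed V x))
  refine (zsmul_hom_app _ _ V _).trans ?_
  congr 1
  refine Eq.trans ?_ (free_lift_unit z.toHom V ((X.δ k).hom.app V x))
  exact congrArg (fun y => z.lin.hom.app V y) (free_map_unit (X.δ k) V x)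

/-- The map of complexes `ℤ[X]~ ⟶ M[n]` defined by an `n`-cocycle. -/
def Cocycle.toComplex {X : SimplicialObject (SetSheaf J)} {M : AbSheaf J} {n : ℕ}
    (z : Cocycle X M n) :
    freeComplex X ⟶ (HomologicalComplex.single _ (ComplexShape.up ℤ) (-(n : ℤ))).obj M :=
  extendToSingle (freeChain.obj X) z.lin z.d_lin

section
variable [HasDerivedCategory.{w} (AbSheaf J)]

/-- The hypercohomology `ℍⁿ(X, M) = Extⁿ(ℤ[X]~, M) = Hom(ℤ[X]~, M[n])` (in the derived category of
abelian sheaves) of a simplicial sheaf of sets `X`. -/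
abbrev HH (X : SimplicialObject (SetSheaf J)) (M : AbSheaf J) (n : ℕ) : Type w :=
  DerivedCategory.Q.obj (freeComplex X) ⟶
    (DerivedCategory.singleFunctor (AbSheaf J) (-(n : ℤ))).obj M

/-- The class of a cocycle. -/
def Cocycle.cls {X : SimplicialObject (SetSheaf J)} {M : AbSheaf J} {n : ℕ}
    (z : Cocycle X M n) : HH X M n :=
  DerivedCategory.Q.map z.toComplex ≫
    (DerivedCategory.singleFunctorIsoCompQ (AbSheaf J) (-(n : ℤ))).inv.app M

/-- The pullback `f^* : ℍⁿ(Y, M) → ℍⁿ(X, M)` along a map of simplicial sheaves `f : X ⟶ Y`. -/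
def HH.pullback {X Y : SimplicialObject (SetSheaf J)} (f : X ⟶ Y) {M : AbSheaf J} {n : ℕ}
    (c : HH Y M n) : HH X M n :=
  DerivedCategory.Q.map (freeComplexMap f) ≫ c

end

/-- The constant abelian sheaf `ℤ`. -/
abbrev constZ (J : GrothendieckTopology C) : AbSheaf J :=
  (constantSheaf J AddCommGrpCat.{max u v}).obj (AddCommGrpCat.of (ULift ℤ))

/-- The section `1` of the constant sheaf `ℤ`. -/
def oneZ (V : Cᵒᵖ) : (constZ J).obj.obj V :=
  (toSheafify J ((Functor.const Cᵒᵖ).obj (AddCommGrpCat.of (ULift.{max u v} ℤ)))).app V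
    (ULift.up 1)

lemma oneZ_map {V W : Cᵒᵖ} (f : V ⟶ W) :
    (constZ J).obj.map f (oneZ V) = oneZ W := by
  have := (toSheafify J ((Functor.const Cᵒᵖ).obj
    (AddCommGrpCat.of (ULift.{max u v} ℤ)))).naturality f
  exact (congrArg (fun k => k (ULift.up 1)) this).symm

/-- The augmentation `ℤ[X] ⟶ ℤ`, sending each section of `X` to `1`. -/
def augmentation (X : SetSheaf J) : (freeAb J).obj X ⟶ constZ J :=
  ((freeAdj J).homEquiv X (constZ J)).symm
    ⟨{ app := fun V => TypeCat.ofHom fun _ => oneZ V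
       naturality := fun V W f => by
         ext x
         exact (oneZ_map f).symm }⟩

lemma augmentation_unit (X : SetSheaf J) (V : Cᵒᵖ) (x : X.obj.obj V) :
    (augmentation X).hom.app V (((freeAdj J).unit.app X).hom.app V x) = oneZ V :=
  free_lift_unit _ V x

lemma map_augmentation {X Y : SetSheaf J} (f : X ⟶ Y) :
    (freeAb J).map f ≫ augmentation Y = augmentation X := by
  apply free_hom_ext
  intro V x
  refine Eq.trans ?_ (augmentation_unit X V x).symm
  refine Eq.trans ?_ (augmentation_unit Y V (f.hom.app V x))
  exact congrArg (fun y => (augmentation Y).hom.app V y) (free_map_unit f V x)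

/-- The augmentation `ℤ[X]~ ⟶ ℤ[0]` of the complex of a simplicial sheaf. -/
def augComplex (X : SimplicialObject (SetSheaf J)) :
    freeComplex X ⟶ (HomologicalComplex.single _ (ComplexShape.up ℤ) 0).obj (constZ J) :=
  extendToSingle (freeChain.obj X) (n := 0) (augmentation (X _⦋0⦌)) (by
    refine (freeChain_d_comp X 0 _).trans ?_
    rw [Fin.sum_univ_two, map_augmentation, map_augmentation]
    simp
    rfl)

end Basic

section Tensor
variable {C : Type u} [Category.{v} C] {J : GrothendieckTopology C}

lemma tensor_addHom_ext {P Q R : Type*} [AddCommGroup P] [AddCommGroup Q] [AddCommGroup R]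
    {f g : TensorProduct ℤ P Q →+ R}
    (h : ∀ a b, f (TensorProduct.tmul ℤ a b) = g (TensorProduct.tmul ℤ a b)) : f = g := by
  ext x
  induction x using TensorProduct.induction_on with
  | zero => rw [map_zero, map_zero]
  | tmul a b => exact h a b
  | add x y hx hy => rw [map_add, map_add, hx, hy]

/-- The presheaf `V ↦ A(V) ⊗_ℤ B(V)`. -/
def tensorPresheaf (A B : AbSheaf J) : Cᵒᵖ ⥤ AddCommGrpCat.{max u v} where
  obj V := AddCommGrpCat.of (TensorProduct ℤ (A.obj.obj V) (B.obj.obj V))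
  map f := AddCommGrpCat.ofHom (TensorProduct.map (A.obj.map f).hom.toIntLinearMap
    (B.obj.map f).hom.toIntLinearMap).toAddMonoidHom
  map_id V := AddCommGrpCat.hom_ext (tensor_addHom_ext fun a b => by simp)
  map_comp f g := AddCommGrpCat.hom_ext (tensor_addHom_ext fun a b => by simp)

/-- The tensor product `A ⊗ B` of abelian sheaves. -/
def tensor (A B : AbSheaf J) : AbSheaf J :=
  (presheafToSheaf J _).obj (tensorPresheaf A B)

/-- The biadditive map `A(V) × B(V) → (A ⊗ B)(V)`, `(a, b) ↦ a ⊗ b`. -/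
def tmul (A B : AbSheaf J) (V : Cᵒᵖ) :
    A.obj.obj V →+ B.obj.obj V →+ (tensor A B).obj.obj V :=
  AddMonoidHom.mk' (fun a => AddMonoidHom.mk'
      (fun b => ((toSheafify J (tensorPresheaf A B)).app V).hom (TensorProduct.tmul ℤ a b))
      (fun b b' => by
        rw [TensorProduct.tmul_add]
        exact map_add ((toSheafify J (tensorPresheaf A B)).app V).hom _ _))
    (fun a a' => by
      ext b
      refine (congrArg ((toSheafify J (tensorPresheaf A B)).app V).hom
        (TensorProduct.add_tmul a a' b)).trans ?_
      exact map_add ((toSheafify J (tensorPresheaf A B)).app V).hom _ _)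

lemma tmul_restrict (A B : AbSheaf J) {V W : Cᵒᵖ} (f : V ⟶ W) (a : A.obj.obj V)
    (b : B.obj.obj V) :
    (tensor A B).obj.map f (tmul A B V a b) = tmul A B W (A.obj.map f a) (B.obj.map f b) := by
  have h := (toSheafify J (tensorPresheaf A B)).naturality f
  exact (congrArg (fun k => k.hom (TensorProduct.tmul ℤ a b)) h).symm

lemma tensor_hom_ext {A B M : AbSheaf J} {f g : tensor A B ⟶ M}
    (h : ∀ (V : Cᵒᵖ) (a : A.obj.obj V) (b : B.obj.obj V),
      f.hom.app V (tmul A B V a b) = g.hom.app V (tmul A B V a b)) : f = g := by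
  apply Sheaf.hom_ext
  apply sheafify_hom_ext J _ _ M.property
  refine NatTrans.ext (funext fun V => AddCommGrpCat.hom_ext (tensor_addHom_ext fun a b => ?_))
  exact h V a b

/-- The map of presheaves `f ⊗ g`. -/
def tensorPresheafMap {A A' B B' : AbSheaf J} (f : A ⟶ A') (g : B ⟶ B') :
    tensorPresheaf A B ⟶ tensorPresheaf A' B' where
  app V := AddCommGrpCat.ofHom (TensorProduct.map (f.hom.app V).hom.toIntLinearMap
    (g.hom.app V).hom.toIntLinearMap).toAddMonoidHom
  naturality _ _ k := AddCommGrpCat.hom_ext (tensor_addHom_ext fun a b =>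
    congrArg₂ (fun p q => TensorProduct.tmul ℤ p q)
      (congrArg (fun l => l.hom a) (f.hom.naturality k))
      (congrArg (fun l => l.hom b) (g.hom.naturality k)))

/-- The tensor product of two homomorphisms of abelian sheaves. -/
def tensorMap {A A' B B' : AbSheaf J} (f : A ⟶ A') (g : B ⟶ B') : tensor A B ⟶ tensor A' B' :=
  (presheafToSheaf J _).map (tensorPresheafMap f g)

lemma tensorMap_tmul {A A' B B' : AbSheaf J} (f : A ⟶ A') (g : B ⟶ B') (V : Cᵒᵖ)
    (a : A.obj.obj V) (b : B.obj.obj V) :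
    (tensorMap f g).hom.app V (tmul A B V a b) =
      tmul A' B' V (f.hom.app V a) (g.hom.app V b) := by
  have h := toSheafify_naturality J (tensorPresheafMap f g)
  exact (congrArg (fun k => (k.app V).hom (TensorProduct.tmul ℤ a b)) h).symm

end Tensor

section Groups

/-- The Heisenberg group of a biadditive map `β : P × Q → R`: the set `P × Q × R` with
`(a, b, t) (a', b', t') = (a + a', b + b', t + t' + β a b')`. -/
@[ext]
structure HeisenbergGroup {P Q R : Type*} [AddCommGroup P] [AddCommGroup Q] [AddCommGroup R]
    (β : P →+ Q →+ R) where
  a : P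
  b : Q
  t : R

instance {P Q R : Type*} [AddCommGroup P] [AddCommGroup Q] [AddCommGroup R]
    (β : P →+ Q →+ R) : Group (HeisenbergGroup β) where
  mul x y := ⟨x.a + y.a, x.b + y.b, x.t + y.t + β x.a y.b⟩
  one := ⟨0, 0, 0⟩
  inv x := ⟨-x.a, -x.b, -x.t + β x.a x.b⟩
  mul_assoc x y z := HeisenbergGroup.ext (add_assoc _ _ _) (add_assoc _ _ _) (by
    change (x.t + y.t + β x.a y.b) + z.t + β (x.a + y.a) z.b =
      x.t + (y.t + z.t + β y.a z.b) + β x.a (y.b + z.b)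
    simp only [map_add, AddMonoidHom.add_apply]
    abel)
  one_mul x := HeisenbergGroup.ext (zero_add _) (zero_add _) (by
    change 0 + x.t + β 0 x.b = x.t
    simp)
  mul_one x := HeisenbergGroup.ext (add_zero _) (add_zero _) (by
    change x.t + 0 + β x.a 0 = x.t
    simp)
  inv_mul_cancel x := HeisenbergGroup.ext (neg_add_cancel _) (neg_add_cancel _) (by
    change (-x.t + β x.a x.b) + x.t + β (-x.a) x.b = 0
    simp)

/-- An `ι`-simplex of the classifying space of a group `G`: a family `g i j` of elements of `G`
with `g i j * g j k = g i k`, where `g i j` is the label of the edge from `i` to `j`. -/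
@[ext]
structure BarSimplex (ι : Type) (G : Type*) [Group G] where
  g : ι → ι → G
  mul_eq : ∀ i j k, g i j * g j k = g i k

/-- The simplex with edges `x_i⁻¹ x_j`, for a family `x` of elements of `G`. -/
def BarSimplex.ofVertices {ι : Type} {G : Type*} [Group G] (x : ι → G) : BarSimplex ι G :=
  ⟨fun i j => (x i)⁻¹ * x j, fun i j k => by group⟩

/-- `B_n G = G^n`: a simplex corresponds to the labels of its edges from `i` to `i + 1`. -/
def BarSimplex.equiv (n : ℕ) (G : Type*) [Group G] :
    BarSimplex (Fin (n + 1)) G ≃ (Fin n → G) where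
  toFun x i := x.g i.castSucc i.succ
  invFun y := BarSimplex.ofVertices (Fin.partialProd y)
  left_inv x := by
    have h1 : ∀ i, x.g i i = 1 := fun i => by simpa using x.mul_eq i i i
    have h0 : ∀ i : Fin (n + 1),
        Fin.partialProd (fun k : Fin n => x.g k.castSucc k.succ) i = x.g 0 i := by
      intro i
      induction i using Fin.induction with
      | zero => rw [Fin.partialProd_zero, h1]
      | succ i ih => rw [Fin.partialProd_succ, ih, x.mul_eq]
    ext i j
    change (Fin.partialProd (fun k : Fin n => x.g k.castSucc k.succ) i)⁻¹ *
      Fin.partialProd (fun k : Fin n => x.g k.castSucc k.succ) j = _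
    rw [h0, h0, inv_mul_eq_iff_eq_mul, x.mul_eq]
  right_inv y := by
    ext i
    change (Fin.partialProd y i.castSucc)⁻¹ * Fin.partialProd y i.succ = y i
    rw [Fin.partialProd_succ, inv_mul_cancel_left]

/-- Restriction of a simplex along a map of vertices. -/
def BarSimplex.comap {ι κ : Type} {G : Type*} [Group G] (r : ι → κ) (x : BarSimplex κ G) :
    BarSimplex ι G :=
  ⟨fun i j => x.g (r i) (r j), fun i j k => x.mul_eq (r i) (r j) (r k)⟩

/-- Functoriality in the group. -/
def BarSimplex.map {ι : Type} {G G' : Type*} [Group G] [Group G'] (φ : G →* G')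
    (x : BarSimplex ι G) : BarSimplex ι G' :=
  ⟨fun i j => φ (x.g i j), fun i j k => by rw [← map_mul, x.mul_eq]⟩

end Groups

section GroupSheaves
variable {C : Type u} [Category.{v} C] {J : GrothendieckTopology C}

/-- A presheaf of sets that is a locally determined part of a product of sheaves is a sheaf. -/
lemma isSheaf_of_coords {P : Cᵒᵖ ⥤ Type w} {ι : Type} (F : ι → Cᵒᵖ ⥤ Type w)
    (hF : ∀ i, Presieve.IsSheaf J (F i)) (c : ∀ i, P ⟶ F i)
    (inj : ∀ (V : Cᵒᵖ) (x y : P.obj V), (∀ i, (c i).app V x = (c i).app V y) → x = y)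
    (glue : ∀ (V : C) (S : Sieve V) (_ : S ∈ J V) (y : ∀ i, (F i).obj (op V)),
      (∀ (W : C) (f : W ⟶ V), S f → ∃ x : P.obj (op W), ∀ i, (c i).app _ x = (F i).map f.op (y i)) →
      ∃ x : P.obj (op V), ∀ i, (c i).app _ x = y i) :
    Presieve.IsSheaf J P := by
  intro V S hS x hx
  have hxi : ∀ i, (Presieve.FamilyOfElements.map x (c i)).Compatible := by
    intro i Y₁ Y₂ Z g₁ g₂ f₁ f₂ h₁ h₂ h
    refine (congrArg (fun k => k (x f₁ h₁)) ((c i).naturality g₁.op)).symm.trans ?_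
    refine Eq.trans ?_ (congrArg (fun k => k (x f₂ h₂)) ((c i).naturality g₂.op))
    exact congrArg ((c i).app _) (hx g₁ g₂ h₁ h₂ h)
  choose y hy hyu using fun i => hF i S hS _ (hxi i)
  obtain ⟨p, hp⟩ := glue V S hS y (fun W f hf => ⟨x f hf, fun i => (hy i f hf).symm⟩)
  refine ⟨p, fun W f hf => inj _ _ _ fun i => ?_, fun q hq => inj _ _ _ fun i => ?_⟩
  · refine (congrArg (fun k => k p) ((c i).naturality f.op)).trans ?_
    refine (congrArg ((F i).map f.op) (hp i)).trans ?_
    exact hy i f hf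
  · rw [hp i]
    apply hyu i
    intro W f hf
    refine (congrArg (fun k => k q) ((c i).naturality f.op)).symm.trans ?_
    exact congrArg ((c i).app _) (hq f hf)

/-- Sheaves of groups on the site `(C, J)`. -/
abbrev GrpSheaf (J : GrothendieckTopology C) := Sheaf J GrpCat.{max u v}

/-- The underlying sheaf of sets of a sheaf of groups. -/
abbrev forgetGrp : GrpSheaf J ⥤ SetSheaf J := sheafCompose J (forget GrpCat.{max u v})

lemma isSheaf_forgetAb (A : AbSheaf J) :
    Presieve.IsSheaf J (A.obj ⋙ forget AddCommGrpCat.{max u v}) :=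
  (isSheaf_iff_isSheaf_of_type _ _).1 ((forgetAb J).obj A).property

lemma isSheaf_forgetGrp (G : GrpSheaf J) :
    Presieve.IsSheaf J (G.obj ⋙ forget GrpCat.{max u v}) :=
  (isSheaf_iff_isSheaf_of_type _ _).1 (forgetGrp.obj G).property

/-- The product `A × B` of two abelian sheaves, as a (multiplicative) sheaf of groups. -/
def prodGrp (A B : AbSheaf J) : GrpSheaf J where
  obj :=
    { obj := fun V => GrpCat.of (Multiplicative (A.obj.obj V × B.obj.obj V))
      map := fun f => GrpCat.ofHom
        (AddMonoidHom.toMultiplicative ((A.obj.map f).hom.prodMap (B.obj.map f).hom))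
      map_id := fun V => GrpCat.hom_ext (MonoidHom.ext fun x => Prod.ext
        (congrArg (fun k => k.hom x.toAdd.1) (A.obj.map_id V))
        (congrArg (fun k => k.hom x.toAdd.2) (B.obj.map_id V)))
      map_comp := fun f g => GrpCat.hom_ext (MonoidHom.ext fun x => Prod.ext
        (congrArg (fun k => k.hom x.toAdd.1) (A.obj.map_comp f g))
        (congrArg (fun k => k.hom x.toAdd.2) (B.obj.map_comp f g))) }
  property := by
    rw [Presheaf.isSheaf_iff_isSheaf_forget J _ (forget GrpCat.{max u v}),
      isSheaf_iff_isSheaf_of_type]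
    refine isSheaf_of_coords (ι := Bool)
      (fun i => match i with
        | true => A.obj ⋙ forget _
        | false => B.obj ⋙ forget _)
      (fun i => match i with
        | true => isSheaf_forgetAb A
        | false => isSheaf_forgetAb B)
      (fun i => match i with
        | true => { app := fun V => TypeCat.ofHom fun x => x.toAdd.1 }
        | false => { app := fun V => TypeCat.ofHom fun x => x.toAdd.2 })
      (fun V x y h => Prod.ext (h true) (h false))
      (fun V S hS y _ => ⟨Multiplicative.ofAdd (y true, y false), fun i => ?_⟩)
    cases i <;> rfl

/-- The Heisenberg sheaf `H_{A,B}`. -/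
def heisenberg (A B : AbSheaf J) : GrpSheaf J where
  obj :=
    { obj := fun V => GrpCat.of (HeisenbergGroup (tmul A B V))
      map := fun {V W} f => GrpCat.ofHom (MonoidHom.mk'
        (fun x => ⟨A.obj.map f x.a, B.obj.map f x.b, (tensor A B).obj.map f x.t⟩)
        (fun x y => HeisenbergGroup.ext (map_add _ _ _) (map_add _ _ _) (by
          change (tensor A B).obj.map f (x.t + y.t + tmul A B V x.a y.b) =
            (tensor A B).obj.map f x.t + (tensor A B).obj.map f y.t +
              tmul A B W (A.obj.map f x.a) (B.obj.map f y.b)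
          rw [map_add, map_add, tmul_restrict])))
      map_id := fun V => GrpCat.hom_ext (MonoidHom.ext fun x => HeisenbergGroup.ext
        (congrArg (fun k => k.hom x.a) (A.obj.map_id V))
        (congrArg (fun k => k.hom x.b) (B.obj.map_id V))
        (congrArg (fun k => k.hom x.t) ((tensor A B).obj.map_id V)))
      map_comp := fun f g => GrpCat.hom_ext (MonoidHom.ext fun x => HeisenbergGroup.ext
        (congrArg (fun k => k.hom x.a) (A.obj.map_comp f g))
        (congrArg (fun k => k.hom x.b) (B.obj.map_comp f g))
        (congrArg (fun k => k.hom x.t) ((tensor A B).obj.map_comp f g))) }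
  property := by
    rw [Presheaf.isSheaf_iff_isSheaf_forget J _ (forget GrpCat.{max u v}),
      isSheaf_iff_isSheaf_of_type]
    refine isSheaf_of_coords (ι := Fin 3)
      (fun i => match i with
        | 0 => A.obj ⋙ forget _
        | 1 => B.obj ⋙ forget _
        | 2 => (tensor A B).obj ⋙ forget _)
      (fun i => match i with
        | 0 => isSheaf_forgetAb A
        | 1 => isSheaf_forgetAb B
        | 2 => isSheaf_forgetAb (tensor A B))
      (fun i => match i with
        | 0 => { app := fun V => TypeCat.ofHom fun x => x.a }
        | 1 => { app := fun V => TypeCat.ofHom fun x => x.b }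
        | 2 => { app := fun V => TypeCat.ofHom fun x => x.t })
      (fun V x y h => HeisenbergGroup.ext (h 0) (h 1) (h 2))
      (fun V S hS y _ => ⟨⟨y 0, y 1, y 2⟩, fun i => ?_⟩)
    fin_cases i <;> rfl

/-- A central extension `0 → M → E → G → 1` of a sheaf of groups `G` by an abelian sheaf `M`. -/
structure CentralExtension (M : AbSheaf J) (G : GrpSheaf J) where
  E : GrpSheaf J
  incl : ∀ V : Cᵒᵖ, Multiplicative (M.obj.obj V) →* E.obj.obj V
  incl_restrict : ∀ {V W : Cᵒᵖ} (f : V ⟶ W) (m : M.obj.obj V),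
    E.obj.map f (incl V (Multiplicative.ofAdd m)) = incl W (Multiplicative.ofAdd (M.obj.map f m))
  incl_injective : ∀ V, Function.Injective (incl V)
  incl_central : ∀ V m (e : E.obj.obj V), incl V m * e = e * incl V m
  proj : E ⟶ G
  exact : ∀ V (e : E.obj.obj V), proj.hom.app V e = 1 ↔ e ∈ (incl V).range
  locallySurjective : Presheaf.IsLocallySurjective J proj.hom

/-- The Heisenberg extension `0 → A ⊗ B → H_{A,B} → A × B → 0`. -/
def heisenbergExtension (A B : AbSheaf J) : CentralExtension (tensor A B) (prodGrp A B) where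
  E := heisenberg A B
  incl V := MonoidHom.mk' (fun m => ⟨0, 0, m.toAdd⟩) (fun m m' =>
    HeisenbergGroup.ext (add_zero _).symm (add_zero _).symm (by
      change m.toAdd + m'.toAdd = m.toAdd + m'.toAdd + tmul A B V 0 0
      simp))
  incl_restrict {V W} f m := HeisenbergGroup.ext (map_zero _) (map_zero _) rfl
  incl_injective V m m' h := congrArg HeisenbergGroup.t h
  incl_central V m e := HeisenbergGroup.ext (add_comm _ _) (add_comm _ _) (by
    change m.toAdd + e.t + tmul A B V 0 e.b = e.t + m.toAdd + tmul A B V e.a 0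
    simp [add_comm])
  proj := ⟨{ app := fun V => GrpCat.ofHom (MonoidHom.mk'
    (fun x => Multiplicative.ofAdd (x.a, x.b)) (fun _ _ => rfl)) }⟩
  exact V e := by
    constructor
    · intro h
      refine ⟨Multiplicative.ofAdd e.t, ?_⟩
      have h' : (e.a, e.b) = (0, 0) := h
      exact HeisenbergGroup.ext (congrArg Prod.fst h').symm (congrArg Prod.snd h').symm rfl
    · rintro ⟨m, rfl⟩
      rfl
  locallySurjective := ⟨fun {V} x => by
    refine J.superset_covering ?_ (J.top_mem _)
    intro W f _
    exact ⟨⟨((prodGrp A B).obj.map f.op x).toAdd.1, ((prodGrp A B).obj.map f.op x).toAdd.2, 0⟩, rfl⟩⟩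

/-- The classifying simplicial sheaf `BG` of a sheaf of groups `G`, with `B_n G = G^n`. -/
def classifying (G : GrpSheaf J) : SimplicialObject (SetSheaf J) where
  obj n :=
    { obj :=
        { obj := fun V => BarSimplex (Fin (n.unop.len + 1)) (G.obj.obj V)
          map := fun f => TypeCat.ofHom (BarSimplex.map (G.obj.map f).hom)
          map_id := fun V => by ext x; simp [BarSimplex.map]
          map_comp := fun f g => by ext x; simp [BarSimplex.map] }
      property := by
        rw [isSheaf_iff_isSheaf_of_type]
        refine isSheaf_of_coords (ι := Fin (n.unop.len + 1) × Fin (n.unop.len + 1))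
          (fun _ => G.obj ⋙ forget _) (fun _ => isSheaf_forgetGrp G)
          (fun i => { app := fun V => TypeCat.ofHom fun x => x.g i.1 i.2 })
          (fun V x y h => BarSimplex.ext (funext fun i => funext fun j => h (i, j)))
          (fun V S hS y hy => ⟨⟨fun i j => y (i, j), fun i j k => ?_⟩, fun i => rfl⟩)
        refine (isSheaf_forgetGrp G).isSeparated S hS |>.ext fun W f hf => ?_
        obtain ⟨x, hx⟩ := hy W f hf
        refine Eq.trans (map_mul (G.obj.map f.op).hom _ _) ?_
        have h1 := hx (i, j)
        have h2 := hx (j, k)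
        have h3 := hx (i, k)
        refine Eq.trans (congrArg₂ (· * ·) h1.symm h2.symm) (Eq.trans ?_ h3)
        exact x.mul_eq i j k }
  map r := ⟨{ app := fun V => TypeCat.ofHom (BarSimplex.comap (r.unop.toOrderHom)) }⟩

end GroupSheaves

section ClassifyingTopos
variable {C : Type u} [Category.{v} C] {J : GrothendieckTopology C}

/-- A site for the classifying topos `B_G`, the topos of left `G`-objects of the topos of sheaves:
it has the objects of `C`, and a morphism `V ⟶ W` is a pair of a morphism `f : V ⟶ W` of `C`
and a section `g ∈ G(V)`. A presheaf on it is a presheaf `F` on `C` with a left action of `G`: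
the pair `(f, g)` acts as `F(W) → F(V)`, `x ↦ g • f^* x`. -/
structure ClassifyingSite (G : GrpSheaf J) where
  base : C

/-- The morphisms of the classifying site. -/
@[ext]
structure ClassifyingSite.Hom {G : GrpSheaf J} (V W : ClassifyingSite G) where
  f : V.base ⟶ W.base
  g : G.obj.obj (op V.base)

instance (G : GrpSheaf J) : Category.{max u v} (ClassifyingSite G) where
  Hom := ClassifyingSite.Hom
  id V := ⟨𝟙 _, 1⟩
  comp φ ψ := ⟨φ.f ≫ ψ.f, φ.g * G.obj.map φ.f.op ψ.g⟩
  id_comp φ := ClassifyingSite.Hom.ext (Category.id_comp _) (by simp)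
  comp_id φ := ClassifyingSite.Hom.ext (Category.comp_id _) (by simp)
  assoc φ ψ χ := ClassifyingSite.Hom.ext (Category.assoc _ _ _) (by simp [mul_assoc])

/-- The projection from the classifying site to `C`, forgetting the sections of `G`. -/
def siteProj (G : GrpSheaf J) : ClassifyingSite G ⥤ C where
  obj V := V.base
  map φ := φ.f
  map_id _ := rfl
  map_comp _ _ := rfl

/-- The inclusion of `C` in the classifying site. Restriction along it forgets the action. -/
def siteIncl (G : GrpSheaf J) : C ⥤ ClassifyingSite G where
  obj V := ⟨V⟩
  map f := ⟨f, 1⟩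
  map_id _ := rfl
  map_comp f f' := ClassifyingSite.Hom.ext rfl (by
    change (1 : G.obj.obj _) = 1 * (G.obj.map f.op).hom 1
    simp)

lemma sieve_mem_iff {G : GrpSheaf J} {V : ClassifyingSite G} (S : Sieve V)
    {W : ClassifyingSite G} (φ : W ⟶ V) :
    S φ ↔ S (⟨φ.f, 1⟩ : ClassifyingSite.Hom W V) := by
  have key : ∀ (f : W.base ⟶ V.base) (g h : G.obj.obj (op W.base)),
      S (⟨f, g⟩ : ClassifyingSite.Hom W V) → S (⟨f, h⟩ : ClassifyingSite.Hom W V) := by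
    intro f g h hS
    have h2 := S.downward_closed hS (⟨𝟙 _, h * g⁻¹⟩ : ClassifyingSite.Hom W W)
    convert h2 using 1
    refine ClassifyingSite.Hom.ext (Category.id_comp _).symm ?_
    change h = h * g⁻¹ * (G.obj.map (𝟙 _)).hom g
    simp
  exact ⟨key _ _ _, key _ _ _⟩

/-- The topology of the classifying site: a sieve covers if the morphisms of `C` underlying its
members form a covering sieve. -/
def classifyingTopology (G : GrpSheaf J) : GrothendieckTopology (ClassifyingSite G) where
  sieves V := {S | Sieve.functorPullback (siteIncl G) (X := V.base) S ∈ J V.base}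
  top_mem' V := by
    change Sieve.functorPullback (siteIncl G) (X := V.base) ⊤ ∈ J V.base
    rw [Sieve.functorPullback_top]
    exact J.top_mem _
  pullback_stable' V W S φ hS := by
    refine J.superset_covering ?_ (J.pullback_stable φ.f hS)
    intro Z f hf
    change S ((siteIncl G).map f ≫ φ)
    rw [sieve_mem_iff]
    exact hf
  transitive' V S hS R hR := by
    refine J.transitive hS _ fun Z f hf => ?_
    refine J.superset_covering ?_ (hR (f := (siteIncl G).map f) hf)
    intro T k hk
    exact (congrArg (fun h : (siteIncl G).obj T ⟶ V => R h)
      ((siteIncl G).map_comp (Z := V.base) k f)).mpr hk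

instance (G : GrpSheaf J) : (siteProj G).IsCocontinuous (classifyingTopology G) J where
  cover_lift {V S} hS := J.superset_covering (fun _ _ hf => hf) hS

lemma isSheaf_classifying {G : GrpSheaf J} (F : (ClassifyingSite G)ᵒᵖ ⥤ Type w)
    (hF : Presieve.IsSheaf J ((siteIncl G).op ⋙ F)) :
    Presieve.IsSheaf (classifyingTopology G) F := by
  intro V S hS x hx
  let x' : Presieve.FamilyOfElements ((siteIncl G).op ⋙ F)
      (Sieve.functorPullback (siteIncl G) (X := V.base) S).arrows :=
    fun W f hf => x ((siteIncl G).map f) hf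
  have hx' : x'.Compatible := fun Y₁ Y₂ Z g₁ g₂ f₁ f₂ h₁ h₂ h =>
    hx ((siteIncl G).map g₁) ((siteIncl G).map g₂) h₁ h₂
      (((siteIncl G).map_comp g₁ f₁).symm.trans
        ((congrArg (siteIncl G).map h).trans ((siteIncl G).map_comp g₂ f₂)))
  obtain ⟨t, ht, htu⟩ := hF _ hS x' hx'
  refine ⟨t, fun W φ hφ => ?_, fun s hs => htu s fun W f hf => hs _ hf⟩
  have hφ' := (sieve_mem_iff S φ).1 hφ
  have h1 : F.map (Quiver.Hom.op (⟨φ.f, 1⟩ : ClassifyingSite.Hom W V)) t = x _ hφ' := ht φ.f hφ'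
  let ψ : W ⟶ W := (⟨𝟙 _, φ.g⟩ : ClassifyingSite.Hom W W)
  have h0 : ψ ≫ (⟨φ.f, 1⟩ : ClassifyingSite.Hom W V) = φ := by
    refine ClassifyingSite.Hom.ext (Category.id_comp _) ?_
    change φ.g * (G.obj.map (𝟙 _)).hom 1 = φ.g
    simp
  have h2 := hx ψ (𝟙 W) hφ' hφ (h0.trans (Category.id_comp _).symm)
  have h3 : F.map (𝟙 W).op (x φ hφ) = x φ hφ := by simp
  refine Eq.trans ?_ (h2.trans h3)
  rw [← h1]
  refine Eq.trans (congrArg (fun k : W ⟶ V => F.map k.op t) h0.symm) ?_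
  rw [op_comp, Functor.map_comp]
  rfl

instance (G : GrpSheaf J) : (siteProj G).IsContinuous (classifyingTopology G) J where
  op_comp_isSheaf_of_types F :=
    isSheaf_classifying _ ((isSheaf_iff_isSheaf_of_type _ _).1 F.property)

/-- The topos `B_G` of `G`-objects. -/
abbrev BTopos (G : GrpSheaf J) := SetSheaf (classifyingTopology G)

/-- The abelian group objects of `B_G`. -/
abbrev BAb (G : GrpSheaf J) := AbSheaf (classifyingTopology G)

/-- An abelian sheaf, as an abelian group object of `B_G` with trivial action. -/
def trivAb (G : GrpSheaf J) : AbSheaf J ⥤ BAb G :=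
  (siteProj G).sheafPushforwardContinuous _ (classifyingTopology G) J

/-- A sheaf of sets, as an object of `B_G` with trivial action. -/
def trivSet (G : GrpSheaf J) : SetSheaf J ⥤ BTopos G :=
  (siteProj G).sheafPushforwardContinuous _ (classifyingTopology G) J

instance (G : GrpSheaf J) : Limits.PreservesFiniteLimits (trivAb G) := by
  unfold trivAb; infer_instance

instance (G : GrpSheaf J) : Limits.PreservesFiniteColimits (trivAb G) := by
  have := ((siteProj G).sheafAdjunctionCocontinuous AddCommGrpCat.{max u v}
    (classifyingTopology G) J).leftAdjoint_preservesColimits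
  unfold trivAb; infer_instance

instance (G : GrpSheaf J) : (trivAb G).Additive where
  map_add := rfl

/-- The presheaf `G` on the classifying site, on which `G` acts by left translations. -/
def universalTorsorPresheaf (G : GrpSheaf J) : (ClassifyingSite G)ᵒᵖ ⥤ Type (max u v) where
  obj V := G.obj.obj (op V.unop.base)
  map φ := TypeCat.ofHom fun x => φ.unop.g * G.obj.map φ.unop.f.op x
  map_id V := by
    ext x
    change 1 * (G.obj.map (𝟙 _)).hom x = x
    simp
  map_comp {V W Z} φ ψ := by
    ext x
    change ψ.unop.g * (G.obj.map ψ.unop.f.op).hom φ.unop.g *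
      (G.obj.map (φ.unop.f.op ≫ ψ.unop.f.op)).hom x =
      ψ.unop.g * (G.obj.map ψ.unop.f.op).hom (φ.unop.g * (G.obj.map φ.unop.f.op).hom x)
    simp [mul_assoc]

/-- The universal `G`-torsor of `B_G`: the sheaf `G`, on which `G` acts by left translations. (Its
torsor structure is given by the right translations.) -/
def universalTorsor (G : GrpSheaf J) : BTopos G where
  obj := universalTorsorPresheaf G
  property := by
    rw [isSheaf_iff_isSheaf_of_type]
    apply isSheaf_classifying
    refine isSheaf_of_coords (ι := Unit) (fun _ => G.obj ⋙ forget GrpCat.{max u v})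
      (fun _ => isSheaf_forgetGrp G)
      (fun _ => { app := fun V => 𝟙 (G.obj.obj V : Type (max u v)), naturality := fun V W f => ?_ })
      (fun V x y h => h ()) (fun V S hS y _ => ⟨y (), fun _ => rfl⟩)
    ext x
    exact one_mul ((G.obj.map f).hom x)

/-- A section of the universal torsor, as an element of `G`. -/
def torsorVal {G : GrpSheaf J} {V : (ClassifyingSite G)ᵒᵖ} (x : (universalTorsor G).obj.obj V) :
    G.obj.obj (op V.unop.base) := x

lemma torsorVal_map {G : GrpSheaf J} {V W : (ClassifyingSite G)ᵒᵖ} (φ : V ⟶ W)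
    (x : (universalTorsor G).obj.obj V) :
    torsorVal ((universalTorsor G).obj.map φ x) =
      φ.unop.g * G.obj.map φ.unop.f.op (torsorVal x) := rfl

/-- The simplicial object `EG` of `B_G`: the Čech nerve of the cover of the terminal object by the
universal torsor `P`, with `E_n G = P^{n+1}`. -/
def universalTotal (G : GrpSheaf J) : SimplicialObject (BTopos G) where
  obj n :=
    { obj :=
        { obj := fun V => Fin (n.unop.len + 1) → (universalTorsor G).obj.obj V
          map := fun φ => TypeCat.ofHom fun x i => (universalTorsor G).obj.map φ (x i)
          map_id := fun V => by ext x; simp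
          map_comp := fun f g => by ext x; simp }
      property := by
        rw [isSheaf_iff_isSheaf_of_type]
        exact isSheaf_of_coords (ι := Fin (n.unop.len + 1)) (fun _ => (universalTorsor G).obj)
          (fun _ => (isSheaf_iff_isSheaf_of_type _ _).1 (universalTorsor G).property)
          (fun i => { app := fun V => TypeCat.ofHom fun x => x i })
          (fun V x y h => funext h)
          (fun V S hS y _ => ⟨y, fun i => rfl⟩) }
  map r := ⟨{ app := fun V => TypeCat.ofHom fun x i => x (r.unop.toOrderHom i) }⟩

/-- The projection `EG ⟶ BG` (`BG` having the trivial action): the tuple `(x_0, …, x_n)` is sent to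
the simplex whose edge from `i` to `j` is labelled by `x_i⁻¹ x_j`. -/
def universalProj (G : GrpSheaf J) :
    universalTotal G ⟶ ((SimplicialObject.whiskering _ _).obj (trivSet G)).obj (classifying G) where
  app n :=
    ⟨{ app := fun V => TypeCat.ofHom fun x =>
        BarSimplex.ofVertices fun i => torsorVal (x i)
       naturality := fun V W φ => by
        ext x
        refine BarSimplex.ext (funext fun i => funext fun j => ?_)
        change (torsorVal ((universalTorsor G).obj.map φ (x i)))⁻¹ *
          torsorVal ((universalTorsor G).obj.map φ (x j)) =
            (G.obj.map φ.unop.f.op).hom ((torsorVal (x i))⁻¹ * torsorVal (x j))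
        rw [torsorVal_map, torsorVal_map, map_mul, map_inv]
        group }⟩

/-- The map of abelian sheaves with `G`-action `ℤ[Y] ⟶ ℤ[X]` induced by a map `Y ⟶ X` from an
object `Y` of `B_G` to a sheaf `X` with trivial action. -/
def freeToTriv {G : GrpSheaf J} {Y : BTopos G} {X : SetSheaf J} (p : Y ⟶ (trivSet G).obj X) :
    (freeAb _).obj Y ⟶ (trivAb G).obj ((freeAb J).obj X) :=
  ((freeAdj _).homEquiv _ _).symm (p ≫ (trivSet G).map ((freeAdj J).unit.app X))

lemma freeToTriv_unit {G : GrpSheaf J} {Y : BTopos G} {X : SetSheaf J}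
    (p : Y ⟶ (trivSet G).obj X) (V) (y : Y.obj.obj V) :
    (freeToTriv p).hom.app V (((freeAdj _).unit.app Y).hom.app V y) =
      ((freeAdj J).unit.app X).hom.app (op V.unop.base) (p.hom.app V y) :=
  free_lift_unit _ V y

lemma free_map_freeToTriv {G : GrpSheaf J} {Y Y' : BTopos G} {X X' : SetSheaf J}
    (p : Y ⟶ (trivSet G).obj X) (p' : Y' ⟶ (trivSet G).obj X') (f : Y ⟶ Y') (k : X ⟶ X')
    (h : f ≫ p' = p ≫ (trivSet G).map k) :
    (freeAb _).map f ≫ freeToTriv p' = freeToTriv p ≫ (trivAb G).map ((freeAb J).map k) := by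
  apply free_hom_ext
  intro V y
  have e1 : (freeToTriv p').hom.app V (((freeAb _).map f).hom.app V
      (((freeAdj _).unit.app Y).hom.app V y)) =
        ((freeAdj J).unit.app X').hom.app (op V.unop.base) (p'.hom.app V (f.hom.app V y)) :=
    (congrArg (fun t => (freeToTriv p').hom.app V t) (free_map_unit f V y)).trans
      (freeToTriv_unit p' V _)
  have e2 : ((freeAb J).map k).hom.app (op V.unop.base) ((freeToTriv p).hom.app V
      (((freeAdj _).unit.app Y).hom.app V y)) =
        ((freeAdj J).unit.app X').hom.app (op V.unop.base)
          (k.hom.app (op V.unop.base) (p.hom.app V y)) :=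
    (congrArg (fun t => ((freeAb J).map k).hom.app (op V.unop.base) t)
      (freeToTriv_unit p V y)).trans (free_map_unit k (op V.unop.base) _)
  have e3 : p'.hom.app V (f.hom.app V y) = k.hom.app (op V.unop.base) (p.hom.app V y) :=
    congrArg (fun q => q.hom.app V y) h
  exact e1.trans ((congrArg _ e3).trans e2.symm)

/-- The map of chain complexes `ℤ[EG]~ ⟶ ℤ[BG]~` induced by the projection. -/
def universalChainMap (G : GrpSheaf J) : freeChain.obj (universalTotal G) ⟶
    ((trivAb G).mapHomologicalComplex _).obj (freeChain.obj (classifying G)) where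
  f n := freeToTriv ((universalProj G).app (op ⦋n⦌))
  comm' i j hij := by
    obtain rfl : j + 1 = i := hij
    refine Eq.symm ((freeChain_d_comp (universalTotal G) j _).trans ?_)
    have h : (freeChain.obj (classifying G)).d (j + 1) j =
        ∑ k : Fin (j + 2), (-1 : ℤ) ^ (k : ℕ) • (freeAb J).map ((classifying G).δ k) :=
      AlgebraicTopology.alternatingFaceMapComplex_obj_d _ _
    refine Eq.trans ?_ (congrArg (fun t : (freeAb J).obj ((classifying G) _⦋j + 1⦌) ⟶
      (freeAb J).obj ((classifying G) _⦋j⦌) =>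
        freeToTriv ((universalProj G).app (op ⦋j + 1⦌)) ≫ (trivAb G).map t) h).symm
    simp only [Functor.map_sum, Functor.map_zsmul, Preadditive.comp_sum, Preadditive.comp_zsmul]
    refine Finset.sum_congr rfl fun k _ => congrArg _ ?_
    exact free_map_freeToTriv _ _ _ _ ((universalProj G).naturality (SimplexCategory.δ k).op)

end ClassifyingTopos

section ExtendMap
variable {A B : Type*} [Category* A] [Category* B] [Abelian A] [Abelian B]

open Classical in
/-- A family `L_n ⟶ F(K_n)`, reindexed by `ℤ` (with `L_n` in degree `-n`). -/
def extendToMapX (F : A ⥤ B) {K : ChainComplex A ℕ} {L : ChainComplex B ℕ}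
    (f : ∀ n, L.X n ⟶ F.obj (K.X n)) (i : ℤ) :
    (L.extend ComplexShape.embeddingDownNat).X i ⟶
      F.obj ((K.extend ComplexShape.embeddingDownNat).X i) :=
  if h : ∃ n, ComplexShape.embeddingDownNat.f n = i then
    (L.extendXIso ComplexShape.embeddingDownNat h.choose_spec).hom ≫ f h.choose ≫
      F.map (K.extendXIso ComplexShape.embeddingDownNat h.choose_spec).inv
  else 0

lemma extendToMapX_eq (F : A ⥤ B) {K : ChainComplex A ℕ} {L : ChainComplex B ℕ}
    (f : ∀ n, L.X n ⟶ F.obj (K.X n)) {i : ℤ} {n : ℕ}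
    (hn : ComplexShape.embeddingDownNat.f n = i) :
    extendToMapX F f i = (L.extendXIso ComplexShape.embeddingDownNat hn).hom ≫ f n ≫
      F.map (K.extendXIso ComplexShape.embeddingDownNat hn).inv := by
  have h : ∃ n, ComplexShape.embeddingDownNat.f n = i := ⟨n, hn⟩
  rw [extendToMapX, dif_pos h]
  have aux : ∀ (m : ℕ) (hm : ComplexShape.embeddingDownNat.f m = i), m = n →
      (L.extendXIso ComplexShape.embeddingDownNat hm).hom ≫ f m ≫
        F.map (K.extendXIso ComplexShape.embeddingDownNat hm).inv =
      (L.extendXIso ComplexShape.embeddingDownNat hn).hom ≫ f n ≫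
        F.map (K.extendXIso ComplexShape.embeddingDownNat hn).inv := by
    intro m hm hmn
    subst hmn
    rfl
  exact aux _ h.choose_spec
    (ComplexShape.embeddingDownNat.injective_f (h.choose_spec.trans hn.symm))

lemma extendToMapX_comm (F : A ⥤ B) [F.Additive] {K : ChainComplex A ℕ} {L : ChainComplex B ℕ}
    (f : ∀ n, L.X n ⟶ F.obj (K.X n))
    (hf : ∀ n, f (n + 1) ≫ F.map (K.d (n + 1) n) = L.d (n + 1) n ≫ f n) (i j : ℤ)
    (hij : i + 1 = j) :
    extendToMapX F f i ≫ F.map ((K.extend ComplexShape.embeddingDownNat).d i j) =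
      (L.extend ComplexShape.embeddingDownNat).d i j ≫ extendToMapX F f j := by
  by_cases h : ∃ n, ComplexShape.embeddingDownNat.f n = j
  · obtain ⟨n, hn⟩ := h
    have hm : ComplexShape.embeddingDownNat.f (n + 1) = i := by
      have h2 : -(n : ℤ) = j := hn
      change -((n + 1 : ℕ) : ℤ) = i
      omega
    rw [extendToMapX_eq F _ hm, extendToMapX_eq F _ hn, K.extend_d_eq _ hm hn,
      L.extend_d_eq _ hm hn]
    simp only [Functor.map_comp, Category.assoc, Iso.inv_hom_id_assoc]
    rw [← F.map_comp_assoc, Iso.inv_hom_id, F.map_id, Category.id_comp, reassoc_of% hf n]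
  · have hz : Limits.IsZero ((K.extend ComplexShape.embeddingDownNat).X j) :=
      K.isZero_extend_X _ j fun n hn => h ⟨n, hn⟩
    exact (F.map_isZero hz).eq_of_tgt _ _

/-- A map of chain complexes `L ⟶ F(K)`, as a map of cochain complexes indexed by `ℤ`. -/
def extendToMap (F : A ⥤ B) [F.Additive] {K : ChainComplex A ℕ} {L : ChainComplex B ℕ}
    (φ : L ⟶ (F.mapHomologicalComplex _).obj K) :
    L.extend ComplexShape.embeddingDownNat ⟶
      (F.mapHomologicalComplex (ComplexShape.up ℤ)).obj
        (K.extend ComplexShape.embeddingDownNat) where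
  f i := extendToMapX F (fun n => φ.f n) i
  comm' i j hij := extendToMapX_comm F (fun n => φ.f n) (fun n => φ.comm (n + 1) n) i j hij

end ExtendMap

section Comparison
variable {C : Type u} [Category.{v} C] {J : GrothendieckTopology C}

/-- The map of complexes `ℤ[EG]~ ⟶ ℤ[BG]~` induced by the projection. -/
def universalComplexMap (G : GrpSheaf J) : freeComplex (universalTotal G) ⟶
    ((trivAb G).mapHomologicalComplex (ComplexShape.up ℤ)).obj (freeComplex (classifying G)) :=
  extendToMap (trivAb G) (universalChainMap G)

/-- The map `ℍⁿ(BG, M) → ℍⁿ(EG, M)`, for an abelian sheaf `M` with trivial action (the target is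
computed in the topos `B_G`): the inverse image to `B_G`, followed by the pullback along the
projection `EG ⟶ BG`. -/
def pullbackToUniversal [HasDerivedCategory.{w} (AbSheaf J)] (G : GrpSheaf J)
    [HasDerivedCategory.{w'} (BAb G)] {M : AbSheaf J} {n : ℕ} (c : HH (classifying G) M n) :
    HH (universalTotal G) ((trivAb G).obj M) n :=
  DerivedCategory.Q.map (universalComplexMap G) ≫
    (trivAb G).mapDerivedCategoryFactors.inv.app _ ≫
    (trivAb G).mapDerivedCategory.map c ≫
    ((trivAb G).mapDerivedCategorySingleFunctor (-(n : ℤ))).hom.app M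

/-- The map `Hⁿ(M) → ℍⁿ(U, M)` from the cohomology of the topos to the hypercohomology of a
simplicial object `U`, induced by the augmentation `ℤ[U]~ ⟶ ℤ`. -/
def fromCohomology [HasDerivedCategory.{w} (AbSheaf J)] [HasExt.{w'} (AbSheaf J)]
    (U : SimplicialObject (SetSheaf J)) {M : AbSheaf J} {n : ℕ} (c : Sheaf.H M n) : HH U M n :=
  DerivedCategory.Q.map (augComplex U) ≫
    (DerivedCategory.singleFunctorIsoCompQ (AbSheaf J) 0).inv.app (constZ J) ≫
    Abelian.Ext.hom c ≫
    ((DerivedCategory.singleFunctors (AbSheaf J)).shiftIso (n : ℤ) (-(n : ℤ)) 0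
      (add_neg_cancel _)).hom.app M

end Comparison

section ExtensionClass
variable {C : Type u} [Category.{v} C] {J : GrothendieckTopology C}

/-- The simplicial set of sections over `V` of a simplicial sheaf of sets. -/
def sections (U : SimplicialObject (SetSheaf J)) (V : Cᵒᵖ) : SSet.{max u v} :=
  U ⋙ sheafToPresheaf J _ ⋙ (evaluation _ _).obj V

/-- The restriction maps of the simplicial sets of sections. -/
def sectionsMap (U : SimplicialObject (SetSheaf J)) {V W : Cᵒᵖ} (f : V ⟶ W) :
    sections U V ⟶ sections U W :=
  Functor.whiskerLeft U (Functor.whiskerLeft (sheafToPresheaf J _) ((evaluation _ _).map f))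

/-- A simplicial sheaf of sets is a hypercover (of the terminal object) if every map
`∂Δ[n] ⟶ U(V)` extends to `Δ[n]` locally on `V`. For `n = 0`: `U_0` covers the terminal object. -/
def IsHypercover (U : SimplicialObject (SetSheaf J)) : Prop :=
  ∀ (n : ℕ) (V : C) (σ : ((SSet.boundary.{max u v} n : SSet.Subcomplex _) : SSet.{max u v}) ⟶
    sections U (op V)), ∃ S ∈ J V, ∀ (W : C) (f : W ⟶ V), S f →
      ∃ τ : SSet.stdSimplex.{max u v}.obj ⦋n⦌ ⟶ sections U (op W),
        (SSet.boundary.{max u v} n).ι ≫ τ = σ ≫ sectionsMap U f.op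

/-- The value at a section of `Y` of a map from an object `Y` of `B_G` to a sheaf of groups `E` with
trivial action. -/
def valGrp {G E : GrpSheaf J} {Y : BTopos G} (e : Y ⟶ (trivSet G).obj (forgetGrp.obj E))
    (V : (ClassifyingSite G)ᵒᵖ) (y : Y.obj.obj V) : E.obj.obj (op V.unop.base) :=
  e.hom.app V y

/-- The value at a section of `Y` of a map from an object `Y` of `B_G` to an abelian sheaf `M` with
trivial action. -/
def valTriv {G : GrpSheaf J} {M : AbSheaf J} {Y : BTopos G}
    (z : Y ⟶ (forgetAb _).obj ((trivAb G).obj M))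
    (V : (ClassifyingSite G)ᵒᵖ) (y : Y.obj.obj V) : M.obj.obj (op V.unop.base) :=
  valAb z V y

/-- Data computing the class of a central extension `0 → M → E → G → 1`, that is, the class in
`H²(B_G, M)` of the gerbe of lifts to an `E`-torsor of the universal `G`-torsor `P` of `B_G`:
* a hypercover `U` of the topos `B_G`, and a trivialization `s` of `P` over `U_0`. It gives the
  trivial `E`-torsor over `U_0` as a lift of `P`;
* an isomorphism of lifts over `U_1`: a section `e` of `E` over `U_1` which lifts the section
  `g_{01} = s_0⁻¹ s_1` of `G`;
* the section `z = e_{01} e_{12} e_{02}⁻¹` of `M` over `U_2`. -/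
structure LiftingDatum {M : AbSheaf J} {G : GrpSheaf J} (X : CentralExtension M G) where
  U : SimplicialObject (BTopos G)
  hypercover : IsHypercover U
  s : U _⦋0⦌ ⟶ universalTorsor G
  e : U _⦋1⦌ ⟶ (trivSet G).obj (forgetGrp.obj X.E)
  z : U _⦋2⦌ ⟶ (forgetAb _).obj ((trivAb G).obj M)
  lifts : ∀ (V : (ClassifyingSite G)ᵒᵖ) (x : (U _⦋1⦌).obj.obj V),
    torsorVal (s.hom.app V ((U.δ 0).hom.app V x)) =
      torsorVal (s.hom.app V ((U.δ 1).hom.app V x)) *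
        X.proj.hom.app (op V.unop.base) (valGrp e V x)
  coboundary : ∀ (V : (ClassifyingSite G)ᵒᵖ) (x : (U _⦋2⦌).obj.obj V),
    X.incl _ (Multiplicative.ofAdd (valTriv z V x)) * valGrp e V ((U.δ 1).hom.app V x) =
      valGrp e V ((U.δ 2).hom.app V x) * valGrp e V ((U.δ 0).hom.app V x)

lemma delta_delta {K : Type*} [Category* K] {T : GrothendieckTopology K}
    (U : SimplicialObject (Sheaf T (Type w))) {n : ℕ} {i j : Fin (n + 2)} (h : i ≤ j) (V : Kᵒᵖ)
    (x : (U _⦋n + 2⦌).obj.obj V) :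
    (U.δ i).hom.app V ((U.δ j.succ).hom.app V x) =
      (U.δ j).hom.app V ((U.δ i.castSucc).hom.app V x) :=
  congrArg (fun k => k.hom.app V x) (U.δ_comp_δ h)

lemma central_identity {H : Type*} [Group H] {m₀ m₁ m₂ m₃ e₀₁ e₀₂ e₀₃ e₁₂ e₁₃ e₂₃ : H}
    (c₀ : m₀ * e₁₃ = e₁₂ * e₂₃) (c₁ : m₁ * e₀₃ = e₀₂ * e₂₃) (c₂ : m₂ * e₀₃ = e₀₁ * e₁₃)
    (c₃ : m₃ * e₀₂ = e₀₁ * e₁₂) (h₀ : ∀ e, m₀ * e = e * m₀) (h₁ : ∀ e, m₁ * e = e * m₁) :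
    m₀ * m₂ = m₁ * m₃ := by
  apply mul_right_cancel (b := e₀₃)
  rw [mul_assoc, c₂, ← mul_assoc, h₀ e₀₁, mul_assoc, c₀, ← mul_assoc, ← c₃, h₁ m₃, mul_assoc,
    mul_assoc, c₁]

lemma alternating_sum_four {H : Type*} [AddCommGroup H] {f : Fin 4 → H}
    (h : f 0 + f 2 = f 1 + f 3) : ∑ k : Fin 4, (-1 : ℤ) ^ (k : ℕ) • f k = 0 := by
  have h' : f 0 = f 1 + f 3 - f 2 := eq_sub_of_add_eq h
  rw [Fin.sum_univ_four, h']
  change (-1 : ℤ) ^ 0 • _ + (-1 : ℤ) ^ 1 • _ + (-1 : ℤ) ^ 2 • _ + (-1 : ℤ) ^ 3 • _ = _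
  norm_num
  abel

/-- The `2`-cocycle `z`. -/
def LiftingDatum.cocycle {M : AbSheaf J} {G : GrpSheaf J} {X : CentralExtension M G}
    (D : LiftingDatum X) : Cocycle D.U ((trivAb G).obj M) 2 where
  toHom := D.z
  closed V x := by
    have c0 := D.coboundary V ((D.U.δ 0).hom.app V x)
    have c1 := D.coboundary V ((D.U.δ 1).hom.app V x)
    have c2 := D.coboundary V ((D.U.δ 2).hom.app V x)
    have c3 := D.coboundary V ((D.U.δ 3).hom.app V x)
    have r01 : (D.U.δ 0).hom.app V ((D.U.δ 1).hom.app V x) =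
      (D.U.δ 0).hom.app V ((D.U.δ 0).hom.app V x) :=
        delta_delta D.U (i := (0 : Fin 3)) (j := 0) le_rfl V x
    have r02 : (D.U.δ 0).hom.app V ((D.U.δ 2).hom.app V x) =
      (D.U.δ 1).hom.app V ((D.U.δ 0).hom.app V x) :=
        delta_delta D.U (i := (0 : Fin 3)) (j := 1) (by decide) V x
    have r03 : (D.U.δ 0).hom.app V ((D.U.δ 3).hom.app V x) =
      (D.U.δ 2).hom.app V ((D.U.δ 0).hom.app V x) :=
        delta_delta D.U (i := (0 : Fin 3)) (j := 2) (by decide) V x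
    have r12 : (D.U.δ 1).hom.app V ((D.U.δ 2).hom.app V x) =
      (D.U.δ 1).hom.app V ((D.U.δ 1).hom.app V x) :=
        delta_delta D.U (i := (1 : Fin 3)) (j := 1) (by decide) V x
    have r13 : (D.U.δ 1).hom.app V ((D.U.δ 3).hom.app V x) =
      (D.U.δ 2).hom.app V ((D.U.δ 1).hom.app V x) :=
        delta_delta D.U (i := (1 : Fin 3)) (j := 2) (by decide) V x
    have r23 : (D.U.δ 2).hom.app V ((D.U.δ 3).hom.app V x) =
      (D.U.δ 2).hom.app V ((D.U.δ 2).hom.app V x) :=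
        delta_delta D.U (i := (2 : Fin 3)) (j := 2) (by decide) V x
    rw [r01] at c1
    rw [r02, r12] at c2
    rw [r03, r13, r23] at c3
    have key := central_identity c0 c1 c2 c3 (X.incl_central _ _) (X.incl_central _ _)
    have key' : valTriv D.z V ((D.U.δ 0).hom.app V x) + valTriv D.z V ((D.U.δ 2).hom.app V x) =
      valTriv D.z V ((D.U.δ 1).hom.app V x) + valTriv D.z V ((D.U.δ 3).hom.app V x) :=
        X.incl_injective _ (((X.incl _).map_mul _ _).trans (key.trans ((X.incl _).map_mul _ _).symm))
    exact alternating_sum_four (f := fun k => valAb D.z V ((D.U.δ k).hom.app V x)) key'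

/-- The class in `H²(B_G, M)` of a central extension of `G` by `M` is the class `c` whose image in
`ℍ²(U, M)` is the class of the cocycle `z`, for all data as above. -/
def IsExtensionClass {M : AbSheaf J} {G : GrpSheaf J} [HasDerivedCategory.{w} (BAb G)]
    [HasExt.{w'} (BAb G)] (X : CentralExtension M G) (c : Sheaf.H ((trivAb G).obj M) 2) : Prop :=
  ∀ D : LiftingDatum X, fromCohomology D.U c = D.cocycle.cls

end ExtensionClass

section EilenbergMacLane
variable {C : Type u} [Category.{v} C] {J : GrothendieckTopology C}

/-- The chain complex `M[n]`, with `M` placed in homological degree `n`. -/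
abbrev chainSingle (M : AbSheaf J) (n : ℕ) : ChainComplex (AbSheaf J) ℕ :=
  (HomologicalComplex.single (AbSheaf J) (ComplexShape.down ℕ) n).obj M

/-- The Eilenberg–MacLane object `K(M, n) = K(M[n])`, `K` being the Dold–Kan functor from chain
complexes to simplicial objects. -/
def EM (M : AbSheaf J) (n : ℕ) : SimplicialObject (AbSheaf J) :=
  Abelian.DoldKan.Γ.obj (chainSingle M n)

/-- The simplicial sheaf of sets underlying a simplicial abelian sheaf. -/
abbrev underlying : SimplicialObject (AbSheaf J) ⥤ SimplicialObject (SetSheaf J) :=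
  (SimplicialObject.whiskering _ _).obj (forgetAb J)

/-- The simplicial sheaf of sets underlying `K(M, n)`. -/
abbrev EMSet (M : AbSheaf J) (n : ℕ) : SimplicialObject (SetSheaf J) :=
  underlying.obj (EM M n)

/-- The projection from the alternating face complex of `K(M, n)` to its normalized complex
`N K(M, n)`, followed by the Dold–Kan isomorphism `N K(M, n) ≅ M[n]`. -/
def emProj (M : AbSheaf J) (n : ℕ) :
    (AlgebraicTopology.alternatingFaceMapComplex (AbSheaf J)).obj (EM M n) ⟶ chainSingle M n :=
  AlgebraicTopology.DoldKan.PInftyToNormalizedMooreComplex (EM M n) ≫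
    Abelian.DoldKan.equivalence.counitIso.hom.app (chainSingle M n)

/-- The homomorphism `K(M, n)_n ⟶ M` (an isomorphism). -/
def emVal (M : AbSheaf J) (n : ℕ) : EM M n _⦋n⦌ ⟶ M :=
  (emProj M n).f n ≫
    (HomologicalComplex.singleObjXSelf (ComplexShape.down ℕ) n M).hom

lemma d_emVal (M : AbSheaf J) (n : ℕ) :
    ∑ k : Fin (n + 2), (-1 : ℤ) ^ (k : ℕ) • ((EM M n).δ k ≫ emVal M n) = 0 := by
  have h := (emProj M n).comm (n + 1) n
  have h2 : ((AlgebraicTopology.alternatingFaceMapComplex (AbSheaf J)).obj (EM M n)).d (n + 1) n =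
    ∑ k : Fin (n + 2), (-1 : ℤ) ^ (k : ℕ) • (EM M n).δ k :=
      AlgebraicTopology.alternatingFaceMapComplex_obj_d _ _
  have h3 : (chainSingle M n).d (n + 1) n = 0 := HomologicalComplex.single_obj_d ..
  rw [h3, Limits.comp_zero, h2] at h
  have h4 : (∑ k : Fin (n + 2), (-1 : ℤ) ^ (k : ℕ) • (EM M n).δ k) ≫ emVal M n = 0 := by
    unfold emVal
    refine (Category.assoc _ _ _).symm.trans ?_
    refine (congrArg (· ≫ _) h.symm).trans ?_
    exact Limits.zero_comp
  rw [← h4]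
  simp only [Preadditive.sum_comp, Preadditive.zsmul_comp]

/-- The fundamental cocycle of `K(M, n)`. -/
def fundamentalCocycle (M : AbSheaf J) (n : ℕ) : Cocycle (EMSet M n) M n where
  toHom := (forgetAb J).map (emVal M n)
  closed V x := by
    refine Eq.trans ?_ (congrArg (fun k => k.hom.app V x) (d_emVal M n))
    refine Eq.trans ?_ (sum_hom_app _ _ V _).symm
    refine Finset.sum_congr rfl fun k _ => ?_
    exact (zsmul_hom_app _ _ V _).symm

/-- The fundamental class `ι_M^n ∈ ℍⁿ(K(M, n), M)`. -/
def fundamentalClass [HasDerivedCategory.{w} (AbSheaf J)] (M : AbSheaf J) (n : ℕ) :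
    HH (EMSet M n) M n :=
  (fundamentalCocycle M n).cls

/-- The map `W ⟶ K(S, n)` corresponding, under the Dold–Kan equivalence, to the map of complexes
`N W ⟶ S[n]` given by a homomorphism `W_n ⟶ S` vanishing on boundaries. -/
def mapToEM (W : SimplicialObject (AbSheaf J)) {S : AbSheaf J} {n : ℕ} (φ : W _⦋n⦌ ⟶ S)
    (hφ : ∑ k : Fin (n + 2), (-1 : ℤ) ^ (k : ℕ) • (W.δ k ≫ φ) = 0) : W ⟶ EM S n :=
  Abelian.DoldKan.equivalence.toAdjunction.homEquiv W (chainSingle S n)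
    (HomologicalComplex.mkHomToSingle
      ((AlgebraicTopology.inclusionOfMooreComplexMap W).f n ≫ φ) (by
        intro i hi
        obtain rfl : n + 1 = i := hi
        have h := (AlgebraicTopology.inclusionOfMooreComplexMap W).comm (n + 1) n
        refine (Category.assoc _ _ _).symm.trans ?_
        refine (congrArg (· ≫ φ) h.symm).trans ?_
        refine (Category.assoc _ _ _).trans ?_
        have h2 : (AlgebraicTopology.AlternatingFaceMapComplex.obj W).d (n + 1) n =
          ∑ k : Fin (n + 2), (-1 : ℤ) ^ (k : ℕ) • W.δ k :=
            AlgebraicTopology.alternatingFaceMapComplex_obj_d _ _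
        refine (congrArg (fun t : W _⦋n + 1⦌ ⟶ W _⦋n⦌ => _ ≫ t ≫ φ) h2).trans ?_
        simp only [Preadditive.sum_comp, Preadditive.zsmul_comp]
        rw [hφ, Limits.comp_zero]
        rfl))

/-- The map `X ⟶ K(M, n)` corresponding to a (normalized) `n`-cocycle of a simplicial sheaf of sets
`X`: the map `ℤ[X] ⟶ K(M, n)` which it defines, restricted to `X`. -/
def Cocycle.toEM {X : SimplicialObject (SetSheaf J)} {M : AbSheaf J} {n : ℕ}
    (z : Cocycle X M n) : X ⟶ EMSet M n :=
  ((freeAdj J).whiskerRight SimplexCategoryᵒᵖ).homEquiv X (EM M n)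
    (mapToEM (((SimplicialObject.whiskering _ _).obj (freeAb J)).obj X) z.lin
      ((freeChain_d_comp X n z.lin).symm.trans z.d_lin))

end EilenbergMacLane

section Cup
variable {C : Type u} [Category.{v} C] {J : GrothendieckTopology C}

/-- The diagonal `X ⊗ Y` of the external tensor product of simplicial abelian sheaves:
`(X ⊗ Y)_n = X_n ⊗ Y_n`. -/
def diagTensor (X Y : SimplicialObject (AbSheaf J)) : SimplicialObject (AbSheaf J) where
  obj n := tensor (X.obj n) (Y.obj n)
  map r := tensorMap (X.map r) (Y.map r)
  map_id n := tensor_hom_ext fun V a b => by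
    rw [tensorMap_tmul, X.map_id, Y.map_id]; rfl
  map_comp r r' := tensor_hom_ext fun V a b => by
    refine (tensorMap_tmul _ _ V a b).trans ?_
    rw [X.map_comp, Y.map_comp]
    refine Eq.trans ?_ (congrArg (fun t => (tensorMap (X.map r') (Y.map r')).hom.app V t)
      (tensorMap_tmul (X.map r) (Y.map r) V a b)).symm
    exact (tensorMap_tmul (X.map r') (Y.map r') V ((X.map r).hom.app V a)
      ((Y.map r).hom.app V b)).symm

/-- The first coordinate of a section of `X × Y`. -/
def fstVal {X Y : SimplicialObject (AbSheaf J)} (n : SimplexCategoryᵒᵖ) (V : Cᵒᵖ)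
    (p : ((underlying.obj X ⨯ underlying.obj Y).obj n).obj.obj V) : (X.obj n).obj.obj V :=
  ((Limits.prod.fst : underlying.obj X ⨯ underlying.obj Y ⟶ _).app n).hom.app V p

/-- The second coordinate of a section of `X × Y`. -/
def sndVal {X Y : SimplicialObject (AbSheaf J)} (n : SimplexCategoryᵒᵖ) (V : Cᵒᵖ)
    (p : ((underlying.obj X ⨯ underlying.obj Y).obj n).obj.obj V) : (Y.obj n).obj.obj V :=
  ((Limits.prod.snd : underlying.obj X ⨯ underlying.obj Y ⟶ _).app n).hom.app V p

/-- The map `X × Y ⟶ X ⊗ Y`, `(x, y) ↦ x ⊗ y`. -/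
def tensorPairing (X Y : SimplicialObject (AbSheaf J)) :
    underlying.obj X ⨯ underlying.obj Y ⟶ underlying.obj (diagTensor X Y) where
  app n := ⟨{
    app := fun V => TypeCat.ofHom fun p =>
      tmul (X.obj n) (Y.obj n) V (fstVal n V p) (sndVal n V p)
    naturality := fun V W f => by
      ext p
      refine Eq.trans ?_ (tmul_restrict (X.obj n) (Y.obj n) f _ _).symm
      exact congrArg₂ (fun s t => tmul (X.obj n) (Y.obj n) W s t)
        (congrArg (fun k => k p) (((Limits.prod.fst :
          underlying.obj X ⨯ underlying.obj Y ⟶ _).app n).hom.naturality f))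
        (congrArg (fun k => k p) (((Limits.prod.snd :
          underlying.obj X ⨯ underlying.obj Y ⟶ _).app n).hom.naturality f)) }⟩
  naturality n m r := by
    ext V p
    refine Eq.trans ?_ (tensorMap_tmul (X.map r) (Y.map r) V (fstVal n V p) (sndVal n V p)).symm
    exact congrArg₂ (fun s t => tmul (X.obj m) (Y.obj m) V s t)
      (congrArg (fun k => k.hom.app V p) ((Limits.prod.fst :
          underlying.obj X ⨯ underlying.obj Y ⟶ _).naturality r))
      (congrArg (fun k => k.hom.app V p) ((Limits.prod.snd :
          underlying.obj X ⨯ underlying.obj Y ⟶ _).naturality r))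

instance : Limits.HasFiniteBiproducts (AbSheaf J) := Abelian.hasFiniteBiproducts

/-- The part of degree `n` of the tensor product of two chain complexes. -/
abbrev tensorDegree (K L : ChainComplex (AbSheaf J) ℕ) (n : ℕ) : AbSheaf J :=
  ⨁ fun pq : Finset.HasAntidiagonal.antidiagonal n => tensor (K.X pq.1.1) (L.X pq.1.2)

/-- The normalized chain complex of a simplicial abelian sheaf. -/
abbrev normalized (X : SimplicialObject (AbSheaf J)) : ChainComplex (AbSheaf J) ℕ :=
  Abelian.DoldKan.N.obj X

/-- The projection `X_n ⟶ (N X)_n`, vanishing on the degenerate simplices. -/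
abbrev toNormalized (X : SimplicialObject (AbSheaf J)) (n : ℕ) : X _⦋n⦌ ⟶ (normalized X).X n :=
  (AlgebraicTopology.DoldKan.PInftyToNormalizedMooreComplex X).f n

/-- The Alexander–Whitney map `(X ⊗ Y)_n ⟶ (N X ⊗ N Y)_n`. Its component of degree `(p, q)` is the
tensor product of the front face of dimension `p` and of the back face of dimension `q`. -/
def alexanderWhitney (X Y : SimplicialObject (AbSheaf J)) (n : ℕ) :
    diagTensor X Y _⦋n⦌ ⟶ tensorDegree (normalized X) (normalized Y) n :=
  Limits.biproduct.lift fun pq : Finset.HasAntidiagonal.antidiagonal n => tensorMap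
    (X.map (SimplexCategory.subinterval 0 pq.1.1
      (by have := Finset.HasAntidiagonal.mem_antidiagonal.1 pq.2; omega)).op ≫ toNormalized X pq.1.1)
    (Y.map (SimplexCategory.subinterval pq.1.1 pq.1.2
      (by have := Finset.HasAntidiagonal.mem_antidiagonal.1 pq.2; omega)).op ≫ toNormalized Y pq.1.2)

/-- The isomorphism `(N K(A, i) ⊗ N K(B, j))_{i+j} ≅ (A[i] ⊗ B[j])_{i+j} = A ⊗ B` (the only nonzero
summand of the source is the one of degree `(i, j)`). -/
def tensorSingle (A B : AbSheaf J) (i j : ℕ) :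
    tensorDegree (normalized (EM A i)) (normalized (EM B j)) (i + j) ⟶ tensor A B :=
  Limits.biproduct.π (fun pq : Finset.HasAntidiagonal.antidiagonal (i + j) =>
      tensor ((normalized (EM A i)).X pq.1.1) ((normalized (EM B j)).X pq.1.2))
      ⟨(i, j), Finset.HasAntidiagonal.mem_antidiagonal.2 rfl⟩ ≫
    tensorMap
      ((Abelian.DoldKan.equivalence.counitIso.hom.app (chainSingle A i)).f i ≫
        (HomologicalComplex.singleObjXSelf (ComplexShape.down ℕ) i A).hom)
      ((Abelian.DoldKan.equivalence.counitIso.hom.app (chainSingle B j)).f j ≫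
        (HomologicalComplex.singleObjXSelf (ComplexShape.down ℕ) j B).hom)

lemma tensorMap_comp {A A' A'' B B' B'' : AbSheaf J} (f : A ⟶ A') (f' : A' ⟶ A'') (g : B ⟶ B')
    (g' : B' ⟶ B'') : tensorMap f g ≫ tensorMap f' g' = tensorMap (f ≫ f') (g ≫ g') :=
  tensor_hom_ext fun V a b => by
    refine Eq.trans ?_ (tensorMap_tmul (f ≫ f') (g ≫ g') V a b).symm
    refine (congrArg (fun t => (tensorMap f' g').hom.app V t) (tensorMap_tmul f g V a b)).trans ?_
    exact tensorMap_tmul f' g' V (f.hom.app V a) (g.hom.app V b)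

lemma subinterval_front :
    SimplexCategory.subinterval (n := 2) 0 1 (by omega) = SimplexCategory.δ (2 : Fin 3) := by
  ext i
  fin_cases i <;> rfl

lemma subinterval_back :
    SimplexCategory.subinterval (n := 2) 1 1 (by omega) = SimplexCategory.δ (0 : Fin 3) := by
  ext i
  fin_cases i <;> rfl

lemma alexanderWhitney_tensorSingle (A B : AbSheaf J) :
    alexanderWhitney (EM A 1) (EM B 1) 2 ≫ tensorSingle A B 1 1 =
      tensorMap ((EM A 1).δ (2 : Fin 3) ≫ emVal A 1) ((EM B 1).δ (0 : Fin 3) ≫ emVal B 1) := by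
  refine (Category.assoc _ _ _).symm.trans ?_
  refine (congrArg (· ≫ _) (Limits.biproduct.lift_π _ _)).trans ?_
  refine (tensorMap_comp _ _ _ _).trans ?_
  simp only [subinterval_front, subinterval_back]
  rfl

lemma diagTensor_delta (X Y : SimplicialObject (AbSheaf J)) {n : ℕ} (k : Fin (n + 2)) :
    (diagTensor X Y).δ k = tensorMap (X.δ k) (Y.δ k) := rfl

lemma cup_identity {P Q R : Type*} [AddCommGroup P] [AddCommGroup Q] [AddCommGroup R]
    (T : P →+ Q →+ R) (x : Fin 3 → Fin 4 → P) (y : Fin 3 → Fin 4 → Q)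
    (x₀ : x 2 0 = x 0 3) (x₁ : x 2 1 = x 1 3) (x₂ : x 2 2 = x 2 3)
    (y₁ : y 0 1 = y 0 0) (y₂ : y 0 2 = y 1 0) (y₃ : y 0 3 = y 2 0)
    (hx : ∑ i : Fin 3, (-1 : ℤ) ^ (i : ℕ) • x i 3 = 0)
    (hy : ∑ i : Fin 3, (-1 : ℤ) ^ (i : ℕ) • y i 0 = 0) :
    ∑ k : Fin 4, (-1 : ℤ) ^ (k : ℕ) • T (x 2 k) (y 0 k) = 0 := by
  rw [Fin.sum_univ_three] at hx hy
  rw [Fin.sum_univ_four, x₀, x₁, x₂, y₁, y₂, y₃]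
  change (-1 : ℤ) ^ 0 • _ + (-1 : ℤ) ^ 1 • _ + (-1 : ℤ) ^ 2 • _ = _ at hx
  change (-1 : ℤ) ^ 0 • _ + (-1 : ℤ) ^ 1 • _ + (-1 : ℤ) ^ 2 • _ = _ at hy
  change (-1 : ℤ) ^ 0 • _ + (-1 : ℤ) ^ 1 • _ + (-1 : ℤ) ^ 2 • _ + (-1 : ℤ) ^ 3 • _ = _
  norm_num at hx hy ⊢
  have hx' : x 2 3 = x 1 3 - x 0 3 := by rw [← sub_eq_zero, ← hx]; abel
  have hy' : y 2 0 = y 1 0 - y 0 0 := by rw [← sub_eq_zero, ← hy]; abel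
  rw [hx', hy']
  simp only [map_sub, AddMonoidHom.sub_apply]
  abel

/-- The map `(K(A,1) ⊗ K(B,1))_2 ⟶ A ⊗ B` given by the Alexander–Whitney map vanishes on
boundaries. -/
lemma d_alexanderWhitney (A B : AbSheaf J) :
    ∑ k : Fin 4, (-1 : ℤ) ^ (k : ℕ) • ((diagTensor (EM A 1) (EM B 1)).δ k ≫
      alexanderWhitney (EM A 1) (EM B 1) 2 ≫ tensorSingle A B 1 1) = 0 := by
  rw [alexanderWhitney_tensorSingle]
  apply tensor_hom_ext
  intro V a b
  refine (sum_hom_app _ _ V _).trans ?_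
  let f : ((EMSet A 1) _⦋1⦌).obj.obj V → A.obj.obj V := valAb (fundamentalCocycle A 1).toHom V
  let g : ((EMSet B 1) _⦋1⦌).obj.obj V → B.obj.obj V := valAb (fundamentalCocycle B 1).toHom V
  let a' : ((EMSet A 1) _⦋3⦌).obj.obj V := a
  let b' : ((EMSet B 1) _⦋3⦌).obj.obj V := b
  let x : Fin 3 → Fin 4 → A.obj.obj V := fun i k =>
    f (((EMSet A 1).δ i).hom.app V (((EMSet A 1).δ k).hom.app V a'))
  let y : Fin 3 → Fin 4 → B.obj.obj V := fun i k =>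
    g (((EMSet B 1).δ i).hom.app V (((EMSet B 1).δ k).hom.app V b'))
  have hx := (fundamentalCocycle A 1).closed V (((EMSet A 1).δ 3).hom.app V a')
  have hy := (fundamentalCocycle B 1).closed V (((EMSet B 1).δ 0).hom.app V b')
  refine Eq.trans (Finset.sum_congr rfl fun k _ => ?_)
    (cup_identity (tmul A B V) x y
      (congrArg f (delta_delta (EMSet A 1) (i := (0 : Fin 3)) (j := 2) (by decide) V a').symm)
      (congrArg f (delta_delta (EMSet A 1) (i := (1 : Fin 3)) (j := 2) (by decide) V a').symm)
      (congrArg f (delta_delta (EMSet A 1) (i := (2 : Fin 3)) (j := 2) (by decide) V a').symm)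
      (congrArg g (delta_delta (EMSet B 1) (i := (0 : Fin 3)) (j := 0) (by decide) V b'))
      (congrArg g (delta_delta (EMSet B 1) (i := (0 : Fin 3)) (j := 1) (by decide) V b'))
      (congrArg g (delta_delta (EMSet B 1) (i := (0 : Fin 3)) (j := 2) (by decide) V b'))
      hx hy)
  refine (zsmul_hom_app _ _ V _).trans (congrArg _ ?_)
  refine (congrArg (fun t => (tensorMap ((EM A 1).δ (2 : Fin 3) ≫ emVal A 1)
    ((EM B 1).δ (0 : Fin 3) ≫ emVal B 1)).hom.app V t)
      (tensorMap_tmul ((EM A 1).δ k) ((EM B 1).δ k) V a b)).trans ?_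
  exact tensorMap_tmul ((EM A 1).δ (2 : Fin 3) ≫ emVal A 1) ((EM B 1).δ (0 : Fin 3) ≫ emVal B 1)
    V _ _

/-- The cup product `δ_{1,1} : K(A, 1) × K(B, 1) ⟶ K(A ⊗ B, 2)`: the map `(x, y) ↦ x ⊗ y` to
the diagonal of the external tensor product, followed by the map
`K(A, 1) ⊗ K(B, 1) ⟶ K(A ⊗ B, 2)` which corresponds to the Alexander–Whitney map
`N(K(A, 1) ⊗ K(B, 1)) ⟶ N K(A, 1) ⊗ N K(B, 1) ≅ (A ⊗ B)[2]` under the Dold–Kan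
correspondence. -/
def cup (A B : AbSheaf J) : EMSet A 1 ⨯ EMSet B 1 ⟶ EMSet (tensor A B) 2 :=
  tensorPairing (EM A 1) (EM B 1) ≫
    underlying.map (mapToEM (diagTensor (EM A 1) (EM B 1))
      (alexanderWhitney (EM A 1) (EM B 1) 2 ≫ tensorSingle A B 1 1) (d_alexanderWhitney A B))

lemma alternating_sum_three {H : Type*} [AddCommGroup H] {f : Fin 3 → H}
    (h : f 2 + f 0 = f 1) : ∑ k : Fin 3, (-1 : ℤ) ^ (k : ℕ) • f k = 0 := by
  rw [Fin.sum_univ_three, ← h]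
  change (-1 : ℤ) ^ 0 • _ + (-1 : ℤ) ^ 1 • _ + (-1 : ℤ) ^ 2 • _ = _
  norm_num

/-- The `1`-cocycle `(a, b) ↦ a` of `B(A × B)`. -/
def fstCocycle (A B : AbSheaf J) : Cocycle (classifying (prodGrp A B)) A 1 where
  toHom := ⟨{ app := fun V => TypeCat.ofHom fun x => (x.g 0 1).toAdd.1 }⟩
  closed V x := alternating_sum_three (f := fun k => valAb _ V (((classifying (prodGrp A B)).δ k).hom.app V x))
    (congrArg (fun t => (Multiplicative.toAdd t).1) (x.mul_eq 0 1 2))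

/-- The `1`-cocycle `(a, b) ↦ b` of `B(A × B)`. -/
def sndCocycle (A B : AbSheaf J) : Cocycle (classifying (prodGrp A B)) B 1 where
  toHom := ⟨{ app := fun V => TypeCat.ofHom fun x => (x.g 0 1).toAdd.2 }⟩
  closed V x := alternating_sum_three (f := fun k => valAb _ V (((classifying (prodGrp A B)).δ k).hom.app V x))
    (congrArg (fun t => (Multiplicative.toAdd t).2) (x.mul_eq 0 1 2))

/-- The map `B(A × B) ⟶ K(A, 1) × K(B, 1)`. -/
def toProduct (A B : AbSheaf J) : classifying (prodGrp A B) ⟶ EMSet A 1 ⨯ EMSet B 1 :=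
  Limits.prod.lift (fstCocycle A B).toEM (sndCocycle A B).toEM

end Cup

end

end HeisenbergCup

open HeisenbergCup

/-!
Write `G = A × B` and `M = A ⊗ B`. All classes are represented by cocycles and compared on the
simplicial object `EG` of the topos `B_G`.

*`ℍⁿ(BG, M) = ℍⁿ(EG, M)`* (`pullbackToUniversal_bijective`). Every section of `E_n G` is, for a
unique element of `G`, the translate of one whose zeroth vertex is `1`, so `ℤ[E_n G]` is induced
from `ℤ[B_n G]`: equivariant maps `ℤ[E_n G] ⟶ N` are the maps `ℤ[B_n G] ⟶ N` of abelian sheaves. As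
the functor forgetting the action of `G` is exact and preserves injectives, a comparison of
injective resolutions of `M` over the site and over the topos `B_G` gives the result
(`derivedPullback_bijective`); no spectral sequence is needed.

*`Hⁿ(B_G, M) = ℍⁿ(EG, M)`* (`fromCohomology_universalTotal_bijective`). Adding `1` as a vertex is an
extra degeneracy of the sections of `EG` over each object of the classifying site. It is not
equivariant, but it suffices for `ℤ[EG]` to be a resolution of `ℤ`.

*The class of the extension.* A trivialization of the universal torsor over `U_0` is a map
`U_0 ⟶ P = E_0 G` and extends to a map `U ⟶ EG`, which sends a simplex to the tuple of the values at
its vertices. Two lifts of the same transition function differ by a section of `M`, so their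
cocycles are cohomologous (`LiftingDatum.pullback_cls`). As `EG` is itself a hypercover, the
condition on the class of an extension amounts to the one condition that its image in `ℍ²(EG, M)` be
the class of the cocycle computed on `EG` (`isExtensionClass_iff`). For the Heisenberg extension,
the section `(a, b) ↦ (a, b, 0)` gives the cocycle `(a, b, a', b') ↦ a ⊗ b'`; existence and
uniqueness of the class follow from the previous step.

*The cup product.* By the Dold–Kan correspondence, maps to `K(M, n)` are the normalized `n`-cocycles
(`EMSet_hom_ext`, `toEM_fundamentalCocycle`). All `1`-cocycles are normalized, so
`K(A, 1) × K(B, 1)` represents pairs of `1`-cocycles, as `B(A × B)` does (`isIso_toProduct`). The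
component of degree `(1, 1)` of the Alexander–Whitney map is the tensor product of the front and the
back edge of a triangle, so the cup product pulls the fundamental cocycle back to
`(a, b, a', b') ↦ a ⊗ b'` as well (`toProduct_cup_fundamentalCocycle`).
-/

namespace HeisenbergCup
noncomputable section

/-! ### Homs in the derived category computed by injective resolutions -/

section HomologicalAlgebra
open CochainComplex HomComplex Limits Pretriangulated

variable {A B : Type*} [Category* A] [Category* B] [Abelian A] [Abelian B]

/-- The complexes of groups `Hom(L_p, W)` are exact, for all terms `L_p` of `L`. -/
def HomExact (L W : CochainComplex B ℤ) : Prop :=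
  ∀ (p i j k : ℤ) (_ : i + 1 = j) (_ : j + 1 = k) (g : L.X p ⟶ W.X j), g ≫ W.d j k = 0 →
    ∃ h : L.X p ⟶ W.X i, h ≫ W.d i j = g

lemma HomExact.shift {L W : CochainComplex B ℤ} (h : HomExact L W) (n : ℤ) :
    HomExact L (W⟦n⟧) := by
  intro p i j k hij hjk g hg
  have e : ∀ a b, (W⟦n⟧).d a b = n.negOnePow • W.d (a + n) (b + n) := fun _ _ => rfl
  have hg' : n.negOnePow • ((g : L.X p ⟶ W.X (j + n)) ≫ W.d (j + n) (k + n)) = 0 :=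
    (Linear.comp_units_smul ..).symm.trans ((congrArg (g ≫ ·) (e j k)).symm.trans hg)
  obtain ⟨t, ht⟩ := h p (i + n) (j + n) (k + n) (by lia) (by lia) g
    ((smul_eq_zero_iff_eq n.negOnePow).1 hg')
  refine ⟨n.negOnePow • t, ?_⟩
  rw [e]
  have : (n.negOnePow • t) ≫ (n.negOnePow • W.d (i + n) (j + n)) = t ≫ W.d (i + n) (j + n) := by
    rw [Linear.units_smul_comp, Linear.comp_units_smul, smul_smul]
    simp
  exact this.trans ht

/-- If `L` is bounded above, `W` is bounded below and the complexes `Hom(L_p, W)` are exact, then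
every map `L ⟶ W` is null-homotopic: the homotopy is built by descending induction on the degree,
starting above the bound of `L`, and only finitely many degrees matter. -/
lemma HomExact.nonempty_homotopy {L W : CochainComplex B ℤ} (h : HomExact L W) (f : L ⟶ W)
    (a d : ℤ) [L.IsStrictlyLE a] [W.IsStrictlyGE d] : Nonempty (Homotopy f 0) := by
  -- `f` is the boundary of a cochain `α` in the degrees above `a - n`
  have key : ∀ n : ℕ, ∃ α : Cochain L W (-1), ∀ p, a - n < p →
      (δ (-1) 0 α).v p p (add_zero p) = f.f p := by
    intro n
    induction n with
    | zero => exact ⟨0, fun p hp => (L.isZero_of_isStrictlyLE a p (by lia)).eq_of_src _ _⟩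
    | succ n ih =>
      obtain ⟨α, hα⟩ := ih
      let p := a - n
      have hp := hα (p + 1) (by lia)
      rw [δ_v (-1) 0 (neg_add_cancel 1) α (p + 1) (p + 1) (add_zero _) p (p + 2)
        (by lia) (by lia)] at hp
      let u := f.f p - L.d p (p + 1) ≫ α.v (p + 1) p (by lia)
      have hu : u ≫ W.d p (p + 1) = 0 := by
        simp only [Int.negOnePow_zero, one_smul] at hp
        simp only [u, Preadditive.sub_comp, Category.assoc, f.comm, ← hp, Preadditive.comp_add,
          HomologicalComplex.d_comp_d_assoc, zero_comp, add_zero, sub_self]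
      obtain ⟨t, ht⟩ := h p (p - 1) p (p + 1) (by lia) (by lia) u hu
      -- `α` is corrected in degree `p` only, where its value becomes `t`
      let t' := t - α.v p (p - 1) (by lia)
      refine ⟨α + Cochain.single t' (-1), fun q hq => ?_⟩
      have hq' : p ≤ q := by lia
      obtain hq' | rfl := hq'.lt_or_eq
      · rw [δ_add, Cochain.add_v, hα q (by lia), add_eq_left,
          δ_v (-1) 0 (neg_add_cancel 1) _ q q (add_zero q) (q - 1) (q + 1) rfl rfl,
          Cochain.single_v_eq_zero _ _ _ _ _ (by lia),
          Cochain.single_v_eq_zero _ _ _ _ _ (by lia)]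
        simp
      · rw [δ_v (-1) 0 (neg_add_cancel 1) _ p p (add_zero p) (p - 1) (p + 1) rfl rfl,
          Cochain.add_v, Cochain.add_v, Cochain.single_v,
          Cochain.single_v_eq_zero _ _ _ _ _ (by lia)]
        simp [t', ht, u]
  obtain ⟨α, hα⟩ := key (a - d + 1).toNat
  refine ⟨(Cochain.equivHomotopy f 0).symm ⟨α, ?_⟩⟩
  rw [Cochain.ofHom_zero, add_zero]
  ext p
  by_cases hp : d ≤ p
  · rw [hα p (by lia), Cochain.ofHom_v]
  · exact (W.isZero_of_isStrictlyGE d p (by lia)).eq_of_tgt _ _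

variable (B) in
/-- The functor from complexes to the homotopy category. -/
abbrev toK : CochainComplex B ℤ ⥤ HomotopyCategory B (ComplexShape.up ℤ) :=
  HomotopyCategory.quotient B (ComplexShape.up ℤ)

/-- If the complexes `Hom(L_p, cone j)` are exact, then composition with `j : X ⟶ Y` is bijective
on homotopy classes of maps from `L`. -/
lemma HomExact.bijective {L X Y : CochainComplex B ℤ} (j : X ⟶ Y)
    (h : HomExact L (mappingCone j)) (a d : ℤ) [L.IsStrictlyLE a]
    [(mappingCone j).IsStrictlyGE d] :
    Function.Bijective (fun g : (toK B).obj L ⟶ (toK B).obj X => g ≫ (toK B).map j) := by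
  have hT := HomotopyCategory.mappingCone_triangleh_distinguished j
  -- the long exact sequence of the triangle `X ⟶ Y ⟶ cone j`, whose cone terms vanish
  have hz : ∀ (n : ℤ) (g : (toK B).obj L ⟶ (toK B).obj ((mappingCone j)⟦n⟧)), g = 0 := by
    intro n g
    obtain ⟨g, rfl⟩ := (toK B).map_surjective g
    have : ((mappingCone j)⟦n⟧).IsStrictlyGE (d - n) :=
      (mappingCone j).isStrictlyGE_shift d n (d - n) (by lia)
    obtain ⟨H⟩ := (h.shift n).nonempty_homotopy g a (d - n)
    rw [HomotopyCategory.eq_of_homotopy g 0 H, Functor.map_zero]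
  constructor
  · refine (injective_iff_map_eq_zero (AddMonoidHom.mk'
      (fun g : (toK B).obj L ⟶ (toK B).obj X => g ≫ (toK B).map j)
      (fun _ _ => Preadditive.add_comp ..))).2 fun g hg => ?_
    obtain ⟨t, ht⟩ := Triangle.coyoneda_exact₂ _ (inv_rot_of_distTriang _ hT) g hg
    have ht0 : t = 0 := by
      have := hz (-1) (t ≫ (((toK B).commShiftIso (-1 : ℤ)).inv.app (mappingCone j)))
      exact (cancel_mono (((toK B).commShiftIso (-1 : ℤ)).inv.app (mappingCone j))).1
        (this.trans zero_comp.symm)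
    rw [ht, ht0]
    exact zero_comp
  · intro g
    obtain ⟨t, ht⟩ := Triangle.coyoneda_exact₂ _ hT g (by
      have := hz 0 (g ≫ (toK B).map (mappingCone.inr j) ≫
        (toK B).map ((CategoryTheory.shiftFunctorZero _ ℤ).inv.app _))
      rw [← Category.assoc] at this
      exact (cancel_mono ((toK B).map ((CategoryTheory.shiftFunctorZero _ ℤ).inv.app _))).1
        (this.trans zero_comp.symm))
    exact ⟨t, ht.symm⟩

/-- A bounded below acyclic complex `V` of injective objects is contractible, so that the
complexes `Hom(X, V)` are exact. -/
lemma exists_lift_of_injective_acyclic {V : CochainComplex A ℤ} (d : ℤ) [V.IsStrictlyGE d]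
    (hV : V.Acyclic) [∀ p, Injective (V.X p)] {X : A} {i j k : ℤ} (hij : i + 1 = j)
    (hjk : j + 1 = k) (g : X ⟶ V.X j) (hg : g ≫ V.d j k = 0) :
    ∃ h : X ⟶ V.X i, h ≫ V.d i j = g := by
  have : V.IsKInjective := isKInjective_of_injective V d
  let s := IsKInjective.homotopyZero (𝟙 V) hV
  refine ⟨g ≫ s.hom j i, ?_⟩
  have h1 := s.comm j
  rw [dNext_eq s.hom (show (ComplexShape.up ℤ).Rel j k from hjk),
    prevD_eq s.hom (show (ComplexShape.up ℤ).Rel i j from hij)] at h1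
  have h2 := congrArg (g ≫ ·) h1
  simp only [HomologicalComplex.id_f, Category.comp_id, HomologicalComplex.zero_f, add_zero,
    Preadditive.comp_add, reassoc_of% hg, zero_comp, zero_add] at h2
  rw [Category.assoc, ← h2]

/-- Suppose that `Hom(L_p, -)` is `Hom(K_p, R -)` for an exact functor `R`, and that `W` is acyclic,
bounded below and sent by `R` to a complex of injectives. Then the complexes `Hom(L_p, W)` are
exact, as `R W` is contractible. -/
lemma HomExact.of_injective {L W : CochainComplex B ℤ} (R : B ⥤ A) [R.Additive]
    [PreservesFiniteLimits R] [PreservesFiniteColimits R] (K : ℤ → A)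
    (u : ∀ p, K p ⟶ R.obj (L.X p))
    (hu : ∀ p (N : B), Function.Bijective (fun g : L.X p ⟶ N => u p ≫ R.map g))
    (d : ℤ) [W.IsStrictlyGE d] (hW : W.Acyclic) (hR : ∀ p, Injective (R.obj (W.X p))) :
    HomExact L W := by
  intro p i j k hij hjk g hg
  let RW : CochainComplex A ℤ := (R.mapHomologicalComplex (ComplexShape.up ℤ)).obj W
  have : RW.IsStrictlyGE d := by
    rw [isStrictlyGE_iff]
    exact fun q hq => R.map_isZero (W.isZero_of_isStrictlyGE d q hq)
  have : ∀ q, Injective (RW.X q) := hR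
  obtain ⟨t', ht'⟩ := exists_lift_of_injective_acyclic (V := RW) d (fun q => (hW q).map R) hij hjk
    (u p ≫ R.map g) ((Category.assoc _ _ _).trans (by
      have := congrArg R.map hg
      rw [R.map_comp, R.map_zero] at this
      exact (congrArg (u p ≫ ·) this).trans comp_zero))
  obtain ⟨t, ht⟩ := (hu p (W.X i)).surjective t'
  refine ⟨t, (hu p (W.X j)).injective ?_⟩
  refine Eq.trans ?_ ht'
  rw [← ht]
  exact (congrArg (u p ≫ ·) (R.map_comp _ _)).trans (Category.assoc _ _ _).symm

section
variable [HasDerivedCategory.{w} B]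

/-- Maps to a complex of injectives are equal in the derived category if and only if they are
homotopic. -/
lemma Q_map_eq_iff {K L : CochainComplex B ℤ} [L.IsKInjective] (f g : K ⟶ L) :
    DerivedCategory.Q.map f = DerivedCategory.Q.map g ↔ (toK B).map f = (toK B).map g := by
  constructor
  · intro h
    apply (IsKInjective.Qh_map_bijective ((toK B).obj K) L).injective
    have h1 := (DerivedCategory.quotientCompQhIso B).hom.naturality f
    have h2 := (DerivedCategory.quotientCompQhIso B).hom.naturality g
    rw [h, ← h2] at h1
    exact (cancel_mono _).1 h1
  · intro h
    have h1 := (DerivedCategory.quotientCompQhIso B).hom.naturality f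
    have h2 := (DerivedCategory.quotientCompQhIso B).hom.naturality g
    dsimp only [Functor.comp_map] at h1 h2
    rw [h, h2] at h1
    exact ((cancel_epi _).1 h1).symm

lemma Q_map_surjective {K L : CochainComplex B ℤ} [L.IsKInjective]
    (c : DerivedCategory.Q.obj K ⟶ DerivedCategory.Q.obj L) :
    ∃ f : K ⟶ L, DerivedCategory.Q.map f = c := by
  let e := DerivedCategory.quotientCompQhIso B
  obtain ⟨g, hg⟩ := (IsKInjective.Qh_map_bijective ((toK B).obj K) L).surjective
    (e.hom.app K ≫ c ≫ e.inv.app L)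
  obtain ⟨f, rfl⟩ := (toK B).map_surjective g
  refine ⟨f, ?_⟩
  have h1 := e.hom.naturality f
  dsimp only [Functor.comp_map] at h1
  rw [hg] at h1
  simp only [Category.assoc, Iso.inv_hom_id_app] at h1
  exact ((cancel_epi _).1 (h1.symm.trans (by simp)))

end

section
variable (F : A ⥤ B) [F.Additive] {K : CochainComplex A ℤ} {L : CochainComplex B ℤ}
  (φ : L ⟶ (F.mapHomologicalComplex (ComplexShape.up ℤ)).obj K)

/-- A homotopy between `φ ≫ F f` and `φ ≫ F g` comes from a homotopy between `f` and `g`. -/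
lemma nonempty_homotopy_of_pullback {I : CochainComplex A ℤ}
    (hφ : ∀ p (N : A), Function.Bijective (fun g : K.X p ⟶ N => φ.f p ≫ F.map g)) {f g : K ⟶ I}
    (H : Homotopy (φ ≫ (F.mapHomologicalComplex _).map f)
      (φ ≫ (F.mapHomologicalComplex _).map g)) : Nonempty (Homotopy f g) := by
  let e : ∀ p, L.X p ⟶ F.obj (K.X p) := φ.f
  have he : ∀ i j, e i ≫ F.map (K.d i j) = L.d i j ≫ e j := φ.comm
  let h : ∀ i j, L.X i ⟶ F.obj (I.X j) := H.hom
  have hh : ∀ i, e i ≫ F.map (f.f i) = L.d i (i + 1) ≫ h (i + 1) i +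
      h i (i - 1) ≫ F.map (I.d (i - 1) i) + e i ≫ F.map (g.f i) := by
    intro i
    have h1 := H.comm i
    rw [dNext_eq H.hom (show (ComplexShape.up ℤ).Rel i (i + 1) from rfl),
      prevD_eq H.hom (show (ComplexShape.up ℤ).Rel (i - 1) i from by simp)] at h1
    exact h1
  choose s hs using fun i j => (hφ i (I.X j)).surjective (h i j)
  change ∀ i j, e i ≫ F.map (s i j) = h i j at hs
  have hz : ∀ i j, ¬ (ComplexShape.up ℤ).Rel j i → s i j = 0 := by
    intro i j hij
    refine (hφ i _).injective ?_
    change e i ≫ F.map (s i j) = e i ≫ F.map 0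
    rw [hs, F.map_zero, comp_zero]
    exact H.zero i j hij
  refine ⟨⟨s, hz, fun i => (hφ i _).injective ?_⟩⟩
  rw [dNext_eq s (show (ComplexShape.up ℤ).Rel i (i + 1) from rfl),
    prevD_eq s (show (ComplexShape.up ℤ).Rel (i - 1) i from by simp)]
  refine (hh i).trans ?_
  change _ = e i ≫ F.map _
  simp only [Functor.map_add, Functor.map_comp, Preadditive.comp_add, reassoc_of% he i (i + 1),
    ← hs, Category.assoc]

/-- A chain map `L ⟶ F I` is of the form `φ ≫ F f`. -/
lemma exists_pullback_eq {I : CochainComplex A ℤ}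
    (hφ : ∀ p (N : A), Function.Bijective (fun g : K.X p ⟶ N => φ.f p ≫ F.map g))
    (g : L ⟶ (F.mapHomologicalComplex _).obj I) :
    ∃ f : K ⟶ I, φ ≫ (F.mapHomologicalComplex _).map f = g := by
  let e : ∀ p, L.X p ⟶ F.obj (K.X p) := φ.f
  have he : ∀ i j, e i ≫ F.map (K.d i j) = L.d i j ≫ e j := φ.comm
  let h : ∀ i, L.X i ⟶ F.obj (I.X i) := g.f
  have hh : ∀ i j, h i ≫ F.map (I.d i j) = L.d i j ≫ h j := g.comm
  choose s hs using fun i => (hφ i (I.X i)).surjective (h i)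
  change ∀ i, e i ≫ F.map (s i) = h i at hs
  refine ⟨{ f := s, comm' := fun i j _ => (hφ i _).injective ?_ }, ?_⟩
  · change e i ≫ F.map _ = e i ≫ F.map _
    rw [F.map_comp, F.map_comp, reassoc_of% hs i, hh, reassoc_of% he i j, hs]
  · ext i
    exact hs i

end

section
variable [HasDerivedCategory.{w} A] [HasDerivedCategory.{w'} B]
  (F : A ⥤ B) [F.Additive] [PreservesFiniteLimits F] [PreservesFiniteColimits F]
  {K : CochainComplex A ℤ} {L : CochainComplex B ℤ}
  (φ : L ⟶ (F.mapHomologicalComplex (ComplexShape.up ℤ)).obj K)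

/-- The map `Hom(K, X) → Hom(L, F X)` of derived categories induced by `φ : L ⟶ F K`, for an
exact functor `F`. -/
def derivedPullback {X : DerivedCategory A} (c : DerivedCategory.Q.obj K ⟶ X) :
    DerivedCategory.Q.obj L ⟶ F.mapDerivedCategory.obj X :=
  DerivedCategory.Q.map φ ≫ F.mapDerivedCategoryFactors.inv.app K ≫ F.mapDerivedCategory.map c

lemma derivedPullback_comp {X Y : DerivedCategory A} (c : DerivedCategory.Q.obj K ⟶ X)
    (f : X ⟶ Y) : derivedPullback F φ (c ≫ f) =
      derivedPullback F φ c ≫ F.mapDerivedCategory.map f := by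
  simp [derivedPullback]

lemma derivedPullback_Q {M : CochainComplex A ℤ} (f : K ⟶ M) :
    derivedPullback F φ (DerivedCategory.Q.map f) ≫ F.mapDerivedCategoryFactors.hom.app M =
      DerivedCategory.Q.map (φ ≫ (F.mapHomologicalComplex _).map f) := by
  rw [derivedPullback, Category.assoc, Category.assoc, F.mapDerivedCategoryFactors_hom_naturality,
    Functor.map_comp]
  congr 1
  exact Iso.inv_hom_id_app_assoc F.mapDerivedCategoryFactors K _

lemma derivedPullback_bijective_of_iso {X Y : DerivedCategory A} (e : X ≅ Y)
    (h : Function.Bijective (derivedPullback F φ (X := X))) :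
    Function.Bijective (derivedPullback F φ (X := Y)) := by
  constructor
  · intro c c' hc
    rw [← cancel_mono e.inv]
    apply h.injective
    rw [derivedPullback_comp, derivedPullback_comp, hc]
  · intro c
    obtain ⟨t, ht⟩ := h.surjective (c ≫ F.mapDerivedCategory.map e.inv)
    refine ⟨t ≫ e.hom, ?_⟩
    rw [derivedPullback_comp, ht, Category.assoc, ← Functor.map_comp, e.inv_hom_id,
      CategoryTheory.Functor.map_id, Category.comp_id]

/-- Suppose that `Hom(L_p, -)` is `Hom(K_p, R -)` for an exact functor `R`, and that the maps
`φ_p : L_p ⟶ F K_p` induce bijections `Hom(K_p, N) → Hom(L_p, F N)`. Then `Hom(K, X) → Hom(L, F X)`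
is bijective for `X` bounded below.

Let `I` be an injective resolution of `X`, and `j : F I ⟶ E` one of `F I`. The source is computed by
maps `K ⟶ I` up to homotopy, hence by maps `L ⟶ F I` up to homotopy, and the target by maps
`L ⟶ E` up to homotopy. The two agree although `F I` need not be injective: `R` sends the cone of
`j` to an acyclic complex of injectives, so that `Hom(L_p, cone j)` is exact. -/
theorem derivedPullback_bijective [EnoughInjectives A] [EnoughInjectives B] (R : B ⥤ A)
    [R.Additive] [PreservesFiniteLimits R] [PreservesFiniteColimits R]
    (hR : ∀ N, Injective N → Injective (R.obj N))
    (hFR : ∀ N, Injective N → Injective (R.obj (F.obj N)))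
    (u : ∀ p, K.X p ⟶ R.obj (L.X p))
    (hu : ∀ p (N : B), Function.Bijective (fun g : L.X p ⟶ N => u p ≫ R.map g))
    (hφ : ∀ p (N : A), Function.Bijective (fun g : K.X p ⟶ N => φ.f p ≫ F.map g))
    (a : ℤ) [L.IsStrictlyLE a] (M : CochainComplex A ℤ) (d : ℤ) [M.IsStrictlyGE d] :
    Function.Bijective (derivedPullback F φ (X := DerivedCategory.Q.obj M)) := by
  obtain ⟨I, ι, _, hI, _⟩ := CochainComplex.Plus.modelCategoryQuillen.exists_quasiIso_injective M d
  refine derivedPullback_bijective_of_iso F φ (asIso (DerivedCategory.Q.map ι)).symm ?_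
  let FI : CochainComplex B ℤ := (F.mapHomologicalComplex (ComplexShape.up ℤ)).obj I
  have hFI : FI.IsStrictlyGE d := by
    rw [isStrictlyGE_iff]
    exact fun q hq => F.map_isZero (I.isZero_of_isStrictlyGE d q hq)
  obtain ⟨E, j, _, hE, _⟩ := CochainComplex.Plus.modelCategoryQuillen.exists_quasiIso_injective FI d
  have : I.IsKInjective := isKInjective_of_injective I d
  have : E.IsKInjective := isKInjective_of_injective E d
  have hcone : (mappingCone j).IsStrictlyGE (d - 1) := by
    rw [isStrictlyGE_iff]
    intro q hq
    refine IsZero.of_iso ?_ (HomologicalComplex.homotopyCofiber.XIsoBiprod j q (q + 1) rfl)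
    exact biprod_isZero_iff _ _ |>.2 ⟨FI.isZero_of_isStrictlyGE d _ (by lia),
      E.isZero_of_isStrictlyGE d _ (by lia)⟩
  have hac : HomologicalComplex.Acyclic (mappingCone j) := by
    rw [← HomotopyCategory.quotient_obj_mem_subcategoryAcyclic_iff_acyclic]
    have hj : HomotopyCategory.quasiIso B (ComplexShape.up ℤ) ((toK B).map j) := by
      rw [HomotopyCategory.quotient_map_mem_quasiIso_iff]
      assumption
    rw [HomotopyCategory.quasiIso_eq_trW_subcategoryAcyclic] at hj
    exact (ObjectProperty.trW_iff_of_distinguished _ _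
      (HomotopyCategory.mappingCone_triangleh_distinguished j)).1 hj
  have := preservesBinaryBiproducts_of_preservesBinaryProducts R
  have hinj : ∀ p, Injective (R.obj ((mappingCone j).X p)) := by
    intro p
    have h1 : Injective (R.obj (FI.X (p + 1))) := hFR _ (hI _)
    have h2 : Injective (R.obj (E.X p)) := hR _ (hE _)
    exact Injective.of_iso ((R.mapBiprod _ _).symm ≪≫ R.mapIso
      (HomologicalComplex.homotopyCofiber.XIsoBiprod j p (p + 1) rfl).symm) inferInstance
  have hbij := (HomExact.of_injective R K.X u hu (d - 1) hac hinj).bijective j a (d - 1)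
  constructor
  · intro c c' hc
    obtain ⟨f, rfl⟩ := Q_map_surjective c
    obtain ⟨f', rfl⟩ := Q_map_surjective c'
    have h1 := congrArg (· ≫ F.mapDerivedCategoryFactors.hom.app I) hc
    simp only [derivedPullback_Q] at h1
    have h2 := congrArg (· ≫ DerivedCategory.Q.map j) h1
    simp only [← Functor.map_comp] at h2
    rw [Q_map_eq_iff, Functor.map_comp, Functor.map_comp _ _ j] at h2
    obtain ⟨H⟩ := nonempty_homotopy_of_pullback F φ hφ
      (HomotopyCategory.homotopyOfEq _ _ (hbij.injective h2))
    rw [Q_map_eq_iff, HomotopyCategory.eq_of_homotopy _ _ H]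
  · intro c
    obtain ⟨h, hh⟩ := Q_map_surjective
      (c ≫ F.mapDerivedCategoryFactors.hom.app I ≫ DerivedCategory.Q.map j)
    obtain ⟨g', hg'⟩ := hbij.surjective ((toK B).map h)
    obtain ⟨g, rfl⟩ := (toK B).map_surjective g'
    obtain ⟨f, rfl⟩ := exists_pullback_eq F φ hφ g
    refine ⟨DerivedCategory.Q.map f, ?_⟩
    have h1 : DerivedCategory.Q.map ((φ ≫ (F.mapHomologicalComplex _).map f) ≫ j) =
        DerivedCategory.Q.map h := by
      rw [Q_map_eq_iff, ← hg', Functor.map_comp]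
    rw [hh, Functor.map_comp, ← derivedPullback_Q, Category.assoc] at h1
    rw [← cancel_mono (F.mapDerivedCategoryFactors.hom.app I), ← cancel_mono
      (DerivedCategory.Q.map j)]
    simpa using h1

end
end HomologicalAlgebra

/-! ### Forgetting the action of `G` -/

section
variable {A B : Type*} [Category* A] [Category* B] [Abelian A] [Abelian B]

/-- A family of maps `f_n : L_n ⟶ F K_n` inducing bijections `Hom(K_n, N) → Hom(L_n, F N)` still
does so after extension by zero to the indices in `ℤ`. -/
lemma extendToMapX_bijective (F : A ⥤ B) {K : ChainComplex A ℕ} {L : ChainComplex B ℕ}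
    (f : ∀ n, L.X n ⟶ F.obj (K.X n))
    (hf : ∀ n (N : A), Function.Bijective (fun g : K.X n ⟶ N => f n ≫ F.map g)) (i : ℤ) (N : A) :
    Function.Bijective (fun g : (K.extend ComplexShape.embeddingDownNat).X i ⟶ N =>
      extendToMapX F f i ≫ F.map g) := by
  by_cases h : ∃ n, ComplexShape.embeddingDownNat.f n = i
  · obtain ⟨n, hn⟩ := h
    let e := K.extendXIso ComplexShape.embeddingDownNat hn
    let e' := L.extendXIso ComplexShape.embeddingDownNat hn
    have h1 : (fun g : (K.extend ComplexShape.embeddingDownNat).X i ⟶ N =>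
        extendToMapX F f i ≫ F.map g) = e'.symm.homFromEquiv ∘
          (fun g : K.X n ⟶ N => f n ≫ F.map g) ∘ e.homFromEquiv := by
      ext g
      simp [extendToMapX_eq F f hn, e, e']
    rw [h1]
    exact e'.symm.homFromEquiv.bijective.comp ((hf n N).comp e.homFromEquiv.bijective)
  · have h' : ∀ n, ComplexShape.embeddingDownNat.f n ≠ i := fun n hn => h ⟨n, hn⟩
    have hK := K.isZero_extend_X ComplexShape.embeddingDownNat i h'
    have hL := L.isZero_extend_X ComplexShape.embeddingDownNat i h'
    exact ⟨fun g g' _ => hK.eq_of_src _ _, fun g => ⟨0, hL.eq_of_src _ _⟩⟩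

end

section Restriction
variable {C : Type u} [Category.{v} C] {J : GrothendieckTopology C}

instance : EnoughInjectives (AbSheaf J) := by
  have : EssentiallySmall.{max u v} C := inferInstance
  have : IsGrothendieckAbelian.{max u v} (AbSheaf J) :=
    Sheaf.isGrothendieckAbelian_of_essentiallySmall _ _
  exact IsGrothendieckAbelian.enoughInjectives

variable (G : GrpSheaf J)

instance : (siteIncl G).IsCocontinuous J (classifyingTopology G) where
  cover_lift hS := hS

variable {G}

/-- The automorphism of an object `V` of the classifying site given by a section of `G` over `V`. -/
def siteAct {V : ClassifyingSite G} (h : G.obj.obj (op V.base)) : V ⟶ V :=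
  (⟨𝟙 _, h⟩ : ClassifyingSite.Hom V V)

/-- A morphism of `C`, as a morphism of the classifying site, with trivial component in `G`. -/
def siteLift {V W : ClassifyingSite G} (f : V.base ⟶ W.base) : V ⟶ W :=
  (⟨f, 1⟩ : ClassifyingSite.Hom V W)

/-- A morphism of the classifying site is an action of `G` followed by a morphism of `C`. -/
lemma siteAct_comp_siteLift {V W : ClassifyingSite G} (φ : V ⟶ W) :
    siteAct φ.g ≫ siteLift φ.f = φ := by
  refine ClassifyingSite.Hom.ext (Category.id_comp _) ?_
  change φ.g * (G.obj.map (𝟙 _)).hom 1 = φ.g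
  simp

lemma siteAct_mul_comp_siteLift {V W : ClassifyingSite G} (φ : V ⟶ W)
    (h : G.obj.obj (op W.base)) :
    siteAct (φ.g * G.obj.map φ.f.op h) ≫ siteLift φ.f = φ ≫ siteAct h := by
  refine ClassifyingSite.Hom.ext ((Category.id_comp _).trans (Category.comp_id _).symm) ?_
  change φ.g * (G.obj.map φ.f.op).hom h * (G.obj.map (𝟙 _)).hom 1 =
    φ.g * (G.obj.map φ.f.op).hom h
  simp

lemma map_map_type {D : Type*} [Category* D] (N : Dᵒᵖ ⥤ Type w) {U V W : D} (a : U ⟶ V)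
    (b : V ⟶ W) (x : N.obj (op W)) : N.map a.op (N.map b.op x) = N.map (a ≫ b).op x := by
  simp

lemma map_map_ab {D : Type*} [Category* D] (N : Dᵒᵖ ⥤ AddCommGrpCat.{w}) {U V W : D} (a : U ⟶ V)
    (b : V ⟶ W) (x : N.obj (op W)) : N.map a.op (N.map b.op x) = N.map (a ≫ b).op x := by
  simp

variable (G)

lemma siteIncl_compatiblePreserving :
    CompatiblePreserving (classifyingTopology G) (siteIncl G) where
  compatible {P Z T x} hx {Y₁ Y₂ X} f₁ f₂ g₁ g₂ hg₁ hg₂ eq := by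
    have e1 : f₁.f ≫ g₁ = f₂.f ≫ g₂ := congrArg ClassifyingSite.Hom.f eq
    have e2 : f₁.g = f₂.g := by
      have h : f₁.g * (G.obj.map f₁.f.op).hom 1 = f₂.g * (G.obj.map f₂.f.op).hom 1 :=
        congrArg ClassifyingSite.Hom.g eq
      simpa using h
    have key : ∀ {Y : C} (f : X ⟶ (siteIncl G).obj Y) (y : P.obj.obj (op ((siteIncl G).obj Y))),
        P.obj.map f.op y = P.obj.map (siteAct f.g).op (P.obj.map (siteLift f.f).op y) :=
      fun f y => ((map_map_type P.obj _ _ y).trans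
        (congrArg (fun k : X ⟶ _ => P.obj.map k.op y) (siteAct_comp_siteLift f))).symm
    refine (key f₁ _).trans (Eq.trans ?_ (key f₂ _).symm)
    rw [e2]
    exact congrArg (P.obj.map (siteAct f₂.g).op) (hx f₁.f f₂.f hg₁ hg₂ e1)

instance : (siteIncl G).IsContinuous J (classifyingTopology G) :=
  Functor.isContinuous_of_coverPreserving (siteIncl_compatiblePreserving G)
    ⟨fun hS => J.superset_covering (fun _ f hf => ⟨_, f, 𝟙 _, hf, (Category.id_comp _).symm⟩) hS⟩

/-- The functor from the abelian group objects of `B_G` to abelian sheaves which forgets the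
action of `G`. -/
def forgetAction : BAb G ⥤ AbSheaf J :=
  (siteIncl G).sheafPushforwardContinuous _ J (classifyingTopology G)

instance : Limits.PreservesFiniteLimits (forgetAction G) := by
  unfold forgetAction; infer_instance

instance : Limits.PreservesFiniteColimits (forgetAction G) := by
  have := ((siteIncl G).sheafAdjunctionCocontinuous AddCommGrpCat.{max u v}
    J (classifyingTopology G)).leftAdjoint_preservesColimits
  unfold forgetAction; infer_instance

instance : (forgetAction G).Additive where
  map_add := rfl

/-- Forgetting the trivial action gives back the sheaf itself. -/
lemma injective_forgetAction_trivAb (N : AbSheaf J) [Injective N] :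
    Injective ((forgetAction G).obj ((trivAb G).obj N)) :=
  inferInstanceAs (Injective N)

/-- The presheaf on the classifying site induced from a presheaf `F` on `C`: a section over `V` is a
formal combination of elements of `G(V)` with coefficients in `F(V)`. -/
def inducedPresheaf (F : Cᵒᵖ ⥤ AddCommGrpCat.{max u v}) :
    (ClassifyingSite G)ᵒᵖ ⥤ AddCommGrpCat.{max u v} where
  obj V := AddCommGrpCat.of (G.obj.obj (op V.unop.base) →₀ F.obj (op V.unop.base))
  map φ := AddCommGrpCat.ofHom (Finsupp.liftAddHom fun h =>
    (Finsupp.singleAddHom (φ.unop.g * G.obj.map φ.unop.f.op h)).comp (F.map φ.unop.f.op).hom)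
  map_id V := AddCommGrpCat.hom_ext (Finsupp.addHom_ext fun h x => by
    change Finsupp.liftAddHom _ (Finsupp.single h x) = Finsupp.single h x
    rw [Finsupp.liftAddHom_apply_single]
    change Finsupp.single (1 * (G.obj.map (𝟙 _)).hom h) ((F.map (𝟙 _)).hom x) = _
    simp)
  map_comp φ ψ := AddCommGrpCat.hom_ext (Finsupp.addHom_ext fun h x => by
    change Finsupp.liftAddHom _ (Finsupp.single h x) = Finsupp.liftAddHom _
      (Finsupp.liftAddHom _ (Finsupp.single h x))
    rw [Finsupp.liftAddHom_apply_single, Finsupp.liftAddHom_apply_single]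
    change Finsupp.single (ψ.unop.g * (G.obj.map ψ.unop.f.op).hom φ.unop.g *
      (G.obj.map (φ.unop.f.op ≫ ψ.unop.f.op)).hom h) ((F.map (φ.unop.f.op ≫ ψ.unop.f.op)).hom x) =
      Finsupp.liftAddHom _ (Finsupp.single (φ.unop.g * (G.obj.map φ.unop.f.op).hom h)
        ((F.map φ.unop.f.op).hom x))
    rw [Finsupp.liftAddHom_apply_single]
    change _ = Finsupp.single (ψ.unop.g * (G.obj.map ψ.unop.f.op).hom
      (φ.unop.g * (G.obj.map φ.unop.f.op).hom h)) ((F.map ψ.unop.f.op).hom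
        ((F.map φ.unop.f.op).hom x))
    simp [mul_assoc])

lemma inducedPresheaf_map_single (F : Cᵒᵖ ⥤ AddCommGrpCat.{max u v})
    {V W : (ClassifyingSite G)ᵒᵖ} (φ : V ⟶ W) (h : G.obj.obj (op V.unop.base))
    (x : F.obj (op V.unop.base)) :
    ((inducedPresheaf G F).map φ).hom (Finsupp.single h x) =
      Finsupp.single (φ.unop.g * G.obj.map φ.unop.f.op h) (F.map φ.unop.f.op x) :=
  Finsupp.liftAddHom_apply_single _ _ _

/-- Induction of presheaves of abelian groups from `C` to the classifying site. -/
def induction : (Cᵒᵖ ⥤ AddCommGrpCat.{max u v}) ⥤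
    ((ClassifyingSite G)ᵒᵖ ⥤ AddCommGrpCat.{max u v}) where
  obj := inducedPresheaf G
  map k :=
    { app := fun V => AddCommGrpCat.ofHom (Finsupp.mapRange.addMonoidHom (k.app _).hom)
      naturality := fun V W φ => AddCommGrpCat.hom_ext (Finsupp.addHom_ext fun h x => by
        change Finsupp.mapRange.addMonoidHom _ (((inducedPresheaf G _).map φ).hom
          (Finsupp.single h x)) = ((inducedPresheaf G _).map φ).hom
            (Finsupp.mapRange.addMonoidHom _ (Finsupp.single h x))
        rw [inducedPresheaf_map_single]
        simp only [Finsupp.mapRange.addMonoidHom_apply, Finsupp.mapRange_single]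
        rw [inducedPresheaf_map_single]
        exact congrArg (Finsupp.single _)
          (congrArg (fun l => l.hom x) (k.naturality φ.unop.f.op))) }
  map_id F := NatTrans.ext (funext fun V => AddCommGrpCat.hom_ext
    (Finsupp.mapRange.addMonoidHom_id))
  map_comp k l := NatTrans.ext (funext fun V => AddCommGrpCat.hom_ext
    (Finsupp.mapRange.addMonoidHom_comp _ _))

lemma induction_map_single {F F' : Cᵒᵖ ⥤ AddCommGrpCat.{max u v}} (k : F ⟶ F')
    (V : (ClassifyingSite G)ᵒᵖ) (h : G.obj.obj (op V.unop.base)) (x : F.obj (op V.unop.base)) :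
    (((induction G).map k).app V).hom (Finsupp.single h x) =
      Finsupp.single h (k.app (op V.unop.base) x) :=
  Finsupp.mapRange_single (hf := map_zero _)

instance : (induction G).PreservesMonomorphisms where
  preserves {X Y} k hk := by
    have h : ∀ V, Mono (((induction G).map k).app V) := by
      intro V
      rw [AddCommGrpCat.mono_iff_injective]
      have : Mono (k.app (op V.unop.base)) := inferInstance
      exact Finsupp.mapRange_injective _ (map_zero _) ((AddCommGrpCat.mono_iff_injective _).1 this)
    exact NatTrans.mono_of_mono_app _

/-- The map `F ⟶ i^*(Ind F)`, `x ↦ [1] x`. -/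
def inductionUnit (F : Cᵒᵖ ⥤ AddCommGrpCat.{max u v}) :
    F ⟶ (siteIncl G).op ⋙ inducedPresheaf G F where
  app V := AddCommGrpCat.ofHom (Finsupp.singleAddHom 1)
  naturality V W f := AddCommGrpCat.hom_ext (AddMonoidHom.ext fun x => by
    refine Eq.symm ((inducedPresheaf_map_single G F ((siteIncl G).op.map f) 1 x).trans ?_)
    change Finsupp.single (1 * (G.obj.map f).hom 1) _ = Finsupp.single 1 _
    simp
    rfl)

/-- The map `Ind (i^* N) ⟶ N`, `[h] x ↦ h • x`. -/
def inductionCounit (N : (ClassifyingSite G)ᵒᵖ ⥤ AddCommGrpCat.{max u v}) :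
    inducedPresheaf G ((siteIncl G).op ⋙ N) ⟶ N where
  app V := AddCommGrpCat.ofHom (Finsupp.liftAddHom fun h =>
    (N.map (siteAct (V := V.unop) h).op).hom)
  naturality V W φ := AddCommGrpCat.hom_ext (Finsupp.addHom_ext fun h x => by
    change Finsupp.liftAddHom _ (((inducedPresheaf G _).map φ).hom (Finsupp.single h x)) =
      (N.map φ).hom (Finsupp.liftAddHom _ (Finsupp.single h x))
    rw [inducedPresheaf_map_single]
    refine (Finsupp.liftAddHom_apply_single _ _ _).trans ?_
    refine Eq.trans ?_ (congrArg (N.map φ).hom (Finsupp.liftAddHom_apply_single _ _ _)).symm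
    refine (map_map_ab N _ (siteLift (V := W.unop) (W := V.unop) φ.unop.f) x).trans ?_
    refine Eq.trans ?_ (map_map_ab N φ.unop (siteAct h) x).symm
    exact congrArg (fun k : W.unop ⟶ V.unop => N.map k.op x)
      (siteAct_mul_comp_siteLift φ.unop h))

lemma inductionCounit_single (N : (ClassifyingSite G)ᵒᵖ ⥤ AddCommGrpCat.{max u v})
    (V : (ClassifyingSite G)ᵒᵖ) (h : G.obj.obj (op V.unop.base)) (x : N.obj V) :
    ((inductionCounit G N).app V).hom (Finsupp.single h x) = N.map (siteAct h).op x :=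
  Finsupp.liftAddHom_apply_single _ _ _

/-- Induction is left adjoint to forgetting the action of `G`. -/
def inductionAdj : induction G ⊣
    (Functor.whiskeringLeft _ _ AddCommGrpCat.{max u v}).obj (siteIncl G).op :=
  Adjunction.mkOfUnitCounit
    { unit :=
        { app := inductionUnit G
          naturality := fun F F' k => NatTrans.ext (funext fun V => AddCommGrpCat.hom_ext
            (AddMonoidHom.ext fun x =>
              (induction_map_single G k ((siteIncl G).op.obj V) 1 x).symm)) }
      counit :=
        { app := inductionCounit G
          naturality := fun N N' k => NatTrans.ext (funext fun V => AddCommGrpCat.hom_ext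
            (Finsupp.addHom_ext fun h x => by
              refine (congrArg ((inductionCounit G N').app V).hom (induction_map_single G
                (Functor.whiskerLeft (siteIncl G).op k) V h x)).trans ?_
              refine (inductionCounit_single G N' V h _).trans ?_
              refine Eq.trans ?_ (congrArg (k.app V).hom (inductionCounit_single G N V h x)).symm
              exact (congrArg (fun l => l.hom x) (k.naturality (siteAct h).op)).symm)) }
      left_triangle := NatTrans.ext (funext fun F => NatTrans.ext (funext fun V =>
        AddCommGrpCat.hom_ext (Finsupp.addHom_ext fun h x => by
          refine (congrArg ((inductionCounit G (inducedPresheaf G F)).app V).hom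
            (induction_map_single G (inductionUnit G F) V h x)).trans ?_
          refine (inductionCounit_single G _ V h _).trans ?_
          refine (inducedPresheaf_map_single G F (siteAct (V := V.unop) h).op 1 x).trans ?_
          change Finsupp.single (h * (G.obj.map (𝟙 _)).hom 1) ((F.map (𝟙 _)).hom x) =
            Finsupp.single h x
          simp)))
      right_triangle := NatTrans.ext (funext fun N => NatTrans.ext (funext fun V =>
        AddCommGrpCat.hom_ext (AddMonoidHom.ext fun x => by
          refine (inductionCounit_single G N ((siteIncl G).op.obj V) 1 x).trans ?_
          exact congrArg (fun l => l.hom x) (N.map_id _)))) }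

/-- Forgetting the action preserves injectives: as a functor to presheaves, it has the left adjoint
given by induction and sheafification, both of which preserve monomorphisms. -/
lemma injective_forgetAction (N : BAb G) [Injective N] : Injective ((forgetAction G).obj N) := by
  let adj := (inductionAdj G).comp (sheafificationAdjunction (classifyingTopology G)
    AddCommGrpCat.{max u v})
  have h : Injective ((sheafToPresheaf J _).obj ((forgetAction G).obj N)) :=
    Injective.injective_of_adjoint adj N
  refine ⟨fun {X Y} g f _ => ?_⟩
  obtain ⟨k, hk⟩ := h.factors ((sheafToPresheaf J _).map g) ((sheafToPresheaf J _).map f)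
  refine ⟨(fullyFaithfulSheafToPresheaf J _).preimage k,
    (sheafToPresheaf J _).map_injective ?_⟩
  rw [Functor.map_comp, Functor.FullyFaithful.map_preimage, hk]

end Restriction

/-! ### The hypercohomology of `EG` is that of `BG` -/

section Universal
variable {C : Type u} [Category.{v} C] {J : GrothendieckTopology C} (G : GrpSheaf J)

/-- The section `B_n G ⟶ E_n G` (not `G`-equivariant) sending a simplex to the tuple of its
vertices, the zeroth of which is placed at `1`. -/
def baseVertices (n : ℕ) {V : C} (x : ((classifying G) _⦋n⦌).obj.obj (op V)) :
    ((universalTotal G) _⦋n⦌).obj.obj (op ((siteIncl G).obj V)) :=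
  fun i => (show BarSimplex (Fin (n + 1)) (G.obj.obj (op V)) from x).g 0 i

lemma BarSimplex.g_self {ι : Type} {H : Type*} [Group H] (x : BarSimplex ι H) (i : ι) :
    x.g i i = 1 := by
  simpa using x.mul_eq i i i

lemma universalProj_baseVertices (n : ℕ) {V : C} (x : ((classifying G) _⦋n⦌).obj.obj (op V)) :
    ((universalProj G).app (op ⦋n⦌)).hom.app _ (baseVertices G n x) = x := by
  let y : BarSimplex (Fin (n + 1)) (G.obj.obj (op V)) := x
  refine BarSimplex.ext (funext fun i => funext fun j => ?_)
  change (y.g 0 i)⁻¹ * y.g 0 j = y.g i j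
  rw [inv_mul_eq_iff_eq_mul, y.mul_eq]

/-- Every section of `E_n G` is the translate of a section with zeroth vertex `1`. -/
lemma siteAct_baseVertices (n : ℕ) (V : ClassifyingSite G)
    (y : ((universalTotal G) _⦋n⦌).obj.obj (op V)) :
    ((universalTotal G) _⦋n⦌).obj.map (siteAct (V := V) (torsorVal (y 0))).op
      (baseVertices G n (V := V.base) (((universalProj G).app (op ⦋n⦌)).hom.app _ y)) = y := by
  funext i
  change torsorVal (y 0) * (G.obj.map (𝟙 _)).hom ((torsorVal (y 0))⁻¹ * torsorVal (y i)) =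
    torsorVal (y i)
  simp

/-- The map `ℤ[B_n G] ⟶ ℤ[E_n G]` of abelian sheaves induced by `baseVertices`. -/
def freeBase (n : ℕ) : (freeChain.obj (classifying G)).X n ⟶
    (forgetAction G).obj ((freeChain.obj (universalTotal G)).X n) :=
  ((freeAdj J).homEquiv _ _).symm
    ⟨{ app := fun V => TypeCat.ofHom fun x =>
        (((freeAdj _).unit.app ((universalTotal G) _⦋n⦌)).hom.app
          (op ((siteIncl G).obj V.unop))) (baseVertices G n x)
       naturality := fun V W f => by
        ext x
        refine Eq.trans ?_ (congrArg (fun k => k (baseVertices G n (V := V.unop) x))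
          (((freeAdj _).unit.app ((universalTotal G) _⦋n⦌)).hom.naturality
            ((siteIncl G).op.map f)))
        refine congrArg (((freeAdj _).unit.app ((universalTotal G) _⦋n⦌)).hom.app
          (op ((siteIncl G).obj W.unop))) (funext fun i => ?_)
        exact (one_mul ((G.obj.map f).hom (BarSimplex.g x 0 i))).symm }⟩

lemma freeBase_unit (n : ℕ) (V : C) (x : ((classifying G) _⦋n⦌).obj.obj (op V)) :
    (freeBase G n).hom.app (op V)
        (((freeAdj J).unit.app ((classifying G) _⦋n⦌)).hom.app (op V) x) =
      ((freeAdj _).unit.app ((universalTotal G) _⦋n⦌)).hom.app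
        (op ((siteIncl G).obj V)) (baseVertices G n x) :=
  free_lift_unit _ (op V) x

lemma free_hom_map {K : Type*} [Category* K] {T : GrothendieckTopology K}
    {Y : SetSheaf T} {N : AbSheaf T} (g : (freeAb T).obj Y ⟶ N) {V W : Kᵒᵖ} (φ : V ⟶ W)
    (y : Y.obj.obj V) :
    g.hom.app W (((freeAdj T).unit.app Y).hom.app W (Y.obj.map φ y)) =
      N.obj.map φ (g.hom.app V (((freeAdj T).unit.app Y).hom.app V y)) :=
  congrArg (fun k => k y) (((freeAdj T).unit.app Y ≫ (forgetAb T).map g).hom.naturality φ)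

lemma freeBase_comp_unit (n : ℕ) {N : BAb G} (g : (freeChain.obj (universalTotal G)).X n ⟶ N)
    (V : C) (x : ((classifying G) _⦋n⦌).obj.obj (op V)) :
    (freeBase G n ≫ (forgetAction G).map g).hom.app (op V)
        (((freeAdj J).unit.app ((classifying G) _⦋n⦌)).hom.app (op V) x) =
      g.hom.app (op ((siteIncl G).obj V)) (((freeAdj _).unit.app ((universalTotal G) _⦋n⦌)).hom.app
        (op ((siteIncl G).obj V)) (baseVertices G n x)) :=
  congrArg (g.hom.app (op ((siteIncl G).obj V))) (freeBase_unit G n V x)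

/-- The equivariant map `E_n G ⟶ N` extending a map `B_n G ⟶ N` of sheaves of sets. -/
def extendEquivariantly (n : ℕ) {N : BAb G}
    (k : (classifying G) _⦋n⦌ ⟶ (forgetAb J).obj ((forgetAction G).obj N)) :
    (universalTotal G) _⦋n⦌ ⟶ (forgetAb _).obj N where
  hom :=
    { app := fun V => TypeCat.ofHom fun y => N.obj.map (siteAct (V := V.unop) (torsorVal (y 0))).op
        (valAb k (op V.unop.base) (((universalProj G).app (op ⦋n⦌)).hom.app V y))
      naturality := fun V W φ => by
        ext y
        have h1 : ((universalProj G).app (op ⦋n⦌)).hom.app W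
            (((universalTotal G) _⦋n⦌).obj.map φ y) = ((classifying G) _⦋n⦌).obj.map φ.unop.f.op
              (((universalProj G).app (op ⦋n⦌)).hom.app V y) :=
          congrArg (fun t => t y) (((universalProj G).app (op ⦋n⦌)).hom.naturality φ)
        have h2 : valAb k (op W.unop.base) (((classifying G) _⦋n⦌).obj.map φ.unop.f.op
              (((universalProj G).app (op ⦋n⦌)).hom.app V y)) =
            N.obj.map (siteLift (V := W.unop) (W := V.unop) φ.unop.f).op
              (valAb k (op V.unop.base) (((universalProj G).app (op ⦋n⦌)).hom.app V y)) :=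
          congrArg (fun t => t (((universalProj G).app (op ⦋n⦌)).hom.app V y))
            (k.hom.naturality φ.unop.f.op)
        refine (congrArg (N.obj.map _) ((congrArg (valAb k (op W.unop.base)) h1).trans h2)).trans ?_
        refine (map_map_ab N.obj _ _ _).trans (Eq.trans ?_ (map_map_ab N.obj _ _ _).symm)
        exact congrArg (fun l : W.unop ⟶ V.unop => N.obj.map l.op (valAb k (op V.unop.base)
          (((universalProj G).app (op ⦋n⦌)).hom.app V y)))
            (siteAct_mul_comp_siteLift φ.unop (torsorVal (y 0))) }

/-- The sheaf `ℤ[E_n G]` is induced from `ℤ[B_n G]`: equivariant maps out of it are the same as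
maps of abelian sheaves out of `ℤ[B_n G]`. -/
lemma freeBase_bijective (n : ℕ) (N : BAb G) :
    Function.Bijective (fun g : (freeChain.obj (universalTotal G)).X n ⟶ N =>
      freeBase G n ≫ (forgetAction G).map g) := by
  constructor
  · intro g g' h
    apply free_hom_ext
    intro V y
    rw [← siteAct_baseVertices G n V.unop y]
    refine (free_hom_map g _ _).trans (Eq.trans ?_ (free_hom_map g' _ _).symm)
    refine congrArg (N.obj.map _) ?_
    refine (freeBase_comp_unit G n g _ _).symm.trans (Eq.trans ?_ (freeBase_comp_unit G n g' _ _))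
    exact congrArg (fun t : (freeChain.obj (classifying G)).X n ⟶ (forgetAction G).obj N =>
      t.hom.app (op V.unop.base) (((freeAdj J).unit.app _).hom.app (op V.unop.base)
        (((universalProj G).app (op ⦋n⦌)).hom.app V y))) h
  · intro k
    let z := extendEquivariantly G n ((freeAdj J).homEquiv _ _ k)
    refine ⟨((freeAdj _).homEquiv _ _).symm z, free_hom_ext fun V x => ?_⟩
    refine (freeBase_comp_unit G n _ V.unop x).trans ((free_lift_unit z _ _).trans ?_)
    have h : ((universalProj G).app (op ⦋n⦌)).hom.app _ (baseVertices G n x) = x :=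
      universalProj_baseVertices G n (V := V.unop) x
    have h0 : torsorVal (baseVertices G n (V := V.unop) x 0) = 1 :=
      BarSimplex.g_self (show BarSimplex (Fin (n + 1)) (G.obj.obj (op V.unop)) from x) 0
    change N.obj.map (siteAct (V := (siteIncl G).obj V.unop)
      (torsorVal (baseVertices G n (V := V.unop) x 0))).op (valAb ((freeAdj J).homEquiv _ _ k)
        (op V.unop) (((universalProj G).app (op ⦋n⦌)).hom.app _ (baseVertices G n x))) = _
    rw [h, h0]
    exact congrArg (fun t => t (k.hom.app V (((freeAdj J).unit.app _).hom.app V x)))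
      (N.obj.map_id _)

/-- Equivariant maps from `ℤ[E_n G]` to a sheaf `N` with trivial action factor uniquely through
`ℤ[B_n G]`. -/
lemma freeToTriv_bijective (n : ℕ) (N : AbSheaf J) :
    Function.Bijective (fun g : (freeChain.obj (classifying G)).X n ⟶ N =>
      (universalChainMap G).f n ≫ (trivAb G).map g) := by
  -- `B_n G ⟶ E_n G ⟶ B_n G` is the identity
  have h1 : ∀ (g : (freeChain.obj (classifying G)).X n ⟶ N),
      freeBase G n ≫ (forgetAction G).map ((universalChainMap G).f n ≫ (trivAb G).map g) = g := by
    intro g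
    apply free_hom_ext
    intro V x
    refine (freeBase_comp_unit G n _ V.unop x).trans ?_
    refine (congrArg (g.hom.app V) (freeToTriv_unit _ _ _)).trans ?_
    exact congrArg (fun t => g.hom.app V (((freeAdj J).unit.app _).hom.app V t))
      (universalProj_baseVertices G n (V := V.unop) x)
  constructor
  · intro g g' h
    rw [← h1 g, ← h1 g']
    exact congrArg (fun t => freeBase G n ≫ (forgetAction G).map t) h
  · intro k
    refine ⟨freeBase G n ≫ (forgetAction G).map k, (freeBase_bijective G n _).injective ?_⟩
    exact h1 _

/-- The projection `EG ⟶ BG` induces a bijection `ℍⁿ(BG, M) → ℍⁿ(EG, M)`. -/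
theorem pullbackToUniversal_bijective [HasDerivedCategory.{w} (AbSheaf J)]
    [HasDerivedCategory.{w'} (BAb G)] (M : AbSheaf J) (n : ℕ) :
    Function.Bijective (pullbackToUniversal G : HH (classifying G) M n → _) := by
  have h := derivedPullback_bijective (trivAb G) (universalComplexMap G) (forgetAction G)
    (fun N _ => injective_forgetAction G N) (fun N _ => injective_forgetAction_trivAb G N)
    (fun p => extendToMapX (forgetAction G) (freeBase G) p)
    (fun p N => extendToMapX_bijective (forgetAction G) (freeBase G) (freeBase_bijective G) p N)
    (fun p N => extendToMapX_bijective (trivAb G) _ (freeToTriv_bijective G) p N)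
    0 ((HomologicalComplex.single _ (ComplexShape.up ℤ) (-(n : ℤ))).obj M) (-(n : ℤ))
  have h' := derivedPullback_bijective_of_iso (trivAb G) (universalComplexMap G)
    ((DerivedCategory.singleFunctorIsoCompQ (AbSheaf J) (-(n : ℤ))).symm.app M) h
  have : (pullbackToUniversal G : HH (classifying G) M n → _) =
      (Iso.homToEquiv (((trivAb G).mapDerivedCategorySingleFunctor (-(n : ℤ))).app M)) ∘
        derivedPullback (trivAb G) (universalComplexMap G) := by
    ext c
    simp [pullbackToUniversal, derivedPullback]
  rw [this]
  exact (Equiv.bijective _).comp h'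

end Universal

/-! ### The complex `ℤ[EG]` is a resolution of `ℤ` -/

section AugmentedComplexes
variable {A B : Type*} [Category* A] [Category* B] [Abelian A] [Abelian B]

lemma quasiIso_extendToSingle (K : ChainComplex A ℕ) {M : A} (φ : K.X 0 ⟶ M)
    (hφ : K.d 1 0 ≫ φ = 0)
    (h : QuasiIso ((ChainComplex.toSingle₀Equiv K M).symm ⟨φ, hφ⟩)) :
    QuasiIso (extendToSingle K (n := 0) φ hφ) := by
  have h0 : ComplexShape.embeddingDownNat.f 0 = -((0 : ℕ) : ℤ) := rfl
  have e : extendToSingle K (n := 0) φ hφ =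
      HomologicalComplex.extendMap ((ChainComplex.toSingle₀Equiv K M).symm ⟨φ, hφ⟩)
        ComplexShape.embeddingDownNat ≫
      (HomologicalComplex.extendSingleIso ComplexShape.embeddingDownNat M 0 _ h0).hom := by
    apply HomologicalComplex.to_single_hom_ext
    rw [HomologicalComplex.comp_f, HomologicalComplex.extendSingleIso_hom_f,
      HomologicalComplex.extendMap_f _ ComplexShape.embeddingDownNat h0]
    simp [extendToSingle]
    erw [Iso.inv_hom_id_assoc, Category.assoc]
    rfl
  rw [e]
  have : QuasiIso (HomologicalComplex.extendMap ((ChainComplex.toSingle₀Equiv K M).symm ⟨φ, hφ⟩)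
        ComplexShape.embeddingDownNat) := by
    rwa [HomologicalComplex.quasiIso_extendMap_iff]
  infer_instance

/-- Augmentations of chain complexes are compatible with additive functors. -/
lemma map_toSingle₀ (F : A ⥤ B) [F.Additive] (K : ChainComplex A ℕ) {M : A} (φ : K.X 0 ⟶ M)
    (hφ : K.d 1 0 ≫ φ = 0) (L : ChainComplex B ℕ) (e : L ⟶ (F.mapHomologicalComplex _).obj K)
    (ψ : L.X 0 ⟶ F.obj M) (hψ : L.d 1 0 ≫ ψ = 0) (h : e.f 0 ≫ F.map φ = ψ) :
    e ≫ (F.mapHomologicalComplex _).map ((ChainComplex.toSingle₀Equiv K M).symm ⟨φ, hφ⟩) ≫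
      (HomologicalComplex.singleMapHomologicalComplex F (ComplexShape.down ℕ) 0).hom.app M =
    (ChainComplex.toSingle₀Equiv L (F.obj M)).symm ⟨ψ, hψ⟩ := by
  apply HomologicalComplex.to_single_hom_ext
  subst h
  simp
  exact congrArg (e.f 0 ≫ ·) (Category.comp_id _)

/-- An exact functor preserves resolutions. -/
lemma quasiIso_toSingle₀_map (F : A ⥤ B) [F.Additive] [Limits.PreservesFiniteLimits F]
    [Limits.PreservesFiniteColimits F] {K : ChainComplex A ℕ} {M : A} {φ : K.X 0 ⟶ M}
    {hφ : K.d 1 0 ≫ φ = 0} (h : QuasiIso ((ChainComplex.toSingle₀Equiv K M).symm ⟨φ, hφ⟩))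
    {L : ChainComplex B ℕ} (e : L ≅ (F.mapHomologicalComplex _).obj K)
    {N : B} (i : F.obj M ≅ N)
    (ψ : L.X 0 ⟶ N) (hψ : L.d 1 0 ≫ ψ = 0) (he : e.hom.f 0 ≫ F.map φ ≫ i.hom = ψ) :
    QuasiIso ((ChainComplex.toSingle₀Equiv L N).symm ⟨ψ, hψ⟩) := by
  have hψ' : L.d 1 0 ≫ ψ ≫ i.inv = 0 := by rw [reassoc_of% hψ, Limits.zero_comp]
  have h1 := map_toSingle₀ F K φ hφ L e.hom (ψ ≫ i.inv) hψ' (by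
    rw [← he]
    simp only [Category.assoc]
    exact congrArg (fun t : F.obj (K.X 0) ⟶ F.obj M => e.hom.f 0 ≫ t)
      (by simp : F.map φ = (F.map φ ≫ i.hom) ≫ i.inv))
  have h2 : (ChainComplex.toSingle₀Equiv L N).symm ⟨ψ, hψ⟩ =
      (ChainComplex.toSingle₀Equiv L _).symm ⟨ψ ≫ i.inv, hψ'⟩ ≫
        (ChainComplex.single₀ B).map i.hom := by
    apply HomologicalComplex.to_single_hom_ext
    simp
  rw [h2, ← h1]
  infer_instance

/-- An augmented complex of functors is a resolution if its values are. -/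
lemma quasiIso_toSingle₀_of_evaluation {T : Type*} [Category* T] {K : ChainComplex (T ⥤ A) ℕ}
    {M : T ⥤ A} (φ : K.X 0 ⟶ M) (hφ : K.d 1 0 ≫ φ = 0) (L : T → ChainComplex A ℕ)
    (e : ∀ t, L t ≅ (((evaluation T A).obj t).mapHomologicalComplex _).obj K)
    (ψ : ∀ t, (L t).X 0 ⟶ ((evaluation T A).obj t).obj M)
    (hψ : ∀ t, (L t).d 1 0 ≫ ψ t = 0)
    (he : ∀ t, (e t).hom.f 0 ≫ ((evaluation T A).obj t).map φ = ψ t)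
    (h : ∀ t, QuasiIso ((ChainComplex.toSingle₀Equiv (L t) _).symm ⟨ψ t, hψ t⟩)) :
    QuasiIso ((ChainComplex.toSingle₀Equiv K M).symm ⟨φ, hφ⟩) := by
  rw [HomologicalComplex.quasiIso_iff_evaluation]
  intro t
  have h2 := h t
  rw [← map_toSingle₀ ((evaluation T A).obj t) K φ hφ _ (e t).hom (ψ t) (hψ t) (he t)] at h2
  have h3 := quasiIso_of_comp_left (e t).hom _ (hφφ' := h2)
  exact quasiIso_of_comp_right _
    ((HomologicalComplex.singleMapHomologicalComplex ((evaluation T A).obj t)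
      (ComplexShape.down ℕ) 0).hom.app M) (hφφ' := h3)

/-- An additive functor commutes with the formation of the alternating face complex. -/
def alternatingFaceMapComplexIso (F : A ⥤ B) [F.Additive] (X : SimplicialObject A) :
    (AlgebraicTopology.alternatingFaceMapComplex B).obj
        (((SimplicialObject.whiskering A B).obj F).obj X) ≅
      (F.mapHomologicalComplex _).obj ((AlgebraicTopology.alternatingFaceMapComplex A).obj X) :=
  eqToIso (Functor.congr_obj (AlgebraicTopology.map_alternatingFaceMapComplex F) X).symm

lemma alternatingFaceMapComplexIso_hom_f (F : A ⥤ B) [F.Additive] (X : SimplicialObject A)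
    (n : ℕ) : (alternatingFaceMapComplexIso F X).hom.f n = 𝟙 (F.obj (X _⦋n⦌)) := by
  rw [alternatingFaceMapComplexIso, eqToIso.hom, HomologicalComplex.eqToHom_f]
  rfl

end AugmentedComplexes

section Augmentation
variable {C : Type u} [Category.{v} C] {J : GrothendieckTopology C}

/-- The augmented simplicial set `X ⟶ pt`. -/
def augmentedToPoint (X : SSet.{w}) : SimplicialObject.Augmented (Type w) where
  left := X
  right := PUnit
  hom := { app := fun _ => TypeCat.ofHom fun _ => PUnit.unit }

/-- The simplicial presheaf of abelian groups `V ↦ ℤ[U(V)]`. -/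
abbrev freePresheaf (U : SimplicialObject (SetSheaf J)) :
    SimplicialObject (Cᵒᵖ ⥤ AddCommGrpCat.{max u v}) :=
  U ⋙ sheafToPresheaf J _ ⋙ (Functor.whiskeringRight _ _ _).obj AddCommGrpCat.free

/-- The map of presheaves `ℤ[X(V)] ⟶ ℤ[pt]`. -/
def presheafAugmentation (X : SetSheaf J) : X.obj ⋙ AddCommGrpCat.free.{max u v} ⟶
    (Functor.const Cᵒᵖ).obj (AddCommGrpCat.free.obj PUnit) where
  app V := AddCommGrpCat.free.map (TypeCat.ofHom fun _ => PUnit.unit)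
  naturality V W f := by
    refine (AddCommGrpCat.free.map_comp _ _).symm.trans (Eq.trans ?_ (Category.comp_id _).symm)
    rfl

lemma d_presheafAugmentation (U : SimplicialObject (SetSheaf J)) :
    ((AlgebraicTopology.alternatingFaceMapComplex _).obj (freePresheaf U)).d 1 0 ≫
      presheafAugmentation (U _⦋0⦌) = 0 := by
  have h : ∀ k, (freePresheaf U).δ k ≫ presheafAugmentation (U _⦋0⦌) =
      presheafAugmentation (U _⦋1⦌) := fun k => by
    ext V : 2
    exact (AddCommGrpCat.free.map_comp _ _).symm
  have h2 : ((AlgebraicTopology.alternatingFaceMapComplex _).obj (freePresheaf U)).d 1 0 =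
      ∑ k : Fin 2, (-1 : ℤ) ^ (k : ℕ) • (freePresheaf U).δ k :=
    AlgebraicTopology.alternatingFaceMapComplex_obj_d _ _
  refine (congrArg (fun t : (freePresheaf U) _⦋1⦌ ⟶ (freePresheaf U) _⦋0⦌ =>
    t ≫ presheafAugmentation (U _⦋0⦌)) h2).trans ?_
  rw [Fin.sum_univ_two, Preadditive.add_comp, Preadditive.zsmul_comp, Preadditive.zsmul_comp,
    h, h]
  simp

/-- The isomorphism `ℤ[pt] ≅ ℤ`. -/
def freePointIso : AddCommGrpCat.free.{w}.obj PUnit ≅ AddCommGrpCat.of (ULift.{w} ℤ) :=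
  AddEquiv.toAddCommGrpIso ((FreeAbelianGroup.uniqueEquiv PUnit).trans AddEquiv.ulift.symm)

lemma quasiIso_presheafAugmentation (U : SimplicialObject (SetSheaf J))
    (h : ∀ V, (augmentedToPoint (sections U V)).ExtraDegeneracy) :
    QuasiIso ((ChainComplex.toSingle₀Equiv
      ((AlgebraicTopology.alternatingFaceMapComplex _).obj (freePresheaf U)) _).symm
        ⟨presheafAugmentation (U _⦋0⦌), d_presheafAugmentation U⟩) := by
  have hψ : ∀ V, ((AlgebraicTopology.alternatingFaceMapComplex _).obj
      (((SimplicialObject.whiskering _ _).obj ((evaluation Cᵒᵖ _).obj V)).obj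
        (freePresheaf U))).d 1 0 ≫ (presheafAugmentation (U _⦋0⦌)).app V = 0 := fun V => by
    have h1 := (alternatingFaceMapComplexIso ((evaluation _ _).obj V) (freePresheaf U)).hom.comm 1 0
    rw [alternatingFaceMapComplexIso_hom_f, alternatingFaceMapComplexIso_hom_f] at h1
    have h2 := (Category.id_comp _).symm.trans (h1.trans (Category.comp_id _))
    rw [← h2]
    exact congrArg (fun k => k.app V) (d_presheafAugmentation U)
  refine quasiIso_toSingle₀_of_evaluation _ _ _
    (fun V => alternatingFaceMapComplexIso ((evaluation _ _).obj V) (freePresheaf U))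
    (fun V => (presheafAugmentation (U _⦋0⦌)).app V) hψ (fun V => ?_) (fun V => ?_)
  · rw [alternatingFaceMapComplexIso_hom_f]
    exact Category.id_comp _
  · let ed := (h V).map AddCommGrpCat.free
    exact ed.homotopyEquiv.quasiIso_hom

/-- If the augmented simplicial sets `U(V) ⟶ pt` have extra degeneracies, not necessarily natural
in `V`, then `ℤ[U]~` is a resolution of `ℤ`. -/
lemma quasiIso_augComplex (U : SimplicialObject (SetSheaf J))
    (h : ∀ V, (augmentedToPoint (sections U V)).ExtraDegeneracy) : QuasiIso (augComplex U) := by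
  refine quasiIso_extendToSingle _ _ _ (quasiIso_toSingle₀_map
    (presheafToSheaf J AddCommGrpCat.{max u v}) (quasiIso_presheafAugmentation U h)
    (alternatingFaceMapComplexIso (presheafToSheaf J AddCommGrpCat.{max u v}) (freePresheaf U))
    ((presheafToSheaf J AddCommGrpCat.{max u v}).mapIso
      ((Functor.const Cᵒᵖ).mapIso freePointIso)) _ _ ?_)
  rw [alternatingFaceMapComplexIso_hom_f]
  refine (Category.id_comp _).trans (free_hom_ext fun V x => ?_)
  refine Eq.trans ?_ (augmentation_unit (U _⦋0⦌) V x).symm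
  let η := presheafAugmentation (U _⦋0⦌) ≫ (Functor.const Cᵒᵖ).map freePointIso.hom
  have hη : (presheafToSheaf J AddCommGrpCat.{max u v}).map (presheafAugmentation (U _⦋0⦌)) ≫
      (presheafToSheaf J AddCommGrpCat.{max u v}).map ((Functor.const Cᵒᵖ).map freePointIso.hom) =
      (presheafToSheaf J _).map η := (Functor.map_comp _ _ _).symm
  have hu : ((freeAdj J).unit.app (U _⦋0⦌)).hom.app V x =
      (toSheafify J ((U _⦋0⦌).obj ⋙ AddCommGrpCat.free)).app V (FreeAbelianGroup.of x) := by
    rfl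
  refine (congrArg (fun k => k.hom.app V (((freeAdj J).unit.app (U _⦋0⦌)).hom.app V x)) hη).trans ?_
  rw [hu]
  -- both augmentations are determined by their value `1` on the generators
  have h1 := congrArg (fun k => (k.app V) (FreeAbelianGroup.of x)) (toSheafify_naturality J η)
  refine h1.symm.trans ?_
  have h2 : η.app V (FreeAbelianGroup.of x) = ULift.up 1 := by
    rfl
  exact congrArg (fun t => (toSheafify J ((Functor.const Cᵒᵖ).obj
    (AddCommGrpCat.of (ULift.{max u v} ℤ)))).app V t) h2

end Augmentation

section UniversalAugmentation
variable {C : Type u} [Category.{v} C] {J : GrothendieckTopology C} (G : GrpSheaf J)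

lemma cons_comp_succAbove {T : Type*} {n : ℕ} (a : T) (x : Fin (n + 1) → T) (i : Fin (n + 1)) :
    Fin.cons (α := fun _ => T) a x ∘ i.succ.succAbove =
      Fin.cons (α := fun _ => T) a (x ∘ i.succAbove) := by
  funext j
  cases j using Fin.cases with
  | zero => simp
  | succ j => simp

lemma cons_comp_predAbove {T : Type*} {n : ℕ} (a : T) (x : Fin (n + 1) → T) (i : Fin (n + 1)) :
    Fin.cons (α := fun _ => T) a x ∘ i.succ.predAbove =
      Fin.cons (α := fun _ => T) a (x ∘ i.predAbove) := by
  funext j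
  cases j using Fin.cases with
  | zero => simp
  | succ j => simp

/-- The extra degeneracy of `E_• G` which adds `1` as a vertex. -/
def universalExtraDegeneracy (V : (ClassifyingSite G)ᵒᵖ) :
    (augmentedToPoint (sections (universalTotal G) V)).ExtraDegeneracy where
  s' := TypeCat.ofHom fun _ _ => (1 : G.obj.obj (op V.unop.base))
  s n := TypeCat.ofHom fun x => Fin.cons (α := fun _ => (universalTorsor G).obj.obj V)
    (1 : G.obj.obj (op V.unop.base)) x
  s₀_comp_δ₁ := by
    ext x
    funext i
    fin_cases i
    rfl
  s_comp_δ₀ n := by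
    ext x
    rfl
  s_comp_δ n i := by
    ext x
    exact cons_comp_succAbove (T := G.obj.obj (op V.unop.base)) _ x i
  s_comp_σ n i := by
    ext x
    exact cons_comp_predAbove (T := G.obj.obj (op V.unop.base)) _ x i

/-- The augmentation of `E_• G` induces a bijection `Hⁿ(B_G, M) → ℍⁿ(E_• G, M)`. -/
theorem fromCohomology_universalTotal_bijective [HasDerivedCategory.{w} (BAb G)]
    [HasExt.{w'} (BAb G)] (M : BAb G) (n : ℕ) :
    Function.Bijective (fromCohomology (universalTotal G) : Sheaf.H M n → _) := by
  have hq : QuasiIso (augComplex (universalTotal G)) :=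
    quasiIso_augComplex _ (universalExtraDegeneracy G)
  let e : DerivedCategory.Q.obj (freeComplex (universalTotal G)) ≅
      (DerivedCategory.singleFunctor (BAb G) 0).obj (constZ (classifyingTopology G)) :=
    asIso (DerivedCategory.Q.map (augComplex (universalTotal G))) ≪≫
      (DerivedCategory.singleFunctorIsoCompQ (BAb G) 0).symm.app (constZ _)
  let e' := ((DerivedCategory.singleFunctors (BAb G)).shiftIso (n : ℤ) (-(n : ℤ)) 0
      (add_neg_cancel _)).app M
  have h : (fromCohomology (universalTotal G) : Sheaf.H M n → _) =
      (Iso.homCongr e.symm e') ∘ Abelian.Ext.homEquiv := by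
    ext c
    exact (Category.assoc _ _ _).symm
  rw [h]
  exact (Equiv.bijective _).comp (Equiv.bijective _)

end UniversalAugmentation

/-! ### `EG` is a hypercover -/

section Hypercover
variable {C : Type u} [Category.{v} C] {J : GrothendieckTopology C} (G : GrpSheaf J)

open Classical in
/-- A map from a subcomplex of `Δ[n]` to the sections of `E_• G` is determined by its values at the
vertices, which are arbitrary; so it extends to `Δ[n]`. -/
lemma exists_extension_universalTotal (V : (ClassifyingSite G)ᵒᵖ) (n : ℕ)
    (K : (SSet.stdSimplex.{max u v}.obj ⦋n⦌).Subcomplex)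
    (σ : (K : SSet.{max u v}) ⟶ sections (universalTotal G) V) :
    ∃ τ : SSet.stdSimplex.{max u v}.obj ⦋n⦌ ⟶ sections (universalTotal G) V, K.ι ≫ τ = σ := by
  let T := (universalTorsor G).obj.obj V
  let f : ∀ m : SimplexCategoryᵒᵖ, K.obj m → Fin (m.unop.len + 1) → T := fun m x => σ.app m x
  have hf : ∀ (m m' : SimplexCategoryᵒᵖ) (r : m ⟶ m') (x : K.obj m) (i : Fin (m'.unop.len + 1)),
      f m' ⟨(SSet.stdSimplex.obj ⦋n⦌).map r x.1, K.map r x.2⟩ i =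
        f m x (r.unop.toOrderHom i) := fun m m' r x i =>
    congrArg (fun t : Fin (m'.unop.len + 1) → T => t i) (congrArg (fun k => k x) (σ.naturality r))
  let y : Fin (n + 1) → T := fun j =>
    if h : ∃ x : K.obj (op ⦋0⦌), SSet.stdSimplex.objEquiv x.1 = SimplexCategory.const _ _ j
    then f (op ⦋0⦌) h.choose 0 else (1 : G.obj.obj (op V.unop.base))
  -- the values at the vertices which are not in `K` are arbitrary
  refine ⟨{
    app := fun m => TypeCat.ofHom fun x i => y ((SSet.stdSimplex.objEquiv x).toOrderHom i) }, ?_⟩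
  ext m x
  funext i
  let x' : K.obj (op ⦋0⦌) := ⟨_, K.map (SimplexCategory.const ⦋0⦌ m.unop i).op x.2⟩
  have hx' : SSet.stdSimplex.objEquiv x'.1 =
      SimplexCategory.const _ _ ((SSet.stdSimplex.objEquiv x.1).toOrderHom i) := by
    ext j
    rfl
  have h : ∃ x' : K.obj (op ⦋0⦌), SSet.stdSimplex.objEquiv x'.1 =
      SimplexCategory.const _ _ ((SSet.stdSimplex.objEquiv x.1).toOrderHom i) := ⟨x', hx'⟩
  refine Eq.trans (b := y ((SSet.stdSimplex.objEquiv x.1).toOrderHom i)) rfl ?_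
  refine (dif_pos h).trans ?_
  have h2 : h.choose = x' :=
    Subtype.ext (SSet.stdSimplex.objEquiv.injective (h.choose_spec.trans hx'.symm))
  rw [h2]
  exact hf m (op ⦋0⦌) (SimplexCategory.const ⦋0⦌ m.unop i).op x 0

lemma isHypercover_universalTotal : IsHypercover (universalTotal G) := by
  intro n V σ
  refine ⟨⊤, (classifyingTopology G).top_mem V, fun W f _ => ?_⟩
  exact exists_extension_universalTotal G (op W) n (SSet.boundary n) (σ ≫ sectionsMap _ f.op)

end Hypercover

/-! ### Classes of cocycles -/

section Single
variable {A : Type*} [Category* A] [Abelian A]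

lemma extendToSingle_f (K : ChainComplex A ℕ) {M : A} {n : ℕ} (φ : K.X n ⟶ M)
    (hφ : K.d (n + 1) n ≫ φ = 0) (h : ComplexShape.embeddingDownNat.f n = -(n : ℤ)) :
    (extendToSingle K φ hφ).f (-(n : ℤ)) =
      (K.extendXIso ComplexShape.embeddingDownNat h).hom ≫ φ ≫
        (HomologicalComplex.singleObjXSelf (ComplexShape.up ℤ) (-(n : ℤ)) M).inv := by
  rw [extendToSingle, HomologicalComplex.mkHomToSingle_f]
  exact Category.assoc _ _ _

lemma extendMap_extendToSingle {K L : ChainComplex A ℕ} (f : K ⟶ L) {M : A} {n : ℕ}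
    (φ : L.X n ⟶ M) (hφ : L.d (n + 1) n ≫ φ = 0) (ψ : K.X n ⟶ M)
    (hψ : K.d (n + 1) n ≫ ψ = 0) (h : f.f n ≫ φ = ψ) :
    HomologicalComplex.extendMap f ComplexShape.embeddingDownNat ≫ extendToSingle L φ hφ =
      extendToSingle K ψ hψ := by
  have h0 : ComplexShape.embeddingDownNat.f n = -(n : ℤ) := rfl
  apply HomologicalComplex.to_single_hom_ext
  rw [HomologicalComplex.comp_f, extendToSingle_f _ _ _ h0, extendToSingle_f _ _ _ h0,
    HomologicalComplex.extendMap_f _ ComplexShape.embeddingDownNat h0, ← h]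
  simp

open CochainComplex.HomComplex in
/-- Two maps to `M[n]` which differ by a coboundary are homotopic. -/
lemma nonempty_homotopy_to_single {K : CochainComplex A ℤ} {M : A} {p q : ℤ} (hpq : p + 1 = q)
    (f g : K ⟶ (HomologicalComplex.single A (ComplexShape.up ℤ) p).obj M) (ψ : K.X q ⟶ M)
    (h : f.f p ≫ (HomologicalComplex.singleObjXSelf (ComplexShape.up ℤ) p M).hom =
      K.d p q ≫ ψ + g.f p ≫ (HomologicalComplex.singleObjXSelf (ComplexShape.up ℤ) p M).hom) :
    Nonempty (Homotopy f g) := by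
  let f' : K ⟶ (CochainComplex.singleFunctor A p).obj M := f
  let g' : K ⟶ (CochainComplex.singleFunctor A p).obj M := g
  refine ⟨(Cochain.equivHomotopy f' g').symm
    ⟨Cochain.toSingleMk ψ (show q + -1 = p by lia), ?_⟩⟩
  rw [Cochain.δ_toSingleMk _ _ _ p (by lia)]
  apply (Cochain.toSingleEquiv (add_zero p)).injective
  have hv : ∀ k : K ⟶ (CochainComplex.singleFunctor A p).obj M,
      Cochain.toSingleEquiv (add_zero p) (Cochain.ofHom k) =
        k.f p ≫ (HomologicalComplex.singleObjXSelf (ComplexShape.up ℤ) p M).hom := fun k =>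
    congrArg (· ≫ _) (Cochain.ofHom_v k p)
  rw [map_add, Int.negOnePow_zero, one_smul, Cochain.toSingleEquiv_toSingleMk, hv, hv]
  exact h

/-- Cocycles which differ by a coboundary define the same map to `M[n + 1]` in the derived
category. -/
lemma extendToSingle_Q_eq [HasDerivedCategory.{w} A] {K : ChainComplex A ℕ} {M : A} {n : ℕ}
    {φ φ' : K.X (n + 1) ⟶ M} (hφ : K.d (n + 2) (n + 1) ≫ φ = 0)
    (hφ' : K.d (n + 2) (n + 1) ≫ φ' = 0) (ψ : K.X n ⟶ M)
    (h : φ = K.d (n + 1) n ≫ ψ + φ') :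
    DerivedCategory.Q.map (extendToSingle K φ hφ) =
      DerivedCategory.Q.map (extendToSingle K φ' hφ') := by
  have h0 : ComplexShape.embeddingDownNat.f n = -(n : ℤ) := rfl
  have h1 : ComplexShape.embeddingDownNat.f (n + 1) = -((n + 1 : ℕ) : ℤ) := rfl
  obtain ⟨H⟩ := nonempty_homotopy_to_single (q := -(n : ℤ)) (by push_cast; ring)
    (extendToSingle K φ hφ) (extendToSingle K φ' hφ')
    ((K.extendXIso ComplexShape.embeddingDownNat h0).hom ≫ ψ) (by
      rw [extendToSingle_f _ _ _ h1, extendToSingle_f _ _ _ h1, K.extend_d_eq _ h1 h0, h]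
      simp only [Category.assoc, Iso.inv_hom_id, Iso.inv_hom_id_assoc, Category.comp_id,
        Preadditive.comp_add])
  exact DerivedCategory.Q_map_eq_of_homotopy A H

end Single

section Cocycles
variable {C : Type u} [Category.{v} C] {J : GrothendieckTopology C}

/-- The pullback of a cocycle along a map of simplicial sheaves. -/
def Cocycle.comp {X Y : SimplicialObject (SetSheaf J)} (f : X ⟶ Y) {M : AbSheaf J} {n : ℕ}
    (z : Cocycle Y M n) : Cocycle X M n where
  toHom := f.app (op ⦋n⦌) ≫ z.toHom
  closed V x := by
    refine Eq.trans (Finset.sum_congr rfl fun k _ => ?_)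
      (z.closed V ((f.app (op ⦋n + 1⦌)).hom.app V x))
    refine congrArg (fun t => (-1 : ℤ) ^ (k : ℕ) • valAb z.toHom V t) ?_
    exact congrArg (fun l => l.hom.app V x) (f.naturality (SimplexCategory.δ k).op)

lemma freeComplexMap_toComplex {X Y : SimplicialObject (SetSheaf J)} (f : X ⟶ Y) {M : AbSheaf J}
    {n : ℕ} (z : Cocycle Y M n) (z' : Cocycle X M n)
    (h : f.app (op ⦋n⦌) ≫ z.toHom = z'.toHom) :
    freeComplexMap f ≫ z.toComplex = z'.toComplex := by
  refine extendMap_extendToSingle _ _ _ _ _ ?_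
  apply free_hom_ext
  intro V x
  refine (congrArg (fun t => z.lin.hom.app V t) (free_map_unit (f.app (op ⦋n⦌)) V x)).trans ?_
  refine (free_lift_unit z.toHom V _).trans (Eq.trans ?_ (free_lift_unit z'.toHom V x).symm)
  exact congrArg (fun t => t.hom.app V x) h

/-- The class of the pullback of a cocycle is the pullback of its class. -/
lemma pullback_cls [HasDerivedCategory.{w} (AbSheaf J)] {X Y : SimplicialObject (SetSheaf J)}
    (f : X ⟶ Y) {M : AbSheaf J} {n : ℕ} (z : Cocycle Y M n) (z' : Cocycle X M n)
    (h : f.app (op ⦋n⦌) ≫ z.toHom = z'.toHom) : HH.pullback f z.cls = z'.cls := by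
  refine (Category.assoc _ _ _).symm.trans (congrArg (· ≫ _) ?_)
  exact (Functor.map_comp _ _ _).symm.trans (congrArg _ (freeComplexMap_toComplex f z z' h))

lemma freeComplexMap_augComplex {X Y : SimplicialObject (SetSheaf J)} (f : X ⟶ Y) :
    freeComplexMap f ≫ augComplex Y = augComplex X :=
  extendMap_extendToSingle _ _ _ _ _ (map_augmentation _)

lemma pullback_fromCohomology [HasDerivedCategory.{w} (AbSheaf J)] [HasExt.{w'} (AbSheaf J)]
    {X Y : SimplicialObject (SetSheaf J)} (f : X ⟶ Y) {M : AbSheaf J} {n : ℕ} (c : Sheaf.H M n) :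
    HH.pullback f (fromCohomology Y c) = fromCohomology X c := by
  refine (Category.assoc _ _ _).symm.trans (congrArg (· ≫ _) ?_)
  exact (Functor.map_comp _ _ _).symm.trans (congrArg _ (freeComplexMap_augComplex f))

/-- Cohomologous cocycles have the same class. -/
lemma cls_eq_of_coboundary [HasDerivedCategory.{w} (AbSheaf J)] {X : SimplicialObject (SetSheaf J)}
    {M : AbSheaf J} {n : ℕ} (z z' : Cocycle X M (n + 1)) (t : X _⦋n⦌ ⟶ (forgetAb J).obj M)
    (h : ∀ (V : Cᵒᵖ) (x : (X _⦋n + 1⦌).obj.obj V), valAb z.toHom V x =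
      ∑ k : Fin (n + 2), (-1 : ℤ) ^ (k : ℕ) • valAb t V ((X.δ k).hom.app V x) +
        valAb z'.toHom V x) : z.cls = z'.cls := by
  refine congrArg (· ≫ _) (extendToSingle_Q_eq z.d_lin z'.d_lin
    (((freeAdj J).homEquiv _ _).symm t) ?_)
  refine Eq.trans ?_ (congrArg (· + z'.lin) (freeChain_d_comp X n _)).symm
  apply free_hom_ext
  intro V x
  refine (free_lift_unit z.toHom V x).trans ((h V x).trans ?_)
  refine Eq.trans ?_ (congrArg₂ (· + ·) (sum_hom_app _ _ V _).symm rfl)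
  refine congrArg₂ (· + ·) (Finset.sum_congr rfl fun k _ => ?_) (free_lift_unit z'.toHom V x).symm
  refine Eq.trans ?_ (zsmul_hom_app _ _ V _).symm
  congr 1
  refine (free_lift_unit t V _).symm.trans ?_
  exact (congrArg (fun y => (((freeAdj J).homEquiv _ _).symm t).hom.app V y)
    (free_map_unit (X.δ k) V x)).symm

end Cocycles

/-! ### The class of a central extension, computed on `EG` -/

section Lifting
variable {C : Type u} [Category.{v} C] {J : GrothendieckTopology C} {G : GrpSheaf J}

/-- The map to `E_• G` given by a trivialization of the universal torsor over `U_0`: a simplex is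
sent to the values of the trivialization at its vertices. -/
def vertexMap {U : SimplicialObject (BTopos G)} (s : U _⦋0⦌ ⟶ universalTorsor G) :
    U ⟶ universalTotal G where
  app n :=
    ⟨{ app := fun V => TypeCat.ofHom fun x i => s.hom.app V
        ((U.map (SimplexCategory.const ⦋0⦌ n.unop i).op).hom.app V x)
       naturality := fun V W φ => by
        ext x
        funext i
        exact congrArg (fun k => k x)
          ((U.map (SimplexCategory.const ⦋0⦌ n.unop i).op ≫ s).hom.naturality φ) }⟩
  naturality n m r := by
    ext V x
    funext i
    exact congrArg (fun k => s.hom.app V (k.hom.app V x))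
      (U.map_comp r (SimplexCategory.const ⦋0⦌ m.unop i).op).symm

lemma vertexMap_zero {U : SimplicialObject (BTopos G)} (s : U _⦋0⦌ ⟶ universalTorsor G)
    (V : (ClassifyingSite G)ᵒᵖ) (x : (U _⦋0⦌).obj.obj V) :
    ((vertexMap s).app (op ⦋0⦌)).hom.app V x 0 = s.hom.app V x := by
  have h : (SimplexCategory.const ⦋0⦌ ⦋0⦌ 0).op = 𝟙 (op ⦋0⦌) :=
    Quiver.Hom.unop_inj (by ext i; fin_cases i; rfl)
  refine congrArg (fun k : op ⦋0⦌ ⟶ op ⦋0⦌ => s.hom.app V ((U.map k).hom.app V x)) h |>.trans ?_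
  rw [U.map_id]
  rfl

/-- If the lifts `e_k` of a transition function are changed into `t_k e_k` by elements of the
central subgroup `P`, the resulting cocycle changes by the coboundary of `t`. -/
lemma lifting_identity {P H : Type*} [AddCommGroup P] [Group H] (ι : Multiplicative P →* H)
    (hι : Function.Injective ι) (hc : ∀ m e, ι m * e = e * ι m) {z z' t₀ t₁ t₂ : P}
    {e₀ e₁ e₂ : H} (h' : ι (.ofAdd z') * e₁ = e₂ * e₀)
    (h : ι (.ofAdd z) * (ι (.ofAdd t₁) * e₁) = (ι (.ofAdd t₂) * e₂) * (ι (.ofAdd t₀) * e₀)) :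
    z = ∑ k : Fin 3, (-1 : ℤ) ^ (k : ℕ) • ![t₀, t₁, t₂] k + z' := by
  have h1 : ι (.ofAdd (z + t₁)) * e₁ = ι (.ofAdd (t₂ + t₀ + z')) * e₁ := by
    rw [ofAdd_add, ofAdd_add, ofAdd_add, map_mul, map_mul, map_mul, mul_assoc, h, mul_assoc,
      mul_assoc, mul_assoc, h', ← mul_assoc e₂, ← hc (.ofAdd t₀) e₂, mul_assoc]
  have h2 : z + t₁ = t₂ + t₀ + z' := hι (mul_right_cancel h1)
  rw [eq_sub_of_add_eq h2, Fin.sum_univ_three]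
  simp
  abel

variable {M : AbSheaf J} {X : CentralExtension M G}

/-- Two lifts of the same transition function differ by a section of `M`. -/
lemma LiftingDatum.exists_difference (D D' : LiftingDatum X) (f : D.U ⟶ D'.U)
    (hf : f.app (op ⦋0⦌) ≫ D'.s = D.s) :
    ∃ t : D.U _⦋1⦌ ⟶ (forgetAb _).obj ((trivAb G).obj M),
      ∀ (V : (ClassifyingSite G)ᵒᵖ) (x : (D.U _⦋1⦌).obj.obj V), valGrp D.e V x =
        X.incl _ (Multiplicative.ofAdd (valTriv t V x)) *
          valGrp D'.e V ((f.app (op ⦋1⦌)).hom.app V x) := by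
  have key : ∀ (V : (ClassifyingSite G)ᵒᵖ) (x : (D.U _⦋1⦌).obj.obj V),
      ∃ m : M.obj.obj (op V.unop.base), X.incl _ (Multiplicative.ofAdd m) =
        valGrp D.e V x * (valGrp D'.e V ((f.app (op ⦋1⦌)).hom.app V x))⁻¹ := by
    intro V x
    have hs : ∀ k : Fin 2, D'.s.hom.app V ((D'.U.δ k).hom.app V ((f.app (op ⦋1⦌)).hom.app V x)) =
        D.s.hom.app V ((D.U.δ k).hom.app V x) := fun k => by
      rw [← hf]
      exact congrArg (fun l => D'.s.hom.app V (l.hom.app V x))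
        (f.naturality (SimplexCategory.δ k).op).symm
    have h1 := D.lifts V x
    have h2 := D'.lifts V ((f.app (op ⦋1⦌)).hom.app V x)
    rw [hs, hs, h1] at h2
    have h3 := mul_left_cancel h2
    obtain ⟨m, hm⟩ := (X.exact (op V.unop.base)
      (valGrp D.e V x * (valGrp D'.e V ((f.app (op ⦋1⦌)).hom.app V x))⁻¹)).1 (by
        refine (map_mul (X.proj.hom.app (op V.unop.base)).hom _ _).trans ?_
        refine (congrArg₂ (· * ·) h3 (map_inv (X.proj.hom.app (op V.unop.base)).hom _)).trans ?_
        exact mul_inv_cancel _)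
    exact ⟨m.toAdd, hm⟩
  choose t ht using key
  refine ⟨⟨{ app := fun V => TypeCat.ofHom (t V), naturality := fun V W φ => ?_ }⟩,
    fun V x => ?_⟩
  · ext x
    refine Multiplicative.ofAdd.injective (X.incl_injective (op W.unop.base) ?_)
    refine (ht W _).trans (Eq.trans ?_ (X.incl_restrict φ.unop.f.op (t V x)))
    rw [ht V x]
    refine Eq.trans ?_ (map_mul (X.E.obj.map φ.unop.f.op).hom _ _).symm
    refine congrArg₂ (· * ·) ?_ ?_
    · exact congrArg (fun k => k x) (D.e.hom.naturality φ)
    · refine Eq.trans ?_ (map_inv (X.E.obj.map φ.unop.f.op).hom _).symm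
      exact congrArg (·⁻¹) (congrArg (fun k => k x) ((f.app (op ⦋1⦌) ≫ D'.e).hom.naturality φ))
  · exact (inv_mul_cancel_right _ _).symm.trans (congrArg (· * _) (ht V x).symm)

/-- The classes of the cocycles of two lifting data are compatible with the maps of hypercovers
that are compatible with the trivializations. -/
lemma LiftingDatum.pullback_cls [HasDerivedCategory.{w} (BAb G)] (D D' : LiftingDatum X)
    (f : D.U ⟶ D'.U) (hf : f.app (op ⦋0⦌) ≫ D'.s = D.s) :
    HH.pullback f D'.cocycle.cls = D.cocycle.cls := by
  obtain ⟨t, ht⟩ := D.exists_difference D' f hf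
  refine (HeisenbergCup.pullback_cls f D'.cocycle (D'.cocycle.comp f) rfl).trans
    (cls_eq_of_coboundary _ _ t fun V x => ?_).symm
  have hn : ∀ k : Fin 3, (f.app (op ⦋1⦌)).hom.app V ((D.U.δ k).hom.app V x) =
      (D'.U.δ k).hom.app V ((f.app (op ⦋2⦌)).hom.app V x) := fun k =>
    congrArg (fun l => l.hom.app V x) (f.naturality (SimplexCategory.δ k).op)
  have h := D.coboundary V x
  have h' := D'.coboundary V ((f.app (op ⦋2⦌)).hom.app V x)
  rw [ht, ht, ht, hn, hn, hn] at h
  refine (lifting_identity (X.incl _) (X.incl_injective _) (X.incl_central _) h' h).trans ?_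
  refine congrArg₂ (· + ·) (Finset.sum_congr rfl fun k _ => ?_) rfl
  fin_cases k <;> rfl

/-- The tautological trivialization of the universal torsor over `E_0 G`. -/
def tautologicalSection (G : GrpSheaf J) : (universalTotal G) _⦋0⦌ ⟶ universalTorsor G :=
  ⟨{ app := fun V => TypeCat.ofHom fun x => x 0 }⟩

/-- The class of a central extension may be computed on `E_• G`, as every hypercover which
trivializes the universal torsor maps to it, compatibly with the trivializations. The lifting datum
on `E_• G` is the pullback of a datum `D` along `i`. -/
lemma isExtensionClass_iff [HasDerivedCategory.{w} (BAb G)] [HasExt.{w'} (BAb G)]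
    (D : LiftingDatum X) (i : universalTotal G ⟶ D.U)
    (hi : i.app (op ⦋0⦌) ≫ D.s = tautologicalSection G)
    (z : Cocycle (universalTotal G) ((trivAb G).obj M) 2)
    (hz : i.app (op ⦋2⦌) ≫ D.z = z.toHom) (c : Sheaf.H ((trivAb G).obj M) 2) :
    IsExtensionClass X c ↔ fromCohomology (universalTotal G) c = z.cls := by
  have hc := HeisenbergCup.pullback_cls i D.cocycle z hz
  constructor
  · intro h
    rw [← hc, ← h D, pullback_fromCohomology]
  · intro h D'
    have hs : (vertexMap D'.s ≫ i).app (op ⦋0⦌) ≫ D.s = D'.s := by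
      refine (congrArg (fun k : (universalTotal G) _⦋0⦌ ⟶ universalTorsor G =>
        (vertexMap D'.s).app (op ⦋0⦌) ≫ k) hi).trans ?_
      ext V x
      exact vertexMap_zero D'.s V x
    have h1 := D'.pullback_cls D (vertexMap D'.s ≫ i) hs
    have h2 := pullback_fromCohomology (vertexMap D'.s) c
    rw [h] at h2
    rw [← h1, ← h2]
    refine (HeisenbergCup.pullback_cls (vertexMap D'.s) z (z.comp (vertexMap D'.s)) rfl).trans
      (HeisenbergCup.pullback_cls _ D.cocycle _ ?_).symm
    exact congrArg ((vertexMap D'.s).app (op ⦋2⦌) ≫ ·) hz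

end Lifting

/-! ### The class of the Heisenberg extension on `E(A × B)` -/

section Heisenberg
variable {C : Type u} [Category.{v} C] {J : GrothendieckTopology C} (A B : AbSheaf J)

/-- The `2`-cocycle `(a, b, a', b') ↦ a ⊗ b'` of `B(A × B)`. -/
def cupValue : (classifying (prodGrp A B)) _⦋2⦌ ⟶ (forgetAb J).obj (tensor A B) :=
  ⟨{ app := fun V => TypeCat.ofHom fun x => tmul A B V (x.g 0 1).toAdd.1 (x.g 1 2).toAdd.2
     naturality := fun V W f => by
      ext x
      exact (tmul_restrict A B f _ _).symm }⟩

/-- The section `(a, b) ↦ (a, b, 0)` of the Heisenberg extension (a map of sheaves of sets). -/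
def heisenbergSection :
    (classifying (prodGrp A B)) _⦋1⦌ ⟶ forgetGrp.obj (heisenbergExtension A B).E :=
  ⟨{ app := fun V => TypeCat.ofHom fun x =>
      (⟨(x.g 0 1).toAdd.1, (x.g 0 1).toAdd.2, 0⟩ : HeisenbergGroup (tmul A B V))
     naturality := fun V W f => by
      ext x
      exact HeisenbergGroup.ext rfl rfl (map_zero ((tensor A B).obj.map f).hom).symm }⟩

/-- The lifting datum on `E_•(A × B)` given by the section `(a, b) ↦ (a, b, 0)`. -/
def heisenbergDatum : LiftingDatum (heisenbergExtension A B) where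
  U := universalTotal (prodGrp A B)
  hypercover := isHypercover_universalTotal _
  s := tautologicalSection _
  e := (universalProj _).app (op ⦋1⦌) ≫ (trivSet _).map (heisenbergSection A B)
  z := (universalProj _).app (op ⦋2⦌) ≫ (trivSet _).map (cupValue A B)
  lifts V x := (mul_inv_cancel_left (torsorVal (x 0)) (torsorVal (x 1))).symm
  coboundary V x := by
    let y : BarSimplex (Fin 3) ((prodGrp A B).obj.obj (op V.unop.base)) :=
      ((universalProj (prodGrp A B)).app (op ⦋2⦌)).hom.app V x
    have h := congrArg Multiplicative.toAdd (y.mul_eq 0 1 2)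
    refine HeisenbergGroup.ext ?_ ?_ ?_
    · exact (zero_add _).trans (congrArg Prod.fst h).symm
    · exact (zero_add _).trans (congrArg Prod.snd h).symm
    · change tmul A B _ (y.g 0 1).toAdd.1 (y.g 1 2).toAdd.2 + 0 +
        tmul A B _ 0 (y.g 0 2).toAdd.2 = 0 + 0 + tmul A B _ (y.g 0 1).toAdd.1 (y.g 1 2).toAdd.2
      simp

/-- The class of the Heisenberg extension is the class of the cocycle `(a, b, a', b') ↦ a ⊗ b'`,
pulled back to `E_•(A × B)`. -/
lemma isExtensionClass_heisenberg_iff [HasDerivedCategory.{w} (BAb (prodGrp A B))]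
    [HasExt.{w'} (BAb (prodGrp A B))]
    (z : Cocycle (universalTotal (prodGrp A B)) ((trivAb (prodGrp A B)).obj (tensor A B)) 2)
    (hz : z.toHom = (universalProj _).app (op ⦋2⦌) ≫ (trivSet _).map (cupValue A B))
    (c : Sheaf.H ((trivAb (prodGrp A B)).obj (tensor A B)) 2) :
    IsExtensionClass (heisenbergExtension A B) c ↔
      fromCohomology (universalTotal (prodGrp A B)) c = z.cls :=
  isExtensionClass_iff (heisenbergDatum A B) (𝟙 _) (Category.id_comp _) z
    ((Category.id_comp _).trans hz.symm) c

end Heisenberg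

/-! ### The inverse image of the class of a cocycle -/

section InverseImage
variable {A B : Type*} [Category* A] [Category* B] [Abelian A] [Abelian B]

/-- A map `L ⟶ F K` followed by the image of the map `K ⟶ M[n]` given by a cocycle `φ` is the map
given by the pullback of the cocycle `F φ`. -/
lemma extendToMap_extendToSingle (F : A ⥤ B) [F.Additive] {K : ChainComplex A ℕ}
    {L : ChainComplex B ℕ} (f : L ⟶ (F.mapHomologicalComplex _).obj K) {n : ℕ} {M : A}
    (φ : K.X n ⟶ M)
    (hφ : K.d (n + 1) n ≫ φ = 0) (ψ : L.X n ⟶ F.obj M) (hψ : L.d (n + 1) n ≫ ψ = 0)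
    (h : f.f n ≫ F.map φ = ψ) :
    extendToMap F f ≫ (F.mapHomologicalComplex _).map (extendToSingle K φ hφ) ≫
      (HomologicalComplex.singleMapHomologicalComplex F (ComplexShape.up ℤ) (-(n : ℤ))).hom.app M =
    extendToSingle L ψ hψ := by
  have h0 : ComplexShape.embeddingDownNat.f n = -(n : ℤ) := rfl
  apply HomologicalComplex.to_single_hom_ext
  rw [HomologicalComplex.comp_f, HomologicalComplex.comp_f, extendToSingle_f _ _ _ h0,
    HomologicalComplex.singleMapHomologicalComplex_hom_app_self, ← h]
  have h1 : (extendToMap F f).f (-(n : ℤ)) = _ := extendToMapX_eq F (fun n => f.f n) h0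
  rw [h1]
  change _ ≫ F.map ((extendToSingle K φ hφ).f (-(n : ℤ))) ≫ _ = _
  rw [extendToSingle_f _ _ _ h0]
  have key : ∀ g : L.X n ⟶ F.obj (K.X n),
      (g ≫ F.map (K.extendXIso ComplexShape.embeddingDownNat h0).inv) ≫
        F.map (K.extendXIso ComplexShape.embeddingDownNat h0).hom ≫ F.map φ ≫
          (HomologicalComplex.singleObjXSelf (ComplexShape.up ℤ) (-(n : ℤ)) (F.obj M)).inv =
      (g ≫ F.map φ) ≫
        (HomologicalComplex.singleObjXSelf (ComplexShape.up ℤ) (-(n : ℤ)) (F.obj M)).inv := by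
    intro g
    rw [Category.assoc, ← Functor.map_comp_assoc, Iso.inv_hom_id,
      CategoryTheory.Functor.map_id, Category.id_comp, Category.assoc]
  simp
  exact key (f.f n)

/-- The two descriptions of `M`, placed in degree `n`, as an object of the derived category. -/
def singleIsoQ [HasDerivedCategory.{w} A] (n : ℤ) (M : A) :
    (DerivedCategory.singleFunctor A n).obj M ≅
      DerivedCategory.Q.obj ((HomologicalComplex.single A (ComplexShape.up ℤ) n).obj M) :=
  (DerivedCategory.singleFunctorIsoCompQ A n).app M

variable [HasDerivedCategory.{w} A]
    [HasDerivedCategory.{w'} B] (F : A ⥤ B) [F.Additive] [Limits.PreservesFiniteLimits F]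
    [Limits.PreservesFiniteColimits F]

lemma mapDerivedCategorySingleFunctor_hom_app (n : ℤ) (M : A) :
    (F.mapDerivedCategorySingleFunctor n).hom.app M =
      F.mapDerivedCategory.map (singleIsoQ n M).hom ≫
        F.mapDerivedCategoryFactors.hom.app
          ((HomologicalComplex.single A (ComplexShape.up ℤ) n).obj M) ≫
        DerivedCategory.Q.map
          ((HomologicalComplex.singleMapHomologicalComplex F (ComplexShape.up ℤ) n).hom.app M) ≫
        (singleIsoQ n (F.obj M)).inv :=
  congrArg (_ ≫ ·) ((Category.id_comp _).trans (congrArg (_ ≫ ·) ((Category.id_comp _).trans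
    (congrArg (_ ≫ ·) (Category.id_comp _)))))

lemma derivedPullback_single {K : CochainComplex A ℤ} {L : CochainComplex B ℤ}
    (φ : L ⟶ (F.mapHomologicalComplex _).obj K) {n : ℤ} {M : A}
    (k : K ⟶ (HomologicalComplex.single A (ComplexShape.up ℤ) n).obj M) :
    derivedPullback F φ (DerivedCategory.Q.map k ≫ (singleIsoQ n M).inv) ≫
      (F.mapDerivedCategorySingleFunctor n).hom.app M =
    DerivedCategory.Q.map (φ ≫ (F.mapHomologicalComplex _).map k ≫
      (HomologicalComplex.singleMapHomologicalComplex F (ComplexShape.up ℤ) n).hom.app M) ≫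
        (singleIsoQ n (F.obj M)).inv := by
  have h1 := derivedPullback_Q F φ k
  rw [derivedPullback_comp, mapDerivedCategorySingleFunctor_hom_app, Category.assoc]
  refine (congrArg (derivedPullback F φ (DerivedCategory.Q.map k) ≫ ·)
    ((Functor.map_comp_assoc _ _ _ _).symm.trans
      (congrArg (· ≫ _) ((congrArg F.mapDerivedCategory.map (singleIsoQ n M).inv_hom_id).trans
        (CategoryTheory.Functor.map_id _ _))))).trans ?_
  refine (congrArg (derivedPullback F φ (DerivedCategory.Q.map k) ≫ ·)
    (Category.id_comp _)).trans ?_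
  refine (Category.assoc _ _ _).symm.trans ((congrArg (· ≫ _) h1).trans ?_)
  refine (Category.assoc _ _ _).symm.trans (congrArg (· ≫ _) ?_)
  exact (Functor.map_comp _ _ _).symm.trans (congrArg _ (Category.assoc _ _ _))

end InverseImage

section
variable {C : Type u} [Category.{v} C] {J : GrothendieckTopology C}

/-- The pullback to `E_• G` of the class of a cocycle of `BG` is the class of its pullback. -/
lemma pullbackToUniversal_cls [HasDerivedCategory.{w} (AbSheaf J)] (G : GrpSheaf J)
    [HasDerivedCategory.{w'} (BAb G)] {M : AbSheaf J} {n : ℕ} (z : Cocycle (classifying G) M n)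
    (z' : Cocycle (universalTotal G) ((trivAb G).obj M) n)
    (h : z'.toHom = (universalProj G).app (op ⦋n⦌) ≫ (trivSet G).map z.toHom) :
    pullbackToUniversal G z.cls = z'.cls := by
  have h1 := derivedPullback_single (trivAb G) (universalComplexMap G) z.toComplex
  have h2 := extendToMap_extendToSingle (trivAb G) (universalChainMap G) z.lin z.d_lin z'.lin
    z'.d_lin (by
      apply free_hom_ext
      intro V x
      refine (congrArg (fun t => z.lin.hom.app (op V.unop.base) t)
        (freeToTriv_unit ((universalProj G).app (op ⦋n⦌)) V x)).trans ?_
      refine (free_lift_unit z.toHom _ _).trans (Eq.trans ?_ (free_lift_unit z'.toHom V x).symm)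
      exact congrArg (fun t => t.hom.app V x) h.symm)
  have h3 : pullbackToUniversal G z.cls = derivedPullback (trivAb G) (universalComplexMap G)
      (DerivedCategory.Q.map z.toComplex ≫ (singleIsoQ (-(n : ℤ)) M).inv) ≫
        ((trivAb G).mapDerivedCategorySingleFunctor (-(n : ℤ))).hom.app M := by
    simp only [pullbackToUniversal, derivedPullback, Category.assoc]
    rfl
  exact h3.trans (h1.trans (congrArg (fun t => DerivedCategory.Q.map t ≫ _) h2))
end

/-! ### Maps to Eilenberg–MacLane sheaves -/

section EilenbergMacLane
open AlgebraicTopology AlgebraicTopology.DoldKan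
variable {C : Type u} [Category.{v} C] {J : GrothendieckTopology C}

/-- Under the Dold–Kan adjunction, `W ⟶ K(M, n)` corresponds to its composite with the fundamental
cocycle, restricted to the normalized complex. -/
lemma app_comp_emVal {W : SimplicialObject (AbSheaf J)} {M : AbSheaf J} {n : ℕ} (g : W ⟶ EM M n) :
    g.app (op ⦋n⦌) ≫ emVal M n = (PInftyToNormalizedMooreComplex W).f n ≫
      ((Abelian.DoldKan.equivalence.toAdjunction.homEquiv W (chainSingle M n)).symm g).f n ≫
        (HomologicalComplex.singleObjXSelf (ComplexShape.down ℕ) n M).hom := by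
  have h1 : g.app (op ⦋n⦌) ≫ (PInftyToNormalizedMooreComplex (EM M n)).f n =
      (PInftyToNormalizedMooreComplex W).f n ≫ (Abelian.DoldKan.N.map g).f n :=
    congrArg (fun k => k.f n) (PInftyToNormalizedMooreComplex_naturality g)
  have h2 : ((Abelian.DoldKan.equivalence.toAdjunction.homEquiv W (chainSingle M n)).symm g) =
      Abelian.DoldKan.N.map g ≫ Abelian.DoldKan.equivalence.counitIso.hom.app (chainSingle M n) :=
    Adjunction.homEquiv_counit _ _ _ _
  rw [h2]
  refine Eq.trans (b := (g.app (op ⦋n⦌) ≫ (PInftyToNormalizedMooreComplex (EM M n)).f n) ≫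
    (Abelian.DoldKan.equivalence.counitIso.hom.app (chainSingle M n)).f n ≫
      (HomologicalComplex.singleObjXSelf (ComplexShape.down ℕ) n M).hom) ?_ ?_
  · rw [emVal, emProj]
    simp only [Category.assoc]
    rfl
  · rw [h1]
    exact (Category.assoc _ _ _).trans (congrArg (_ ≫ ·) (Category.assoc _ _ _).symm)

/-- A homomorphism to `K(M, n)` is determined by the pullback of the fundamental cocycle, since the
normalized complex is a direct summand of the complex of all chains. -/
lemma EM_hom_ext {W : SimplicialObject (AbSheaf J)} {M : AbSheaf J} {n : ℕ} {f g : W ⟶ EM M n}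
    (h : f.app (op ⦋n⦌) ≫ emVal M n = g.app (op ⦋n⦌) ≫ emVal M n) : f = g := by
  apply (Abelian.DoldKan.equivalence.toAdjunction.homEquiv W (chainSingle M n)).symm.injective
  apply HomologicalComplex.to_single_hom_ext
  rw [app_comp_emVal, app_comp_emVal] at h
  have h1 : (inclusionOfMooreComplexMap W).f n ≫ (PInftyToNormalizedMooreComplex W).f n = 𝟙 _ :=
    congrArg (fun k => k.f n) (splitMonoInclusionOfMooreComplexMap W).id
  have h2 := congrArg ((inclusionOfMooreComplexMap W).f n ≫ ·) h
  have h3 : ∀ k : (normalized W).X n ⟶ M, (inclusionOfMooreComplexMap W).f n ≫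
      (PInftyToNormalizedMooreComplex W).f n ≫ k = k := fun k =>
    (Category.assoc _ _ _).symm.trans ((congrArg (· ≫ k) h1).trans (Category.id_comp _))
  have h4 := (h3 _).symm.trans (h2.trans (h3 _))
  exact (cancel_mono (HomologicalComplex.singleObjXSelf (ComplexShape.down ℕ) n M).hom).1 h4

/-- The map to `K(S, n)` given by a normalized cocycle pulls the fundamental cocycle back to it. -/
lemma mapToEM_emVal {W : SimplicialObject (AbSheaf J)} {S : AbSheaf J} {n : ℕ} (φ : W _⦋n⦌ ⟶ S)
    (hφ : ∑ k : Fin (n + 2), (-1 : ℤ) ^ (k : ℕ) • (W.δ k ≫ φ) = 0) (hd : DegeneraciesVanish φ) :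
    (mapToEM W φ hφ).app (op ⦋n⦌) ≫ emVal S n = φ := by
  refine (app_comp_emVal _).trans ?_
  rw [mapToEM, Equiv.symm_apply_apply, HomologicalComplex.mkHomToSingle_f]
  refine (congrArg ((PInftyToNormalizedMooreComplex W).f n ≫ ·)
    ((Category.assoc _ _ _).trans ((congrArg (_ ≫ ·) (Iso.inv_hom_id _)).trans
      (Category.comp_id _)))).trans ?_
  have h1 : (PInftyToNormalizedMooreComplex W).f n ≫ (inclusionOfMooreComplexMap W).f n =
      PInfty.f n := congrArg (fun k => k.f n)
        (PInftyToNormalizedMooreComplex_comp_inclusionOfMooreComplexMap W)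
  refine (Category.assoc _ _ _).symm.trans ((congrArg (· ≫ φ) h1).trans ?_)
  -- the projector onto the degenerate part is killed by `φ`
  have h2 := congrArg (· ≫ φ) (PInfty_f_add_QInfty_f (X := W) n)
  rw [degeneraciesVanish_iff_QInfty_f_comp] at hd
  simpa [Preadditive.add_comp, hd] using h2

/-- The fundamental cocycle vanishes on degenerate simplices. -/
lemma degeneraciesVanish_emVal (M : AbSheaf J) (n : ℕ) :
    DegeneraciesVanish (X := EM M n) (emVal M n) := by
  have h1 : emProj M n = PInfty ≫ emProj M n :=
    (congrArg (· ≫ Abelian.DoldKan.equivalence.counitIso.hom.app (chainSingle M n))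
      (PInfty_comp_PInftyToNormalizedMooreComplex (EM M n))).symm.trans (Category.assoc _ _ _)
  have h : (emProj M n).f n = (PInfty (X := EM M n)).f n ≫ (emProj M n).f n :=
    congrArg (fun k : (AlgebraicTopology.alternatingFaceMapComplex (AbSheaf J)).obj (EM M n) ⟶
      chainSingle M n => k.f n) h1
  rw [emVal, h, Category.assoc]
  exact (degeneraciesVanishPInfty_f (EM M n) n).comp _

end EilenbergMacLane

section MapsToEilenbergMacLane
open AlgebraicTopology.DoldKan
variable {C : Type u} [Category.{v} C] {J : GrothendieckTopology C}

/-- The simplicial abelian sheaf `ℤ[X]`. -/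
abbrev freeSimplicial (X : SimplicialObject (SetSheaf J)) : SimplicialObject (AbSheaf J) :=
  ((SimplicialObject.whiskering _ _).obj (freeAb J)).obj X

lemma homEquiv_app {X : SimplicialObject (SetSheaf J)} {W : SimplicialObject (AbSheaf J)}
    (f : freeSimplicial X ⟶ W) (n : SimplexCategoryᵒᵖ) :
    (((freeAdj J).whiskerRight SimplexCategoryᵒᵖ).homEquiv X W f).app n =
      (freeAdj J).homEquiv _ _ (f.app n) :=
  (congrArg (fun k : X ⟶ underlying.obj W => k.app n) (Adjunction.homEquiv_unit
    ((freeAdj J).whiskerRight SimplexCategoryᵒᵖ) X W f)).trans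
    (Adjunction.homEquiv_unit (freeAdj J) _ _ _).symm

/-- A map to `K(M, n)` is determined by the pullback of the fundamental cocycle. -/
lemma EMSet_hom_ext {X : SimplicialObject (SetSheaf J)} {M : AbSheaf J} {n : ℕ}
    {f g : X ⟶ EMSet M n} (h : f.app (op ⦋n⦌) ≫ (fundamentalCocycle M n).toHom =
      g.app (op ⦋n⦌) ≫ (fundamentalCocycle M n).toHom) : f = g := by
  let e := ((freeAdj J).whiskerRight SimplexCategoryᵒᵖ).homEquiv X (EM M n)
  obtain ⟨f', rfl⟩ := e.surjective f
  obtain ⟨g', rfl⟩ := e.surjective g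
  refine congrArg e (EM_hom_ext (((freeAdj J).homEquiv _ _).injective ?_))
  rw [Adjunction.homEquiv_naturality_right, Adjunction.homEquiv_naturality_right]
  exact (congrArg (· ≫ _) (homEquiv_app f' _)).symm.trans
    (h.trans (congrArg (· ≫ _) (homEquiv_app g' _)))

/-- The map to `K(M, n)` given by a normalized cocycle `z` pulls the fundamental cocycle back to
`z`. -/
lemma toEM_fundamentalCocycle {X : SimplicialObject (SetSheaf J)} {M : AbSheaf J} {n : ℕ}
    (z : Cocycle X M n) (hz : DegeneraciesVanish (X := freeSimplicial X) z.lin) :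
    z.toEM.app (op ⦋n⦌) ≫ (fundamentalCocycle M n).toHom = z.toHom := by
  refine (congrArg (· ≫ _) (homEquiv_app _ _)).trans ?_
  refine ((freeAdj J).homEquiv_naturality_right _ _).symm.trans ?_
  refine (congrArg _ (mapToEM_emVal _ _ hz)).trans ?_
  exact Equiv.apply_symm_apply _ _

/-- A `1`-cocycle vanishes on degenerate edges: on a totally degenerate triangle, the cocycle
condition reads `m - m + m = 0`. -/
lemma Cocycle.degenerate_eq_zero {X : SimplicialObject (SetSheaf J)} {M : AbSheaf J}
    (z : Cocycle X M 1) (V : Cᵒᵖ) (x : (X _⦋0⦌).obj.obj V) :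
    valAb z.toHom V ((X.σ 0).hom.app V x) = 0 := by
  have h := z.closed V ((X.σ 0).hom.app V ((X.σ 0).hom.app V x))
  have h0 : ∀ k : Fin 3, (X.δ k).hom.app V ((X.σ 0).hom.app V ((X.σ 0).hom.app V x)) =
      (X.σ 0).hom.app V x := by
    intro k
    have h1 : X.map (SimplexCategory.σ (0 : Fin 1)).op ≫
        X.map (SimplexCategory.σ (0 : Fin 2)).op ≫ X.map (SimplexCategory.δ k).op =
          X.map (SimplexCategory.σ (0 : Fin 1)).op := by
      rw [← X.map_comp, ← X.map_comp, ← op_comp, ← op_comp]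
      congr 2
      ext i
      exact congrArg Fin.val (Subsingleton.elim (α := Fin 1) _ _)
    exact congrArg (fun t => t.hom.app V x) h1
  rw [Fin.sum_univ_three, h0, h0, h0] at h
  simpa using h

/-- Every `1`-cocycle is normalized. -/
lemma Cocycle.degeneraciesVanish {X : SimplicialObject (SetSheaf J)} {M : AbSheaf J}
    (z : Cocycle X M 1) : DegeneraciesVanish (X := freeSimplicial X) z.lin := by
  intro i
  fin_cases i
  apply free_hom_ext
  intro V x
  refine (congrArg (fun t => z.lin.hom.app V t) (free_map_unit (X.σ 0) V x)).trans ?_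
  exact (free_lift_unit z.toHom V _).trans (z.degenerate_eq_zero V x)

end MapsToEilenbergMacLane

/-! ### Maps to the classifying simplicial sheaf -/

section MapsToClassifying
variable {C : Type u} [Category.{v} C] {J : GrothendieckTopology C} {G : GrpSheaf J}

/-- A simplex of the classifying space is determined by its edges starting at the vertex `0`. -/
lemma BarSimplex.ext_zero {n : ℕ} {H : Type*} [Group H] {x y : BarSimplex (Fin (n + 1)) H}
    (h : ∀ i, x.g 0 i = y.g 0 i) : x = y := by
  refine BarSimplex.ext (funext fun i => funext fun j => ?_)
  rw [← mul_left_cancel_iff (a := x.g 0 i), x.mul_eq, h, h, y.mul_eq]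

/-- The edge from `i` to `j` of a simplex. -/
def edge (X : SimplicialObject (SetSheaf J)) {n : SimplexCategoryᵒᵖ} {V : Cᵒᵖ}
    (x : (X.obj n).obj.obj V) (i j : Fin (n.unop.len + 1)) (h : i ≤ j) : (X _⦋1⦌).obj.obj V :=
  (X.map (SimplexCategory.mkOfLe (n := n.unop.len) i j h).op).hom.app V x

lemma edge_map (X : SimplicialObject (SetSheaf J)) {n m : SimplexCategoryᵒᵖ} (r : n ⟶ m) {V : Cᵒᵖ}
    (x : (X.obj n).obj.obj V) (i j : Fin (m.unop.len + 1)) (h : i ≤ j) :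
    edge X ((X.map r).hom.app V x) i j h =
      edge X x (r.unop.toOrderHom i) (r.unop.toOrderHom j) (r.unop.toOrderHom.monotone h) := by
  have h1 : r ≫ (SimplexCategory.mkOfLe (n := m.unop.len) i j h).op =
      (SimplexCategory.mkOfLe (n := n.unop.len) (r.unop.toOrderHom i) (r.unop.toOrderHom j)
        (r.unop.toOrderHom.monotone h)).op :=
    Quiver.Hom.unop_inj (by ext k; fin_cases k <;> rfl)
  have h2 := X.map_comp r (SimplexCategory.mkOfLe (n := m.unop.len) i j h).op
  rw [h1] at h2
  exact congrArg (fun k => k.hom.app V x) h2.symm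

lemma edge_restrict (X : SimplicialObject (SetSheaf J)) {n : SimplexCategoryᵒᵖ} {V W : Cᵒᵖ}
    (f : V ⟶ W) (x : (X.obj n).obj.obj V) (i j : Fin (n.unop.len + 1)) (h : i ≤ j) :
    edge X ((X.obj n).obj.map f x) i j h = (X _⦋1⦌).obj.map f (edge X x i j h) :=
  congrArg (fun k => k x)
    ((X.map (SimplexCategory.mkOfLe (n := n.unop.len) i j h).op).hom.naturality f)

/-- The value, as an element of the group `G(V)`, of a map `Y ⟶ G` at a section of `Y` over `V`. -/
def groupVal {Y : SetSheaf J} (z : Y ⟶ forgetGrp.obj G) {V : Cᵒᵖ} (x : Y.obj.obj V) : G.obj.obj V :=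
  z.hom.app V x

/-- A `1`-cocycle of `X` with values in `G`: on the edges of a triangle,
`z_{01} z_{12} = z_{02}`. -/
def IsGroupCocycle {X : SimplicialObject (SetSheaf J)} (z : X _⦋1⦌ ⟶ forgetGrp.obj G) : Prop :=
  ∀ (V : Cᵒᵖ) (x : (X _⦋2⦌).obj.obj V), groupVal z ((X.δ 2).hom.app V x) *
    groupVal z ((X.δ 0).hom.app V x) = groupVal z ((X.δ 1).hom.app V x)

lemma IsGroupCocycle.mul_edge {X : SimplicialObject (SetSheaf J)} {z : X _⦋1⦌ ⟶ forgetGrp.obj G}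
    (hz : IsGroupCocycle z) {n : SimplexCategoryᵒᵖ} {V : Cᵒᵖ} (x : (X.obj n).obj.obj V)
    (i j k : Fin (n.unop.len + 1)) (hij : i ≤ j) (hjk : j ≤ k) :
    groupVal z (edge X x i j hij) * groupVal z (edge X x j k hjk) =
      groupVal z (edge X x i k (hij.trans hjk)) := by
  have h := hz V
    ((X.map (SimplexCategory.mkOfLeComp (n := n.unop.len) i j k hij hjk).op).hom.app V x)
  have key : ∀ (l : Fin 3) (p q : Fin (n.unop.len + 1)) (hpq : p ≤ q),
      SimplexCategory.δ l ≫ SimplexCategory.mkOfLeComp (n := n.unop.len) i j k hij hjk =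
        SimplexCategory.mkOfLe (n := n.unop.len) p q hpq →
      (X.δ l).hom.app V ((X.map
        (SimplexCategory.mkOfLeComp (n := n.unop.len) i j k hij hjk).op).hom.app V x) =
          edge X x p q hpq := by
    intro l p q hpq h1
    have h2 := X.map_comp (SimplexCategory.mkOfLeComp (n := n.unop.len) i j k hij hjk).op
      (SimplexCategory.δ l).op
    rw [← op_comp, h1] at h2
    exact congrArg (fun k => k.hom.app V x) h2.symm
  rw [key 2 i j hij (by ext t; fin_cases t <;> rfl), key 0 j k hjk (by ext t; fin_cases t <;> rfl),
    key 1 i k (hij.trans hjk) (by ext t; fin_cases t <;> rfl)] at h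
  exact h

lemma IsGroupCocycle.edge_self {X : SimplicialObject (SetSheaf J)} {z : X _⦋1⦌ ⟶ forgetGrp.obj G}
    (hz : IsGroupCocycle z) {n : SimplexCategoryᵒᵖ} {V : Cᵒᵖ} (x : (X.obj n).obj.obj V)
    (i : Fin (n.unop.len + 1)) : groupVal z (edge X x i i le_rfl) = 1 := by
  simpa using hz.mul_edge x i i i le_rfl le_rfl

lemma edge_zero_one (X : SimplicialObject (SetSheaf J)) {V : Cᵒᵖ} (x : (X _⦋1⦌).obj.obj V) :
    edge X x (0 : Fin 2) (1 : Fin 2) zero_le_one = x := by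
  have h : (SimplexCategory.mkOfLe (n := 1) 0 1 zero_le_one).op = 𝟙 (op ⦋1⦌) :=
    Quiver.Hom.unop_inj (by ext k; fin_cases k <;> rfl)
  refine (congrArg (fun k => (X.map k).hom.app V x) h).trans ?_
  rw [X.map_id]
  rfl

/-- A map to `BG` is determined by the `1`-cocycle with values in `G` which it defines. -/
lemma classifying_hom_ext {X : SimplicialObject (SetSheaf J)} {f g : X ⟶ classifying G}
    (h : ∀ (V : Cᵒᵖ) (x : (X _⦋1⦌).obj.obj V),
      BarSimplex.g ((f.app (op ⦋1⦌)).hom.app V x) 0 1 =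
        BarSimplex.g ((g.app (op ⦋1⦌)).hom.app V x) 0 1) : f = g := by
  have key : ∀ (k : X ⟶ classifying G) (n : SimplexCategoryᵒᵖ) (V : Cᵒᵖ) (x : (X.obj n).obj.obj V)
      (i : Fin (n.unop.len + 1)), BarSimplex.g ((k.app n).hom.app V x) 0 i =
        BarSimplex.g ((k.app (op ⦋1⦌)).hom.app V (edge X x 0 i (Fin.zero_le i))) 0 1 := by
    intro k n V x i
    exact congrArg (fun l => BarSimplex.g (l.hom.app V x) 0 1)
      (k.naturality (SimplexCategory.mkOfLe (n := n.unop.len) 0 i (Fin.zero_le i)).op).symm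
  ext n V x
  refine BarSimplex.ext_zero (n := n.unop.len) fun i => ?_
  exact (key f n V x i).trans ((h V _).trans (key g n V x i).symm)

/-- The map to `BG` given by a `1`-cocycle `z` with values in `G`. It sends a simplex `x` to the
simplex with edges `z(x_{0i})⁻¹ z(x_{0j})`, which is `z(x_{ij})` if `i ≤ j`. -/
def classifyingMap {X : SimplicialObject (SetSheaf J)} (z : X _⦋1⦌ ⟶ forgetGrp.obj G)
    (hz : IsGroupCocycle z) : X ⟶ classifying G where
  app n := ⟨{
    app := fun V => TypeCat.ofHom fun x => BarSimplex.ofVertices fun i =>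
      groupVal z (edge X x 0 i (Fin.zero_le i))
    naturality := fun V W f => by
      ext x
      refine BarSimplex.ext_zero (n := n.unop.len) fun i => ?_
      have h : ∀ j, groupVal z (edge X ((X.obj n).obj.map f x) 0 j (Fin.zero_le j)) =
          (G.obj.map f).hom (groupVal z (edge X x 0 j (Fin.zero_le j))) := fun j => by
        rw [edge_restrict]
        exact congrArg (fun k => k (edge X x 0 j (Fin.zero_le j))) (z.hom.naturality f)
      change (groupVal z (edge X ((X.obj n).obj.map f x) 0 0 _))⁻¹ *
        groupVal z (edge X ((X.obj n).obj.map f x) 0 i _) = (G.obj.map f).hom (_⁻¹ * _)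
      rw [h, h, map_mul, map_inv] }⟩
  naturality n m r := by
    ext V x
    refine BarSimplex.ext_zero (n := m.unop.len) fun i => ?_
    change (groupVal z (edge X ((X.map r).hom.app V x) 0 0 _))⁻¹ *
        groupVal z (edge X ((X.map r).hom.app V x) 0 i _) =
      (groupVal z (edge X x 0 (r.unop.toOrderHom 0) (Fin.zero_le _)))⁻¹ *
        groupVal z (edge X x 0 (r.unop.toOrderHom i) (Fin.zero_le _))
    rw [hz.edge_self, edge_map, inv_one, one_mul,
      ← hz.mul_edge x 0 (r.unop.toOrderHom 0) (r.unop.toOrderHom i) (Fin.zero_le _)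
        (r.unop.toOrderHom.monotone (Fin.zero_le i)), inv_mul_cancel_left]

lemma classifyingMap_edge {X : SimplicialObject (SetSheaf J)} (z : X _⦋1⦌ ⟶ forgetGrp.obj G)
    (hz : IsGroupCocycle z) (V : Cᵒᵖ) (x : (X _⦋1⦌).obj.obj V) :
    BarSimplex.g (((classifyingMap z hz).app (op ⦋1⦌)).hom.app V x) 0 1 = groupVal z x := by
  change (groupVal z (edge X x (0 : Fin 2) (0 : Fin 2) _))⁻¹ *
    groupVal z (edge X x (0 : Fin 2) (1 : Fin 2) _) = _
  rw [edge_zero_one]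
  have := hz.edge_self (n := op ⦋1⦌) x 0
  refine (congrArg (fun t => t⁻¹ * _) this).trans ?_
  rw [inv_one, one_mul]

end MapsToClassifying

/-! ### `B(A × B)` as a product -/

section Product
variable {C : Type u} [Category.{v} C] {J : GrothendieckTopology C} {A B : AbSheaf J}

/-- The pair of two `1`-cocycles, with values in `A` and in `B`. -/
def pairCocycle {X : SimplicialObject (SetSheaf J)} (z : Cocycle X A 1) (z' : Cocycle X B 1) :
    X _⦋1⦌ ⟶ forgetGrp.obj (prodGrp A B) :=
  ⟨{ app := fun V => TypeCat.ofHom fun x =>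
      Multiplicative.ofAdd (valAb z.toHom V x, valAb z'.toHom V x)
     naturality := fun V W f => by
      ext x
      exact congrArg Multiplicative.ofAdd (Prod.ext
        (congrArg (fun k => k x) (z.toHom.hom.naturality f))
        (congrArg (fun k => k x) (z'.toHom.hom.naturality f))) }⟩

lemma Cocycle.add_eq {X : SimplicialObject (SetSheaf J)} (z : Cocycle X A 1) {V : Cᵒᵖ}
    (x : (X _⦋2⦌).obj.obj V) : valAb z.toHom V ((X.δ 2).hom.app V x) +
      valAb z.toHom V ((X.δ 0).hom.app V x) = valAb z.toHom V ((X.δ 1).hom.app V x) := by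
  have h := z.closed V x
  rw [Fin.sum_univ_three] at h
  rw [← sub_eq_zero, ← h]
  simp
  abel

lemma isGroupCocycle_pairCocycle {X : SimplicialObject (SetSheaf J)} (z : Cocycle X A 1)
    (z' : Cocycle X B 1) : IsGroupCocycle (pairCocycle z z') := fun _ x =>
  congrArg Multiplicative.ofAdd (Prod.ext (z.add_eq x) (z'.add_eq x))

variable (A B)

/-- The map `K(A, 1) × K(B, 1) ⟶ B(A × B)` given by the fundamental cocycles. -/
def ofProduct : EMSet A 1 ⨯ EMSet B 1 ⟶ classifying (prodGrp A B) :=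
  classifyingMap _ (isGroupCocycle_pairCocycle
    ((fundamentalCocycle A 1).comp (Limits.prod.fst : EMSet A 1 ⨯ EMSet B 1 ⟶ _))
    ((fundamentalCocycle B 1).comp (Limits.prod.snd : EMSet A 1 ⨯ EMSet B 1 ⟶ _)))

lemma toProduct_ofProduct : toProduct A B ≫ ofProduct A B = 𝟙 _ := by
  apply classifying_hom_ext
  intro V x
  refine (classifyingMap_edge _ (isGroupCocycle_pairCocycle _ _) V
    (((toProduct A B).app (op ⦋1⦌)).hom.app V x)).trans ?_
  have h1 : (toProduct A B).app (op ⦋1⦌) ≫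
      (Limits.prod.fst : EMSet A 1 ⨯ EMSet B 1 ⟶ _).app (op ⦋1⦌) ≫
      (fundamentalCocycle A 1).toHom = (fstCocycle A B).toHom := by
    rw [← NatTrans.comp_app_assoc, toProduct, Limits.prod.lift_fst]
    exact toEM_fundamentalCocycle _ (Cocycle.degeneraciesVanish _)
  have h2 : (toProduct A B).app (op ⦋1⦌) ≫
      (Limits.prod.snd : EMSet A 1 ⨯ EMSet B 1 ⟶ _).app (op ⦋1⦌) ≫
      (fundamentalCocycle B 1).toHom = (sndCocycle A B).toHom := by
    rw [← NatTrans.comp_app_assoc, toProduct, Limits.prod.lift_snd]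
    exact toEM_fundamentalCocycle _ (Cocycle.degeneraciesVanish _)
  exact congrArg Multiplicative.ofAdd (Prod.ext (congrArg (fun k => k.hom.app V x) h1)
    (congrArg (fun k => k.hom.app V x) h2))

lemma ofProduct_toProduct : ofProduct A B ≫ toProduct A B = 𝟙 _ := by
  apply Limits.prod.hom_ext
  · rw [Category.assoc, toProduct, Limits.prod.lift_fst, Category.id_comp]
    apply EMSet_hom_ext
    refine (congrArg ((ofProduct A B).app (op ⦋1⦌) ≫ ·)
      (toEM_fundamentalCocycle _ (Cocycle.degeneraciesVanish _))).trans ?_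
    ext V x
    exact congrArg (fun t : Multiplicative (A.obj.obj V × B.obj.obj V) => t.toAdd.1)
      (classifyingMap_edge _ (isGroupCocycle_pairCocycle _ _) V x)
  · rw [Category.assoc, toProduct, Limits.prod.lift_snd, Category.id_comp]
    apply EMSet_hom_ext
    refine (congrArg ((ofProduct A B).app (op ⦋1⦌) ≫ ·)
      (toEM_fundamentalCocycle _ (Cocycle.degeneraciesVanish _))).trans ?_
    ext V x
    exact congrArg (fun t : Multiplicative (A.obj.obj V × B.obj.obj V) => t.toAdd.2)
      (classifyingMap_edge _ (isGroupCocycle_pairCocycle _ _) V x)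

/-- `B(A × B)` and `K(A, 1) × K(B, 1)` both represent pairs of `1`-cocycles with values in `A`
and in `B`. -/
theorem isIso_toProduct : IsIso (toProduct A B) :=
  ⟨ofProduct A B, toProduct_ofProduct A B, ofProduct_toProduct A B⟩

end Product

/-! ### The cocycle of the cup product -/

section CupValue
open AlgebraicTopology.DoldKan
variable {C : Type u} [Category.{v} C] {J : GrothendieckTopology C} (A B : AbSheaf J)

lemma tensorMap_zero_left {A' B' : AbSheaf J} (g : B ⟶ B') : tensorMap (0 : A ⟶ A') g = 0 :=
  tensor_hom_ext fun V a b => (tensorMap_tmul _ _ V a b).trans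
    (congrArg (fun k => k (g.hom.app V b)) (map_zero (tmul A' B' V)))

lemma tensorMap_zero_right {A' B' : AbSheaf J} (f : A ⟶ A') : tensorMap f (0 : B ⟶ B') = 0 :=
  tensor_hom_ext fun V a b => (tensorMap_tmul _ _ V a b).trans
    (map_zero (tmul A' B' V (f.hom.app V a)))

/-- The Alexander–Whitney cocycle vanishes on degenerate simplices: a simplex `σ₀ x` has a
degenerate front face, and a simplex `σ₁ x` a degenerate back face. -/
lemma degeneraciesVanish_alexanderWhitney :
    DegeneraciesVanish (X := diagTensor (EM A 1) (EM B 1))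
      (alexanderWhitney (EM A 1) (EM B 1) 2 ≫ tensorSingle A B 1 1) := by
  rw [alexanderWhitney_tensorSingle]
  have hv : ∀ M : AbSheaf J, (EM M 1).σ 0 ≫ emVal M 1 = 0 := fun M =>
    (degeneraciesVanish_emVal M 1).σ_comp 0
  intro i
  refine (tensorMap_comp _ _ _ _).trans ?_
  fin_cases i
  · have h : (EM A 1).σ (0 : Fin 2) ≫ (EM A 1).δ (2 : Fin 3) =
        (EM A 1).δ (1 : Fin 2) ≫ (EM A 1).σ (0 : Fin 1) :=
      (EM A 1).δ_comp_σ_of_gt (i := (1 : Fin 2)) (j := (0 : Fin 1)) (by decide)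
    have h1 : (EM A 1).σ (0 : Fin 2) ≫ (EM A 1).δ (2 : Fin 3) ≫ emVal A 1 = 0 := by
      rw [reassoc_of% h, hv, Limits.comp_zero]
    exact (congrArg (fun k => tensorMap k _) h1).trans (tensorMap_zero_left _ _ _)
  · have h : (EM B 1).σ (1 : Fin 2) ≫ (EM B 1).δ (0 : Fin 3) =
        (EM B 1).δ (0 : Fin 2) ≫ (EM B 1).σ (0 : Fin 1) :=
      (EM B 1).δ_comp_σ_of_le (i := (0 : Fin 2)) (j := (0 : Fin 1)) (by decide)
    have h1 : (EM B 1).σ (1 : Fin 2) ≫ (EM B 1).δ (0 : Fin 3) ≫ emVal B 1 = 0 := by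
      rw [reassoc_of% h, hv, Limits.comp_zero]
    exact (congrArg (fun k => tensorMap _ k) h1).trans (tensorMap_zero_right _ _ _)

/-- The fundamental cocycle of `K(A ⊗ B, 2)` is pulled back to the cocycle
`(a, b, a', b') ↦ a ⊗ b'` of `B(A × B)`. -/
lemma toProduct_cup_fundamentalCocycle :
    (toProduct A B ≫ cup A B).app (op ⦋2⦌) ≫ (fundamentalCocycle (tensor A B) 2).toHom =
      cupValue A B := by
  have h1 : (mapToEM (diagTensor (EM A 1) (EM B 1))
      (alexanderWhitney (EM A 1) (EM B 1) 2 ≫ tensorSingle A B 1 1)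
        (d_alexanderWhitney A B)).app (op ⦋2⦌) ≫ emVal (tensor A B) 2 = 
      tensorMap ((EM A 1).δ (2 : Fin 3) ≫ emVal A 1) ((EM B 1).δ (0 : Fin 3) ≫ emVal B 1) :=
    (mapToEM_emVal _ _ (degeneraciesVanish_alexanderWhitney A B)).trans
      (alexanderWhitney_tensorSingle A B)
  ext V x
  let p : ((underlying.obj (EM A 1) ⨯ underlying.obj (EM B 1)).obj (op ⦋2⦌)).obj.obj V :=
    ((toProduct A B).app (op ⦋2⦌)).hom.app V x
  refine (congrArg (fun k => k.hom.app V (tmul _ _ V (fstVal (op ⦋2⦌) V p)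
    (sndVal (op ⦋2⦌) V p))) h1).trans ?_
  refine (tensorMap_tmul _ _ V _ _).trans ?_
  have hA : fstVal (op ⦋2⦌) V p = ((fstCocycle A B).toEM.app (op ⦋2⦌)).hom.app V x :=
    congrArg (fun k : classifying (prodGrp A B) ⟶ EMSet A 1 => (k.app (op ⦋2⦌)).hom.app V x)
      (Limits.prod.lift_fst (fstCocycle A B).toEM (sndCocycle A B).toEM)
  have hB : sndVal (op ⦋2⦌) V p = ((sndCocycle A B).toEM.app (op ⦋2⦌)).hom.app V x :=
    congrArg (fun k : classifying (prodGrp A B) ⟶ EMSet B 1 => (k.app (op ⦋2⦌)).hom.app V x)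
      (Limits.prod.lift_snd (fstCocycle A B).toEM (sndCocycle A B).toEM)
  rw [hA, hB]
  refine congrArg₂ (fun a b => tmul A B V a b) ?_ ?_
  · have h := ((fstCocycle A B).toEM.naturality (SimplexCategory.δ (2 : Fin 3)).op).symm
    refine (congrArg (fun k => (k ≫ (fundamentalCocycle A 1).toHom).hom.app V x) h).trans ?_
    exact congrArg (fun k => k.hom.app V (((classifying (prodGrp A B)).δ 2).hom.app V x))
      (toEM_fundamentalCocycle (fstCocycle A B) (Cocycle.degeneraciesVanish _))
  · have h := ((sndCocycle A B).toEM.naturality (SimplexCategory.δ (0 : Fin 3)).op).symm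
    refine (congrArg (fun k => (k ≫ (fundamentalCocycle B 1).toHom).hom.app V x) h).trans ?_
    exact congrArg (fun k => k.hom.app V (((classifying (prodGrp A B)).δ 0).hom.app V x))
      (toEM_fundamentalCocycle (sndCocycle A B) (Cocycle.degeneraciesVanish _))

end CupValue

end

end HeisenbergCup

/-- The class of the Heisenberg extension `0 → A ⊗ B → H_{A,B} → A × B → 0` corresponds to the
homotopy class of the cup product `δ_{1,1} : K(A, 1) × K(B, 1) ⟶ K(A ⊗ B, 2)`, which is given by
the cocycle `(a, b, a', b') ↦ a ⊗ b'`. -/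
theorem mainTheorem4 {C : Type u} [Category.{v} C] (J : GrothendieckTopology C) (A B : AbSheaf J)
    [HasDerivedCategory.{w} (AbSheaf J)] [HasDerivedCategory.{w'} (BAb (prodGrp A B))]
    [HasExt.{w''} (BAb (prodGrp A B))] :
    -- `B(A × B) = K(A × B, 1)` is identified with `K(A, 1) × K(B, 1)`
    IsIso (toProduct A B) ∧
    -- the map `K(A × B, 1) ⟶ K(A ⊗ B, 2)` is given in degree `2` by `a ⊗ b'`
    (∀ (V : Cᵒᵖ) (a a' : A.obj.obj V) (b b' : B.obj.obj V),
      valAb (fundamentalCocycle (tensor A B) 2).toHom V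
        (((toProduct A B ≫ cup A B).app (op ⦋2⦌)).hom.app V
          ((BarSimplex.equiv 2 _).symm
            ![Multiplicative.ofAdd (a, b), Multiplicative.ofAdd (a', b')])) =
        tmul A B V a b') ∧
    -- the identification of `H²(B_{A × B}, A ⊗ B)` with `ℍ²(K(A × B, 1), A ⊗ B)`
    Function.Bijective (fromCohomology (universalTotal (prodGrp A B)) :
      Sheaf.H ((trivAb (prodGrp A B)).obj (tensor A B)) 2 → _) ∧
    Function.Bijective (pullbackToUniversal (prodGrp A B) :
      HH (classifying (prodGrp A B)) (tensor A B) 2 → _) ∧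
    -- the class of the extension is the class of `δ_{1,1}`
    ∃ c : Sheaf.H ((trivAb (prodGrp A B)).obj (tensor A B)) 2,
      (∀ c', IsExtensionClass (heisenbergExtension A B) c' ↔ c' = c) ∧
      fromCohomology (universalTotal (prodGrp A B)) c =
        pullbackToUniversal (prodGrp A B)
          (HH.pullback (toProduct A B)
            (HH.pullback (cup A B) (fundamentalClass (tensor A B) 2))) := by
  have h2 := toProduct_cup_fundamentalCocycle A B
  refine ⟨isIso_toProduct A B, fun V a a' b b' => ?_,
    fromCohomology_universalTotal_bijective _ _ 2, pullbackToUniversal_bijective _ _ 2, ?_⟩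
  · let y : Fin 2 → Multiplicative (A.obj.obj V × B.obj.obj V) :=
      ![Multiplicative.ofAdd (a, b), Multiplicative.ofAdd (a', b')]
    have hy := (BarSimplex.equiv 2 _).apply_symm_apply y
    refine (congrArg (fun k : (classifying (prodGrp A B)) _⦋2⦌ ⟶ (forgetAb J).obj (tensor A B) =>
      k.hom.app V ((BarSimplex.equiv 2 _).symm y)) h2).trans ?_
    exact congrArg₂ (fun s t => tmul A B V s t) (congrArg (fun t => (t 0).toAdd.1) hy)
      (congrArg (fun t => (t 1).toAdd.2) hy)
  · let z : Cocycle (classifying (prodGrp A B)) (tensor A B) 2 :=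
      (fundamentalCocycle (tensor A B) 2).comp (toProduct A B ≫ cup A B)
    let z' : Cocycle (universalTotal (prodGrp A B)) ((trivAb (prodGrp A B)).obj (tensor A B)) 2 :=
      (heisenbergDatum A B).cocycle
    -- the cocycle of the Heisenberg extension on `E(A × B)` is the pullback of the one of the cup
    -- product on `B(A × B)`
    have hz : z'.toHom = (universalProj (prodGrp A B)).app (op ⦋2⦌) ≫
        (trivSet (prodGrp A B)).map z.toHom :=
      congrArg (fun k : (classifying (prodGrp A B)) _⦋2⦌ ⟶ (forgetAb J).obj (tensor A B) =>
        (universalProj (prodGrp A B)).app (op ⦋2⦌) ≫ (trivSet (prodGrp A B)).map k) h2.symm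
    have hcls : HH.pullback (toProduct A B)
        (HH.pullback (cup A B) (fundamentalClass (tensor A B) 2)) = z.cls :=
      (congrArg (HH.pullback (toProduct A B)) (pullback_cls (cup A B) _
        ((fundamentalCocycle (tensor A B) 2).comp (cup A B)) rfl)).trans
        (pullback_cls (toProduct A B) _ z (Category.assoc _ _ _).symm)
    have hbij := fromCohomology_universalTotal_bijective (prodGrp A B)
      ((trivAb (prodGrp A B)).obj (tensor A B)) 2
    obtain ⟨c, hc⟩ := hbij.2 z'.cls
    refine ⟨c, fun c' => (isExtensionClass_heisenberg_iff A B z' rfl c').trans ?_, ?_⟩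
    · rw [← hc]
      exact hbij.1.eq_iff
    · rw [hcls, pullbackToUniversal_cls (prodGrp A B) z z' hz, hc]
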